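/- **Notation.** For $p\in\mathbb R^3$ let $\langle p\rangle=\sqrt{1+|p|^2}$, and for $p,q\in\mathbb R^3$ let $\tau=\langle p\rangle\langle q\rangle-p\cdot q+1$, $$\Lambda(p,q)=\frac{(\tau-1)^2}{\langle p\rangle\langle q\rangle}[\tau(\tau-2)]^{-3/2},\qquad \Phi^{ij}(p,q)=\Lambda(p,q)\big(\tau(\tau-2)\delta_{ij}-(p_i-q_i)(p_j-q_j)+(\tau-2)(p_iq_j+p_jq_i)\big).$$ For a function $g(t,x,p)$ of $(t,x,p)\in\mathbb R\times\mathbb R^3\times\mathbb R^3$ let $$a^g_{ij}(t,x,p)=\int_{\mathbb R^3}\Phi^{ij}(p,q)\,g(t,x,q)\,dq,\qquad b^g_j(t,x,p)=2\int_{\mathbb R^3}\Lambda(p,q)(\tau-2)(p_j+q_j)\,g(t,x,q)\,dq,$$ $$c^g(t,x,p)=4\int_{\mathbb R^3}\frac{1}{\langle p\rangle\langle q\rangle}\frac{\tau-1}{\sqrt{\tau(\tau-2)}}\,g(t,x,q)\,dq+\kappa(p)\,g(t,x,p),\qquad \kappa(p)=2^{7/2}\pi\langle p\rangle\int_0^\pi(1+|p|^2\sin^2\theta)^{-3/2}\sin\theta\,d\theta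 .$$ For $z=(t,x,p)$, $z_0=(t_0,x_0,p_0)$ let $$d_{\mathcal L}(z,z_0)=|\langle p_0\rangle(t-t_0)-p_0\cdot(x-x_0)|^{1/2}+|(x-x_0)_\perp+\langle p_0\rangle(x-x_0)_\parallel-p_0(t-t_0)|^{1/3}+|p_\perp+\langle p_0\rangle p_\parallel-p_0\langle p\rangle|,$$ where $w_\parallel$ is the orthogonal projection of $w$ onto the line spanned by $p_0$ ($w_\parallel=0$ if $p_0=0$) and $w_\perp=w-w_\parallel$. For $\alpha\in(0,1)$ and $U\subset\mathbb R^7$ let $$\|u\|_{C^\alpha_{\mathcal L}(U)}=\sup_{z\ne z_0\in U}\frac{|u(z)-u(z_0)|}{d_{\mathcal L}(z,z_0)^\alpha}+\sup_U|u|.$$ **Proposition 7.8.** Let $\Omega\subset\mathbb R\times\mathbb R^3$ be open, $m\in\mathbb N$, and let $\beta_x,\beta_p\in\mathbb N^3$ be multi-indices (ordered componentwise). Assume that (i) all partial derivatives $\partial_t^{m'}\partial_x^{\gamma_x}\partial_p^{\gamma_p}g$ with $m'\le m$, $\gamma_x\le\beta_x$, $\gamma_p\le\beta_p$ exist and are continuous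 on $\Omega\times\mathbb R^3$; (ii) for all $m'\le m$, $\gamma\le\beta_x$, every point of $\Omega$ has a neighbourhood $V$ and an integrable $w:\mathbb R^3\to\mathbb R$ with $|\partial_t^{m'}\partial_x^{\gamma}g(t,x,p)|\le w(p)$ for all $(t,x)\in V$, $p\in\mathbb R^3$. *(Pointwise bounds.)* Suppose that for some $k>9+|\beta_p|$ and $C_k>0$, $$|\partial_t^m\partial_x^{\beta_x}\partial_p^{\widetilde\beta}g(t,x,p)|\le C_k\langle p\rangle^{-k}\qquad\text{for all }\widetilde\beta\le\beta_p,\ (t,x,p)\in\Omega\times\mathbb R^3 .$$ Then the partial derivatives of $a^g_{ij},b^g_j,c^g$ of orders as in (i) exist and are continuous on $\Omega\times\mathbb R^3$, and for all $i,j$ and all $(t,x,p)\in\Omega\times\mathbb R^3$, $$|\partial_t^m\partial_x^{\beta_x}\partial_p^{\beta_p}a^g_{ij}|\le C\langle p\rangle^{-|\beta_p|},\qquad |\partial_t^m\partial_x^{\beta_x}\partial_p^{\beta_p}b^g_{j}|\le C\langle p\rangle^{1-|\beta_p|},\qquad |\partial_t^m\partial_x^{\beta_x}\partial_p^{\beta_p}c^g|\le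 C\langle p\rangle^{-|\beta_p|},$$ with $C>0$ depending only on $k$, $|\beta_p|$ and $C_k$. *(Hölder bounds.)* Let $\alpha\in(0,1)$, and suppose that for some $\ell>10+\max\{|\beta_p|,\alpha/2\}$ and $C_\ell>0$, $$\|\langle p\rangle^\ell\,\partial_t^m\partial_x^{\beta_x}\partial_p^{\widetilde\beta}g\|_{C^\alpha_{\mathcal L}(\Omega\times\mathbb R^3)}\le C_\ell\qquad\text{for all }\widetilde\beta\le\beta_p .$$ Then, with $s=\min\{-\alpha,|\beta_p|-1\}$, for all $i,j$, $$\|\langle p\rangle^{s}\,\partial_t^m\partial_x^{\beta_x}\partial_p^{\beta_p}a^g_{ij}\|_{C^{2\alpha/3}_{\mathcal L}(\Omega\times\mathbb R^3)}\le C,\qquad \|\langle p\rangle^{-1+s}\,\partial_t^m\partial_x^{\beta_x}\partial_p^{\beta_p}b^g_{j}\|_{C^{2\alpha/3}_{\mathcal L}(\Omega\times\mathbb R^3)}\le C,\qquad \|\langle p\rangle^{s}\,\partial_t^m\partial_x^{\beta_x}\partial_p^{\beta_p}c^g\|_{C^{2\alpha/3}_{\mathcal L}(\Omega\times\mathbb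 R^3)}\le C,$$ with $C>0$ depending only on $\ell$, $|\beta_p|$, $\alpha$ and $C_\ell$. -/

import Mathlib

open MeasureTheory Filter Topology
open scoped ENNReal InnerProductSpace

namespace RelLandau

noncomputable section

/-- Position and momentum space `ℝ³`, with the Euclidean norm. -/
abbrev R3 : Type := EuclideanSpace ℝ (Fin 3)

/-- Points `z = (t, x, p)` of `ℝ⁷ = ℝ × ℝ³ × ℝ³`. -/
abbrev Phase : Type := ℝ × R3 × R3

/-- The bracket `⟨p⟩ = √(1 + |p|²)`. -/
def bracket (p : R3) : ℝ := √(1 + ‖p‖ ^ 2)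

/-! ### The collision kernel and the coefficients -/

/-- `τ = ⟨p⟩⟨q⟩ - p·q + 1`. -/
def tau (p q : R3) : ℝ := bracket p * bracket q - ⟪p, q⟫_ℝ + 1

/-- `Λ(p,q) = (τ-1)² / (⟨p⟩⟨q⟩) · [τ(τ-2)]^{-3/2}`. -/
def Lam (p q : R3) : ℝ :=
  (tau p q - 1) ^ 2 / (bracket p * bracket q)
    * (tau p q * (tau p q - 2)) ^ (-(3 / 2) : ℝ)

/-- `S^{ij}(p,q) = τ(τ-2) δ_{ij} - (p_i-q_i)(p_j-q_j) + (τ-2)(p_i q_j + p_j q_i)`. -/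
def Smat (i j : Fin 3) (p q : R3) : ℝ :=
  tau p q * (tau p q - 2) * (if i = j then 1 else 0)
    - (p i - q i) * (p j - q j)
    + (tau p q - 2) * (p i * q j + p j * q i)

/-- The kernel `Φ^{ij} = Λ S^{ij}`. -/
def Phi (i j : Fin 3) (p q : R3) : ℝ := Lam p q * Smat i j p q

/-- `κ(p) = 2^{7/2} π ⟨p⟩ ∫₀^π (1 + |p|² sin² θ)^{-3/2} sin θ dθ`. -/
def kappa (p : R3) : ℝ :=
  (2 : ℝ) ^ (7 / 2 : ℝ) * Real.pi * bracket p
    * ∫ θ in (0 : ℝ)..Real.pi,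
        (1 + ‖p‖ ^ 2 * Real.sin θ ^ 2) ^ (-(3 / 2) : ℝ) * Real.sin θ

/-- `a^g_{ij}(t,x,p) = ∫ Φ^{ij}(p,q) g(t,x,q) dq`. -/
def aCoeff (i j : Fin 3) (g : Phase → ℝ) (z : Phase) : ℝ :=
  ∫ q : R3, Phi i j z.2.2 q * g (z.1, z.2.1, q)

/-- `b^g_j(t,x,p) = 2 ∫ Λ(p,q) (τ-2) (p_j + q_j) g(t,x,q) dq`. -/
def bCoeff (j : Fin 3) (g : Phase → ℝ) (z : Phase) : ℝ :=
  2 * ∫ q : R3,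
    Lam z.2.2 q * (tau z.2.2 q - 2) * (z.2.2 j + q j) * g (z.1, z.2.1, q)

/-- `c^g(t,x,p) = 4 ∫ (τ-1) / (⟨p⟩⟨q⟩ √(τ(τ-2))) g(t,x,q) dq + κ(p) g(t,x,p)`. -/
def cCoeff (g : Phase → ℝ) (z : Phase) : ℝ :=
  4 * (∫ q : R3,
      1 / (bracket z.2.2 * bracket q)
        * ((tau z.2.2 q - 1) / √(tau z.2.2 q * (tau z.2.2 q - 2)))
        * g (z.1, z.2.1, q))
    + kappa z.2.2 * g z

/-! ### Partial derivatives -/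

/-- Unit vector of `ℝ⁷` in the `t` direction. -/
def dirT : Phase := (1, 0, 0)

/-- Unit vector of `ℝ⁷` in the `x_i` direction. -/
def dirX (i : Fin 3) : Phase := (0, EuclideanSpace.single i 1, 0)

/-- Unit vector of `ℝ⁷` in the `p_i` direction. -/
def dirP (i : Fin 3) : Phase := (0, 0, EuclideanSpace.single i 1)

/-- The derivative of `u` in the direction `v`, as an operator on functions. -/
def pd (v : Phase) (u : Phase → ℝ) : Phase → ℝ := fun z => lineDeriv ℝ u z v

/-- `∂_t^m ∂_x^{βx} ∂_p^{βp} u`, with the momentum derivatives taken first. -/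
def mixed (m : ℕ) (βx βp : Fin 3 → ℕ) (u : Phase → ℝ) : Phase → ℝ :=
  (pd dirT)^[m]
    ((pd (dirX 0))^[βx 0] ((pd (dirX 1))^[βx 1] ((pd (dirX 2))^[βx 2]
      ((pd (dirP 0))^[βp 0] ((pd (dirP 1))^[βp 1] ((pd (dirP 2))^[βp 2] u))))))

/-- The order `|β| = β₁ + β₂ + β₃` of a multi-index. -/
def order (β : Fin 3 → ℕ) : ℕ := ∑ i, β i

/-- The cylinder `Ω × ℝ³_p`, for `Ω ⊆ ℝ × ℝ³`. -/
def cyl (Ω : Set (ℝ × R3)) : Set Phase := {z | (z.1, z.2.1) ∈ Ω}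

/-- All partial derivatives `∂_t^{m'} ∂_x^{γx} ∂_p^{γp} u` with `m' ≤ m`, `γx ≤ βx`, `γp ≤ βp`
exist (as genuine derivatives, not through a default value) and are continuous on `U`. -/
def HasMixedDerivs (U : Set Phase) (m : ℕ) (βx βp : Fin 3 → ℕ) (u : Phase → ℝ) : Prop :=
  ∀ m' ≤ m, ∀ γx ≤ βx, ∀ γp ≤ βp,
    ContinuousOn (mixed m' γx γp u) U ∧
    (m' < m → ∀ z ∈ U, LineDifferentiableAt ℝ (mixed m' γx γp u) z dirT) ∧
    (∀ i, γx i < βx i → ∀ z ∈ U, LineDifferentiableAt ℝ (mixed m' γx γp u) z (dirX i)) ∧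
    (∀ i, γp i < βp i → ∀ z ∈ U, LineDifferentiableAt ℝ (mixed m' γx γp u) z (dirP i))

/-- The derivatives `∂_t^{m'} ∂_x^{γ} g` with `m' ≤ m`, `γ ≤ βx` are dominated, locally uniformly
in `(t,x) ∈ Ω`, by an integrable function of the momentum. This makes the integrals defining the
coefficients converge and be differentiable in `(t,x)` under the integral sign; it is purely
qualitative. -/
def LocallyDominated (Ω : Set (ℝ × R3)) (m : ℕ) (βx : Fin 3 → ℕ) (g : Phase → ℝ) : Prop :=
  ∀ m' ≤ m, ∀ γ ≤ βx, ∀ y ∈ Ω, ∃ w : R3 → ℝ, Integrable w ∧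
    ∀ᶠ y' in 𝓝 y, ∀ q : R3, |mixed m' γ 0 g (y'.1, y'.2, q)| ≤ w q

/-! ### The Lorentzian distance and Hölder norms -/

/-- `w_∥ = (w · p̂) p̂` with `p̂ = p/|p|` (and `w_∥ = 0` for `p = 0`). -/
def par (p w : R3) : R3 := ⟪w, ‖p‖⁻¹ • p⟫_ℝ • (‖p‖⁻¹ • p)

/-- `w_⊥ = w - w_∥`. -/
def perp (p w : R3) : R3 := w - par p w

/-- The inverse Lorentz boost `z₀⁻¹ ∘ z`. -/
def boostInv (z₀ z : Phase) : Phase :=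
  (bracket z₀.2.2 * (z.1 - z₀.1) - ⟪z₀.2.2, z.2.1 - z₀.2.1⟫_ℝ,
   perp z₀.2.2 (z.2.1 - z₀.2.1) + bracket z₀.2.2 • par z₀.2.2 (z.2.1 - z₀.2.1)
     - (z.1 - z₀.1) • z₀.2.2,
   perp z₀.2.2 z.2.2 + bracket z₀.2.2 • par z₀.2.2 z.2.2 - bracket z.2.2 • z₀.2.2)

/-- `‖(t,x,p)‖ = |t|^{1/2} + |x|^{1/3} + |p|`. -/
def kinNorm (z : Phase) : ℝ :=
  |z.1| ^ (1 / 2 : ℝ) + ‖z.2.1‖ ^ (1 / 3 : ℝ) + ‖z.2.2‖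

/-- The relativistic kinetic distance `d_L(z, z₀) = ‖z₀⁻¹ ∘ z‖`. -/
def distL (z z₀ : Phase) : ℝ := kinNorm (boostInv z₀ z)

/-- The norm `‖u‖_{C^α_L(U)} = [u]_{C^α_L(U)} + sup_U |u|`, with values in `[0,∞]`
(pairs `z = z₀` contribute `0 / 0 = 0` to the seminorm). -/
def holderNorm (α : ℝ) (U : Set Phase) (u : Phase → ℝ) : ℝ≥0∞ :=
  (⨆ z ∈ U, ⨆ z₀ ∈ U, ENNReal.ofReal (|u z - u z₀| / distL z z₀ ^ α))
    + ⨆ z ∈ U, ENNReal.ofReal |u z|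

/-- Multiplication of `u` by the weight `⟨p⟩^s`. -/
def weighted (s : ℝ) (u : Phase → ℝ) : Phase → ℝ := fun z => bracket z.2.2 ^ s * u z

end

end RelLandau

namespace RelLandau

/-! ### Elementary inequalities for the bracket and the relative Lorentz factor -/

/-! In terms of the relative Lorentz factor γ = τ - 1, each of the three integral kernels is a
scalar factor h(γ) = γ²(γ-1)^{-1/2}(γ+1)^{-3/2} times a bounded function. Since |p-q|² ≤
2⟨p⟩⟨q⟩(γ-1), the singularity on the diagonal is only of order |p-q|^{-1}. Repeated differentiation
in p would still destroy integrability. The remedy is the field B_i = ⟨p⟩∂_{p_i} + ⟨q⟩∂_{q_i}, which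
generates Lorentz boosts acting on both momenta. It annihilates γ, hence h, and preserves an algebra
of bounded symbols (`Sym.exists_boost`). Writing ⟨p⟩∂_{p_i} = B_i - ⟨q⟩∂_{q_i} and integrating by
parts in q gives ∂_{p_i} ∫ N g dq = ∫ ⟨p⟩^{-1} (B_i N + (q_i/⟨q⟩) N) g dq + ∫ ⟨p⟩^{-1}⟨q⟩ N ∂_{q_i}
g dq (`SingKernel.integral_fderiv`, `SingKernel.hasLineDerivAt_integral`). Each derivative thus
gains ⟨p⟩^{-1}, costs at most one power of ⟨q⟩ and one derivative of g, and leaves the singularity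
unchanged. This is the origin of the decay ⟨p⟩^{-|β_p|}.

Two regularisations make this rigorous. Replacing γ-1 by γ-1+ε smooths the kernel; all bounds are
uniform in ε, and ε tends to 0. A cut-off in δ⟨q⟩² gives the kernel compact support in q, as the
qualitative hypotheses control neither the growth nor the integrability of the momentum derivatives
of g. On the complementary part q is large compared with p, so the kernel is regular and takes all
momentum derivatives itself (`FarSym`). The resulting class `Op` is closed under differentiation
(`Op.exists_deriv`), which yields existence and continuity of the derivatives. For the quantitative
bounds, δ tends to 0: the far part disappears and the near bounds are uniform in δ
(`Op.exists_pointwise`). The local term of c fits the same scheme because κ(p) is a constant times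
1/⟨p⟩ (`kappa_eq`).

For the Hölder bounds (`Op.exists_holder`), the increment is split into a change of (t,x) at fixed
momentum and a change of momentum at fixed (t,x). The first is measured by `distL_transport_le`:
viewed from another frame, a time shift of size d² also becomes a space shift of size d², whose cube
root is d^{2/3}; this turns α into 2α/3 and costs ⟨p⟩^{α/2}. The second is Lipschitz
(`exists_near_lipschitz`), because one derivative of the kernel is of order |p-q|^{-2}, which is
locally integrable in three dimensions. -/

theorem one_le_bracket (p : R3) : 1 ≤ bracket p := by
  unfold bracket
  exact Real.one_le_sqrt.2 (by nlinarith [sq_nonneg ‖p‖])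

theorem bracket_pos (p : R3) : 0 < bracket p := lt_of_lt_of_le one_pos (one_le_bracket p)

theorem bracket_ne_zero (p : R3) : bracket p ≠ 0 := (bracket_pos p).ne'

theorem bracket_sq (p : R3) : bracket p ^ 2 = 1 + ‖p‖ ^ 2 := by
  unfold bracket
  exact Real.sq_sqrt (by positivity)

theorem norm_lt_bracket (p : R3) : ‖p‖ < bracket p := by
  have h := bracket_sq p
  nlinarith [norm_nonneg p, bracket_pos p]

theorem abs_coord_le_norm (p : R3) (i : Fin 3) : |p i| ≤ ‖p‖ := by
  simpa using PiLp.norm_apply_le p i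

theorem abs_coord_le_bracket (p : R3) (i : Fin 3) : |p i| ≤ bracket p :=
  (abs_coord_le_norm p i).trans (norm_lt_bracket p).le

/-- The relative Lorentz factor `γ = ⟨p⟩⟨q⟩ - p·q = τ - 1`. -/
noncomputable def gam (p q : R3) : ℝ := bracket p * bracket q - ⟪p, q⟫_ℝ

theorem tau_eq_gam (p q : R3) : tau p q = gam p q + 1 := rfl

theorem gam_comm (p q : R3) : gam p q = gam q p := by
  unfold gam
  rw [real_inner_comm, mul_comm]

theorem one_add_norm_mul_norm_le (p q : R3) : 1 + ‖p‖ * ‖q‖ ≤ bracket p * bracket q := by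
  apply le_of_sq_le_sq _ (by nlinarith [bracket_pos p, bracket_pos q])
  rw [mul_pow, bracket_sq, bracket_sq]
  nlinarith [sq_nonneg (‖p‖ - ‖q‖)]

theorem abs_bracket_sub_le (p q : R3) : |bracket p - bracket q| ≤ ‖p - q‖ := by
  have hp := bracket_sq p
  have hq := bracket_sq q
  have h := one_add_norm_mul_norm_le p q
  refine (sq_le_sq.1 ?_ : |bracket p - bracket q| ≤ |‖p‖ - ‖q‖|).trans
    (abs_norm_sub_norm_le p q)
  nlinarith

theorem one_le_gam (p q : R3) : 1 ≤ gam p q := by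
  have := one_add_norm_mul_norm_le p q
  have := real_inner_le_norm p q
  unfold gam
  linarith

theorem gam_pos (p q : R3) : 0 < gam p q := lt_of_lt_of_le one_pos (one_le_gam p q)

theorem gam_le (p q : R3) : gam p q ≤ 2 * (bracket p * bracket q) := by
  have := one_add_norm_mul_norm_le p q
  have := neg_le_of_abs_le (abs_real_inner_le_norm p q)
  unfold gam
  linarith

/-- Rationalisation: γ - 1 = X - Y with X = ⟨p⟩⟨q⟩ and Y = 1 + p·q, and the right-hand side is X² -
Y². -/
theorem gam_sub_one_mul (p q : R3) :
    (gam p q - 1) * (bracket p * bracket q + ⟪p, q⟫_ℝ + 1)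
      = ‖p - q‖ ^ 2 + (‖p‖ ^ 2 * ‖q‖ ^ 2 - ⟪p, q⟫_ℝ ^ 2) := by
  have hp := bracket_sq p
  have hq := bracket_sq q
  have h := norm_sub_sq_real p q
  unfold gam
  have : (bracket p * bracket q) ^ 2 = (1 + ‖p‖ ^ 2) * (1 + ‖q‖ ^ 2) := by
    rw [mul_pow, hp, hq]
  nlinarith

/-- The basic lower bound on γ - 1. The Gram determinant in `gam_sub_one_mul` is nonnegative by
Cauchy-Schwarz and can be dropped; γ ≥ 1 bounds the cofactor by 2⟨p⟩⟨q⟩. -/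
theorem norm_sub_sq_le (p q : R3) :
    ‖p - q‖ ^ 2 ≤ 2 * (bracket p * bracket q) * (gam p q - 1) := by
  have h := gam_sub_one_mul p q
  have h1 := one_le_gam p q
  have h2 : ⟪p, q⟫_ℝ ^ 2 ≤ ‖p‖ ^ 2 * ‖q‖ ^ 2 := by
    rw [← mul_pow]
    exact sq_le_sq.2 (by simpa [abs_mul] using abs_real_inner_le_norm p q)
  have h3 : bracket p * bracket q + ⟪p, q⟫_ℝ + 1 ≤ 2 * (bracket p * bracket q) := by
    have := one_le_gam p q
    unfold gam at this
    linarith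
  nlinarith

theorem one_lt_gam {p q : R3} (h : p ≠ q) : 1 < gam p q := by
  have h1 := norm_sub_sq_le p q
  have h2 : 0 < ‖p - q‖ := norm_pos_iff.2 (sub_ne_zero.2 h)
  have h3 : 0 < bracket p * bracket q := mul_pos (bracket_pos p) (bracket_pos q)
  by_contra h4
  have : gam p q - 1 ≤ 0 := by linarith
  nlinarith

/-- Follows from γ ≥ ⟨p⟩(⟨q⟩ - |q|) and ⟨q⟩ - |q| = 1/(⟨q⟩+|q|) ≥ 1/(2⟨q⟩). It trades powers of ⟨p⟩
for powers of ⟨q⟩, which the decay of g absorbs; in particular ⟨p⟩ ≤ 4⟨q⟩ where γ ≤ 2. -/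
theorem bracket_le_two_mul_gam (p q : R3) : bracket p ≤ 2 * bracket q * gam p q := by
  have hp := norm_lt_bracket p
  have hq := norm_lt_bracket q
  have hq2 := bracket_sq q
  have h1 := real_inner_le_norm p q
  have h2 := bracket_pos p
  have h3 := bracket_pos q
  have h4 : 1 / 2 ≤ bracket q * (bracket q - ‖q‖) := by nlinarith [norm_nonneg q]
  have h5 : bracket p * (bracket q - ‖q‖) ≤ gam p q := by
    unfold gam
    nlinarith [norm_nonneg q]
  nlinarith

/-- A convenient bound for the singular factors of the kernels near the diagonal. -/
theorem inv_sqrt_gam_sub_one_le {p q : R3} (h : p ≠ q) (h2 : gam p q ≤ 2) :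
    1 / √(gam p q - 1) ≤ 3 * bracket q * ‖p - q‖⁻¹ := by
  have hγ := one_lt_gam h
  have h1 := norm_sub_sq_le p q
  have h3 := bracket_le_two_mul_gam p q
  have hq := bracket_pos q
  have hp := bracket_pos p
  have hpq : 0 < ‖p - q‖ := norm_pos_iff.2 (sub_ne_zero.2 h)
  have hs : 0 < √(gam p q - 1) := Real.sqrt_pos.2 (by linarith)
  have hss : √(gam p q - 1) ^ 2 = gam p q - 1 := Real.sq_sqrt (by linarith)
  have h4 : bracket p ≤ 4 * bracket q := by nlinarith
  have h5 : ‖p - q‖ ^ 2 ≤ (3 * bracket q * √(gam p q - 1)) ^ 2 := by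
    rw [mul_pow, mul_pow, hss]
    have : bracket p * bracket q ≤ 4 * bracket q ^ 2 := by nlinarith
    nlinarith
  have h6 : ‖p - q‖ ≤ 3 * bracket q * √(gam p q - 1) :=
    le_of_sq_le_sq h5 (by positivity)
  rw [div_le_iff₀ hs, mul_assoc, mul_comm (‖p - q‖⁻¹), ← mul_assoc, ← div_eq_mul_inv,
    le_div_iff₀ hpq]
  linarith

theorem inv_sqrt_gam_sub_one_le' {p q : R3} (h : p ≠ q) :
    1 / √(gam p q - 1) ≤ 3 * bracket q * (1 + ‖p - q‖⁻¹) := by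
  have hq := one_le_bracket q
  have hi : 0 ≤ ‖p - q‖⁻¹ := by positivity
  rcases le_total (gam p q) 2 with h2 | h2
  · have := inv_sqrt_gam_sub_one_le h h2
    nlinarith
  · have h1 : 1 ≤ √(gam p q - 1) := Real.one_le_sqrt.2 (by linarith)
    have : 1 / √(gam p q - 1) ≤ 1 := by
      rw [div_le_one (by linarith)]
      exact h1
    nlinarith [mul_nonneg (by linarith : 0 ≤ bracket q) hi]

/-- The vector ⟨q⟩p - ⟨p⟩q is ⟨p⟩∇_p γ. It vanishes on the diagonal, hence the linear bound. -/
theorem norm_bracket_smul_sub_le (p q : R3) :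
    ‖bracket q • p - bracket p • q‖ ≤ 2 * bracket q * ‖p - q‖ := by
  have h1 : bracket q • p - bracket p • q
      = bracket q • (p - q) + (bracket q - bracket p) • q := by module
  rw [h1]
  refine (norm_add_le _ _).trans ?_
  rw [norm_smul, norm_smul, Real.norm_eq_abs, Real.norm_eq_abs, abs_of_pos (bracket_pos q)]
  have h2 := abs_bracket_sub_le q p
  rw [norm_sub_rev] at h2
  have := norm_lt_bracket q
  have := mul_le_mul h2 this.le (norm_nonneg _) (norm_nonneg _)
  linarith

theorem norm_bracket_smul_sub_le' (p q : R3) :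
    ‖bracket q • p - bracket p • q‖ ≤ 2 * (bracket p * bracket q) := by
  refine (norm_sub_le _ _).trans ?_
  rw [norm_smul, norm_smul, Real.norm_eq_abs, Real.norm_eq_abs, abs_of_pos (bracket_pos q),
    abs_of_pos (bracket_pos p)]
  nlinarith [norm_lt_bracket p, norm_lt_bracket q, bracket_pos p, bracket_pos q]

/-- Controls ⟨p⟩∇_p log(γ-1). Near the diagonal the numerator is O(|p-q|) and the denominator is at
least of order |p-q|², so one inverse power remains; where γ ≥ 2 the crude bound suffices. Only
powers of ⟨q⟩ are lost. -/
theorem norm_bracket_smul_sub_div_le {p q : R3} (h : p ≠ q) :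
    ‖bracket q • p - bracket p • q‖ / (gam p q - 1)
      ≤ 16 * bracket q ^ 3 * (1 + ‖p - q‖⁻¹) := by
  have hγ := one_lt_gam h
  have hq := one_le_bracket q
  have hp := one_le_bracket p
  have h0 : 0 < gam p q - 1 := by linarith
  have h3 := bracket_le_two_mul_gam p q
  have hpq : 0 < ‖p - q‖ := norm_pos_iff.2 (sub_ne_zero.2 h)
  have hi : 0 ≤ ‖p - q‖⁻¹ := by positivity
  have hq3 : bracket q ^ 2 ≤ bracket q ^ 3 := pow_le_pow_right₀ hq (by norm_num)
  rw [div_le_iff₀ h0]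
  rcases le_total (gam p q) 2 with h2 | h2
  · have h4 : bracket p ≤ 4 * bracket q := by nlinarith
    have h1 := norm_sub_sq_le p q
    have h5 := norm_bracket_smul_sub_le p q
    have h6 : ‖p - q‖ ^ 2 ≤ 8 * bracket q ^ 2 * (gam p q - 1) := by
      have : bracket p * bracket q ≤ 4 * bracket q ^ 2 := by nlinarith
      nlinarith
    have h7 : ‖p - q‖ ≤ 8 * bracket q ^ 2 * (gam p q - 1) * ‖p - q‖⁻¹ := by
      rw [← div_eq_mul_inv, le_div_iff₀ hpq]
      linarith
    calc _ ≤ 2 * bracket q * ‖p - q‖ := h5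
      _ ≤ 2 * bracket q * (8 * bracket q ^ 2 * (gam p q - 1) * ‖p - q‖⁻¹) := by gcongr
      _ = 16 * bracket q ^ 3 * (‖p - q‖⁻¹) * (gam p q - 1) := by ring
      _ ≤ _ := by gcongr; linarith
  · have h5 := norm_bracket_smul_sub_le' p q
    have h6 : gam p q ≤ 2 * (gam p q - 1) := by linarith
    have h8 : bracket p * bracket q ≤ 4 * bracket q ^ 2 * (gam p q - 1) := by nlinarith
    calc _ ≤ 2 * (bracket p * bracket q) := h5
      _ ≤ 2 * (4 * bracket q ^ 2 * (gam p q - 1)) := by gcongr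
      _ ≤ 16 * bracket q ^ 2 * 1 * (gam p q - 1) := by nlinarith [sq_nonneg (bracket q)]
      _ ≤ _ := by gcongr; linarith

/-- Serves the term ⟨p⟩/`den` that appears when a normalised difference of momenta is
differentiated; no power of ⟨p⟩ may survive there. -/
theorem bracket_div_sqrt_le {p q : R3} (h : p ≠ q) :
    bracket p / √((gam p q - 1) * (bracket p * bracket q))
      ≤ 6 * bracket q * (1 + ‖p - q‖⁻¹) := by
  have hγ := one_lt_gam h
  have hq := one_le_bracket q
  have hp := one_le_bracket p
  have h0 : 0 < gam p q - 1 := by linarith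
  have h3 := bracket_le_two_mul_gam p q
  have hpq : 0 < ‖p - q‖ := norm_pos_iff.2 (sub_ne_zero.2 h)
  have hi : 0 ≤ ‖p - q‖⁻¹ := by positivity
  have hs : 0 < √(gam p q - 1) := Real.sqrt_pos.2 h0
  rcases le_total (gam p q) 2 with h2 | h2
  · have h4 : bracket p ≤ 4 * bracket q := by nlinarith
    have h5 := inv_sqrt_gam_sub_one_le h h2
    have h6 : bracket p ≤ 2 * √(bracket p * bracket q) := by
      rw [show (2 : ℝ) = √4 by norm_num [show (4 : ℝ) = 2 ^ 2 by norm_num], ← Real.sqrt_mul (by norm_num)]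
      apply Real.le_sqrt_of_sq_le
      nlinarith
    rw [Real.sqrt_mul h0.le]
    have h7 : 0 < √(bracket p * bracket q) := Real.sqrt_pos.2 (by positivity)
    calc _ ≤ 2 * √(bracket p * bracket q) / (√(gam p q - 1) * √(bracket p * bracket q)) := by
          gcongr
      _ = 2 * (1 / √(gam p q - 1)) := by field_simp
      _ ≤ 2 * (3 * bracket q * ‖p - q‖⁻¹) := by gcongr
      _ ≤ _ := by nlinarith
  · have h6 : bracket p ^ 2 ≤ 4 ^ 2 * ((gam p q - 1) * (bracket p * bracket q)) := by
      have : bracket p ≤ 4 * bracket q * (gam p q - 1) := by nlinarith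
      nlinarith
    have h7 : bracket p ≤ 4 * √((gam p q - 1) * (bracket p * bracket q)) := by
      rw [show (4 : ℝ) = √(4 ^ 2) by norm_num, ← Real.sqrt_mul (by norm_num)]
      exact Real.le_sqrt_of_sq_le h6
    have h8 : 0 < √((gam p q - 1) * (bracket p * bracket q)) := Real.sqrt_pos.2 (by positivity)
    have : bracket p / √((gam p q - 1) * (bracket p * bracket q)) ≤ 4 := by
      rw [div_le_iff₀ h8]
      exact h7
    nlinarith [mul_nonneg (by linarith : 0 ≤ bracket q) hi]

/-! ### The symbol class -/

/-- The regularised singular factor `γ² (γ - 1 + ε)^{-1/2} (γ + 1)^{-3/2}`. -/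
noncomputable def hker (ε : ℝ) (p q : R3) : ℝ :=
  gam p q ^ 2 / (√(gam p q - 1 + ε) * √(gam p q + 1) ^ 3)

/-- The regularised normalisation `√((γ - 1 + ε)⟨p⟩⟨q⟩)` of the difference of four-momenta. -/
noncomputable def den (ε : ℝ) (p q : R3) : ℝ :=
  √((gam p q - 1 + ε) * (bracket p * bracket q))

/-- Bounded symbols, generated by homogeneous combinations that the boost fields
`⟨p⟩∂_{p_i} + ⟨q⟩∂_{q_i}` map into one another. The first argument is a regularisation
parameter. -/
inductive Sym : (ℝ → R3 → R3 → ℝ) → Prop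
  | const (c : ℝ) : Sym (fun _ _ _ => c)
  | pdir (i : Fin 3) : Sym (fun _ p _ => p i / bracket p)
  | pinv : Sym (fun _ p _ => 1 / bracket p)
  | qdir (i : Fin 3) : Sym (fun _ _ q => q i / bracket q)
  | qinv : Sym (fun _ _ q => 1 / bracket q)
  | gamma : Sym (fun _ p q => gam p q / (bracket p * bracket q))
  | gammaInv : Sym (fun _ p q => 1 / gam p q)
  | dtime : Sym (fun ε p q => (bracket p - bracket q) / den ε p q)
  | dspace (i : Fin 3) : Sym (fun ε p q => (p i - q i) / den ε p q)
  | add {v w} (hv : Sym v) (hw : Sym w) : Sym (fun ε p q => v ε p q + w ε p q)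
  | mul {v w} (hv : Sym v) (hw : Sym w) : Sym (fun ε p q => v ε p q * w ε p q)

/-! ### Smoothness of the bracket, the Lorentz factor and the symbols. -/

theorem contDiff_bracket : ContDiff ℝ 1 bracket := by
  unfold bracket
  refine ContDiff.sqrt (contDiff_const.add (contDiff_norm_sq ℝ)) fun p => by positivity

@[fun_prop]
theorem continuous_bracket : Continuous bracket := contDiff_bracket.continuous

theorem contDiff_gam : ContDiff ℝ 1 (fun x : ℝ × R3 × R3 => gam x.2.1 x.2.2) := by
  have h := contDiff_bracket
  unfold gam
  exact ((h.comp (by fun_prop)).mul (h.comp (by fun_prop))).sub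
    (ContDiff.inner ℝ (by fun_prop) (by fun_prop))

@[fun_prop]
theorem continuous_gam : Continuous (fun x : R3 × R3 => gam x.1 x.2) := by
  unfold gam
  fun_prop

theorem contDiffAt_den {ε : ℝ} {p q : R3} (h : 0 < gam p q - 1 + ε) :
    ContDiffAt ℝ 1 (fun x : ℝ × R3 × R3 => den x.1 x.2.1 x.2.2) (ε, p, q) := by
  have h1 := contDiff_bracket
  unfold den
  refine ContDiffAt.sqrt ?_ (mul_pos h (mul_pos (bracket_pos p) (bracket_pos q))).ne'
  exact (((contDiff_gam.sub contDiff_const).add contDiff_fst).mul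
    ((h1.comp (by fun_prop)).mul (h1.comp (by fun_prop)))).contDiffAt

theorem den_pos {ε : ℝ} {p q : R3} (h : 0 < gam p q - 1 + ε) : 0 < den ε p q :=
  Real.sqrt_pos.2 (mul_pos h (mul_pos (bracket_pos p) (bracket_pos q)))

theorem den_sq {ε : ℝ} {p q : R3} (h : 0 ≤ gam p q - 1 + ε) :
    den ε p q ^ 2 = (gam p q - 1 + ε) * (bracket p * bracket q) :=
  Real.sq_sqrt (mul_nonneg h (mul_pos (bracket_pos p) (bracket_pos q)).le)

theorem contDiffAt_hker {ε : ℝ} {p q : R3} (h : 0 < gam p q - 1 + ε) :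
    ContDiffAt ℝ 1 (fun x : ℝ × R3 × R3 => hker x.1 x.2.1 x.2.2) (ε, p, q) := by
  have h1 := one_le_gam p q
  unfold hker
  refine ContDiffAt.div (contDiff_gam.contDiffAt.pow 2) ?_ ?_
  · refine ContDiffAt.mul (ContDiffAt.sqrt ?_ h.ne') ((ContDiffAt.sqrt ?_ ?_).pow 3)
    · exact ((contDiff_gam.sub contDiff_const).add contDiff_fst).contDiffAt
    · exact (contDiff_gam.add contDiff_const).contDiffAt
    · simp only
      linarith
  · have : 0 < √(gam p q - 1 + ε) := Real.sqrt_pos.2 h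
    have : 0 < √(gam p q + 1) := Real.sqrt_pos.2 (by linarith)
    positivity

theorem Sym.contDiffAt {w : ℝ → R3 → R3 → ℝ} (hw : Sym w) {ε : ℝ} {p q : R3}
    (h : 0 < gam p q - 1 + ε) :
    ContDiffAt ℝ 1 (fun x : ℝ × R3 × R3 => w x.1 x.2.1 x.2.2) (ε, p, q) := by
  have hb := contDiff_bracket
  have hp : ContDiff ℝ 1 (fun x : ℝ × R3 × R3 => bracket x.2.1) := hb.comp (by fun_prop)
  have hq : ContDiff ℝ 1 (fun x : ℝ × R3 × R3 => bracket x.2.2) := hb.comp (by fun_prop)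
  have hpi (i : Fin 3) : ContDiff ℝ 1 (fun x : ℝ × R3 × R3 => x.2.1 i) := by fun_prop
  have hqi (i : Fin 3) : ContDiff ℝ 1 (fun x : ℝ × R3 × R3 => x.2.2 i) := by fun_prop
  have hg := contDiff_gam
  have hd := contDiffAt_den h
  have hd0 := (den_pos h).ne'
  induction hw with
  | const c => exact contDiffAt_const
  | pdir i => exact (hpi i).contDiffAt.div hp.contDiffAt (bracket_ne_zero p)
  | pinv => exact contDiffAt_const.div hp.contDiffAt (bracket_ne_zero p)
  | qdir i => exact (hqi i).contDiffAt.div hq.contDiffAt (bracket_ne_zero q)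
  | qinv => exact contDiffAt_const.div hq.contDiffAt (bracket_ne_zero q)
  | gamma =>
    exact hg.contDiffAt.div (hp.mul hq).contDiffAt
      (mul_pos (bracket_pos p) (bracket_pos q)).ne'
  | gammaInv => exact contDiffAt_const.div hg.contDiffAt (gam_pos p q).ne'
  | dtime => exact (hp.sub hq).contDiffAt.div hd hd0
  | dspace i => exact ((hpi i).sub (hqi i)).contDiffAt.div hd hd0
  | add _ _ h1 h2 => exact h1.add h2
  | mul _ _ h1 h2 => exact h1.mul h2

/-! ### Derivatives along lines -/

theorem hasDerivAt_bracket (p v : R3) :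
    HasDerivAt (fun s : ℝ => bracket (p + s • v)) (⟪p, v⟫_ℝ / bracket p) 0 := by
  have h1 : HasDerivAt (fun s : ℝ => 1 + ‖p + s • v‖ ^ 2) (2 * ⟪p, v⟫_ℝ) 0 := by
    have h2 : HasDerivAt (fun s : ℝ => p + s • v) v 0 := by
      simpa using ((hasDerivAt_id (0 : ℝ)).smul_const v).const_add p
    simpa using h2.norm_sq.const_add 1
  have h3 := h1.sqrt (by positivity)
  unfold bracket
  convert h3 using 1
  simp only [zero_smul, add_zero]
  rw [mul_div_mul_left _ _ two_ne_zero]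

theorem hasDerivAt_coord (p v : R3) (i : Fin 3) :
    HasDerivAt (fun s : ℝ => (p + s • v) i) (v i) 0 := by
  have : HasDerivAt (fun s : ℝ => p i + s * v i) (1 * v i) 0 :=
    ((hasDerivAt_id (0 : ℝ)).mul_const (v i)).const_add (p i)
  simpa using this

theorem hasDerivAt_gam (p q v w : R3) :
    HasDerivAt (fun s : ℝ => gam (p + s • v) (q + s • w))
      (⟪p, v⟫_ℝ / bracket p * bracket q + bracket p * (⟪q, w⟫_ℝ / bracket q)
        - (⟪p, w⟫_ℝ + ⟪v, q⟫_ℝ)) 0 := by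
  have h2 (p v : R3) : HasDerivAt (fun s : ℝ => p + s • v) v 0 := by
    simpa using ((hasDerivAt_id (0 : ℝ)).smul_const v).const_add p
  have h := ((hasDerivAt_bracket p v).mul (hasDerivAt_bracket q w)).sub
    ((h2 p v).inner ℝ (h2 q w))
  unfold gam
  refine h.congr_deriv ?_
  simp

theorem hasDerivAt_den {ε : ℝ} {p q v w : R3} {G A B : ℝ} (h : 0 < gam p q - 1 + ε)
    (hG : HasDerivAt (fun s : ℝ => gam (p + s • v) (q + s • w)) G 0)
    (hA : HasDerivAt (fun s : ℝ => bracket (p + s • v)) (A * bracket p) 0)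
    (hB : HasDerivAt (fun s : ℝ => bracket (q + s • w)) (B * bracket q) 0) :
    HasDerivAt (fun s : ℝ => den ε (p + s • v) (q + s • w))
      (den ε p q * (G / (gam p q - 1 + ε) + A + B) / 2) 0 := by
  have h1 := (((hG.sub_const 1).add_const ε).mul (hA.mul hB)).sqrt
    (by simpa using (mul_pos h (mul_pos (bracket_pos p) (bracket_pos q))).ne')
  have h2 := den_sq h.le
  have h3 := den_pos h
  unfold den at h2 h3 ⊢
  refine h1.congr_deriv ?_
  simp only [Pi.mul_apply, zero_smul, add_zero]
  generalize √((gam p q - 1 + ε) * (bracket p * bracket q)) = d at h2 h3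
  field_simp
  rw [h2]
  ring

theorem hasDerivAt_hker {ε : ℝ} {p q v w : R3} {G : ℝ} (h : 0 < gam p q - 1 + ε)
    (hG : HasDerivAt (fun s : ℝ => gam (p + s • v) (q + s • w)) G 0) :
    HasDerivAt (fun s : ℝ => hker ε (p + s • v) (q + s • w))
      (hker ε p q * (2 / gam p q - 1 / (2 * (gam p q - 1 + ε)) - 3 / (2 * (gam p q + 1))) * G)
      0 := by
  have h0 := gam_pos p q
  have hs1 : 0 < √(gam p q - 1 + ε) := Real.sqrt_pos.2 h
  have hs2 : 0 < √(gam p q + 1) := Real.sqrt_pos.2 (by linarith)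
  have e1 : √(gam p q - 1 + ε) ^ 2 = gam p q - 1 + ε := Real.sq_sqrt h.le
  have e2 : √(gam p q + 1) ^ 2 = gam p q + 1 := Real.sq_sqrt (by linarith)
  have h1 := (hG.pow 2).div ((((hG.sub_const 1).add_const ε).sqrt (by simpa using h.ne')).mul
    (((hG.add_const 1).sqrt (by simpa using (by linarith : gam p q + 1 ≠ 0))).pow 3))
    (by simpa using ⟨hs1.ne', hs2.ne'⟩)
  unfold hker
  refine h1.congr_deriv ?_
  simp only [Pi.mul_apply, Pi.pow_apply, zero_smul, add_zero]
  have h3 : gam p q + 1 ≠ 0 := by linarith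
  generalize √(gam p q - 1 + ε) = a at *
  generalize √(gam p q + 1) = b at *
  rw [← e1, ← e2]
  field_simp
  norm_num
  ring

theorem hasDerivAt_boost_bracket (p : R3) (i : Fin 3) :
    HasDerivAt (fun s : ℝ => bracket (p + s • (bracket p • EuclideanSpace.single i (1 : ℝ))))
      (p i) 0 := by
  refine (hasDerivAt_bracket p _).congr_deriv ?_
  rw [inner_smul_right]
  simp [bracket_ne_zero p, EuclideanSpace.inner_single_right]

theorem hasDerivAt_boost_coord (p : R3) (i j : Fin 3) :
    HasDerivAt (fun s : ℝ => (p + s • (bracket p • EuclideanSpace.single i (1 : ℝ))) j)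
      (if j = i then bracket p else 0) 0 := by
  refine (hasDerivAt_coord p _ j).congr_deriv ?_
  simp

/-- γ is the Minkowski product of the four-momenta (⟨p⟩,p) and (⟨q⟩,q), and the direction is the
generator of a common Lorentz boost, which preserves it. -/
theorem hasDerivAt_boost_gam (p q : R3) (i : Fin 3) :
    HasDerivAt (fun s : ℝ => gam (p + s • (bracket p • EuclideanSpace.single i (1 : ℝ)))
      (q + s • (bracket q • EuclideanSpace.single i (1 : ℝ)))) 0 0 := by
  refine (hasDerivAt_gam p q _ _).congr_deriv ?_
  simp only [inner_smul_right, inner_smul_left]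
  have := bracket_ne_zero p
  have := bracket_ne_zero q
  simp only [EuclideanSpace.inner_single_right, EuclideanSpace.inner_single_left]
  simp
  field_simp
  ring

theorem hasDerivAt_boost_hker {ε : ℝ} {p q : R3} (h : 0 < gam p q - 1 + ε) (i : Fin 3) :
    HasDerivAt (fun s : ℝ => hker ε (p + s • (bracket p • EuclideanSpace.single i (1 : ℝ)))
      (q + s • (bracket q • EuclideanSpace.single i (1 : ℝ)))) 0 0 :=
  (hasDerivAt_hker h (hasDerivAt_boost_gam p q i)).congr_deriv (by ring)

/-- By invariance of γ only the factor ⟨p⟩⟨q⟩ under the root varies, so the logarithmic derivative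
is again a bounded symbol. -/
theorem hasDerivAt_boost_den {ε : ℝ} {p q : R3} (h : 0 < gam p q - 1 + ε) (i : Fin 3) :
    HasDerivAt (fun s : ℝ => den ε (p + s • (bracket p • EuclideanSpace.single i (1 : ℝ)))
      (q + s • (bracket q • EuclideanSpace.single i (1 : ℝ))))
      (den ε p q * (p i / bracket p + q i / bracket q) / 2) 0 := by
  have hp := bracket_ne_zero p
  have hq := bracket_ne_zero q
  refine (hasDerivAt_den (A := p i / bracket p) (B := q i / bracket q) h
    (hasDerivAt_boost_gam p q i)
    ((hasDerivAt_boost_bracket p i).congr_deriv ?_)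
    ((hasDerivAt_boost_bracket q i).congr_deriv ?_)).congr_deriv ?_
  · field_simp
  · field_simp
  · ring

theorem Sym.neg {w : ℝ → R3 → R3 → ℝ} (hw : Sym w) : Sym (fun ε p q => - w ε p q) := by
  simpa using (Sym.const (-1)).mul hw

theorem Sym.sub {v w : ℝ → R3 → R3 → ℝ} (hv : Sym v) (hw : Sym w) :
    Sym (fun ε p q => v ε p q - w ε p q) := by
  simpa [sub_eq_add_neg] using hv.add hw.neg

/-- The decisive case is the difference of four-momenta: (⟨p⟩-⟨q⟩, p-q) is a four-vector, so the
boost sends the time component to the i-th space component and conversely. This is why `dtime` must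
accompany `dspace`. Unlike ∂_p alone, the boost produces no new inverse powers of γ - 1. -/
theorem Sym.exists_boost {w : ℝ → R3 → R3 → ℝ} (hw : Sym w) (i : Fin 3) :
    ∃ w', Sym w' ∧ ∀ ε p q, 0 < gam p q - 1 + ε →
      HasDerivAt (fun s : ℝ => w ε (p + s • (bracket p • EuclideanSpace.single i (1 : ℝ)))
        (q + s • (bracket q • EuclideanSpace.single i (1 : ℝ)))) (w' ε p q) 0 := by
  induction hw with
  | const c => exact ⟨_, Sym.const 0, fun _ _ _ _ => hasDerivAt_const _ _⟩
  | pdir j =>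
    refine ⟨_, (Sym.const (if j = i then 1 else 0)).sub ((Sym.pdir j).mul (Sym.pdir i)),
      fun ε p q _ => ?_⟩
    have hp := bracket_ne_zero p
    refine ((hasDerivAt_boost_coord p i j).div (hasDerivAt_boost_bracket p i)
      (by simpa using hp)).congr_deriv ?_
    split_ifs <;> simp <;> field_simp
  | pinv =>
    refine ⟨_, (Sym.pinv.mul (Sym.pdir i)).neg, fun ε p q _ => ?_⟩
    have hp := bracket_ne_zero p
    refine ((hasDerivAt_const _ (1 : ℝ)).div (hasDerivAt_boost_bracket p i)
      (by simpa using hp)).congr_deriv ?_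
    simp
    field_simp
  | qdir j =>
    refine ⟨_, (Sym.const (if j = i then 1 else 0)).sub ((Sym.qdir j).mul (Sym.qdir i)),
      fun ε p q _ => ?_⟩
    have hp := bracket_ne_zero q
    refine ((hasDerivAt_boost_coord q i j).div (hasDerivAt_boost_bracket q i)
      (by simpa using hp)).congr_deriv ?_
    split_ifs <;> simp <;> field_simp
  | qinv =>
    refine ⟨_, (Sym.qinv.mul (Sym.qdir i)).neg, fun ε p q _ => ?_⟩
    have hp := bracket_ne_zero q
    refine ((hasDerivAt_const _ (1 : ℝ)).div (hasDerivAt_boost_bracket q i)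
      (by simpa using hp)).congr_deriv ?_
    simp
    field_simp
  | gamma =>
    refine ⟨_, (Sym.gamma.mul ((Sym.pdir i).add (Sym.qdir i))).neg, fun ε p q _ => ?_⟩
    have hp := bracket_ne_zero p
    have hq := bracket_ne_zero q
    refine ((hasDerivAt_boost_gam p q i).div ((hasDerivAt_boost_bracket p i).mul
      (hasDerivAt_boost_bracket q i)) (by simpa using ⟨hp, hq⟩)).congr_deriv ?_
    simp
    field_simp
  | gammaInv =>
    refine ⟨_, Sym.const 0, fun ε p q _ => ?_⟩
    refine ((hasDerivAt_const _ (1 : ℝ)).div (hasDerivAt_boost_gam p q i)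
      (by simpa using (gam_pos p q).ne')).congr_deriv ?_
    simp
  | dtime =>
    refine ⟨_, ((Sym.dspace i).sub (((Sym.const (1 / 2)).mul Sym.dtime).mul
      ((Sym.pdir i).add (Sym.qdir i)))), fun ε p q h => ?_⟩
    have hd := (den_pos h).ne'
    refine (((hasDerivAt_boost_bracket p i).sub (hasDerivAt_boost_bracket q i)).div
      (hasDerivAt_boost_den h i) (by simpa using hd)).congr_deriv ?_
    simp
    field_simp
  | dspace j =>
    refine ⟨_, (((Sym.const (if j = i then 1 else 0)).mul Sym.dtime).sub
      (((Sym.const (1 / 2)).mul (Sym.dspace j)).mul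
      ((Sym.pdir i).add (Sym.qdir i)))), fun ε p q h => ?_⟩
    have hd := (den_pos h).ne'
    refine (((hasDerivAt_boost_coord p i j).sub (hasDerivAt_boost_coord q i j)).div
      (hasDerivAt_boost_den h i) (by simpa using hd)).congr_deriv ?_
    split_ifs <;> simp <;> field_simp
  | add hv hw h1 h2 =>
    obtain ⟨v', hv', h1⟩ := h1
    obtain ⟨w', hw', h2⟩ := h2
    exact ⟨_, hv'.add hw', fun ε p q h => (h1 ε p q h).add (h2 ε p q h)⟩
  | mul hv hw h1 h2 =>
    obtain ⟨v', hv', h1⟩ := h1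
    obtain ⟨w', hw', h2⟩ := h2
    refine ⟨_, (hv'.mul hw).add (hv.mul hw'), fun ε p q h => ?_⟩
    refine ((h1 ε p q h).mul (h2 ε p q h)).congr_deriv ?_
    simp

/-! ### Bounds -/

/-- The factor decreases in ε, stays bounded as γ grows, and behaves like (γ-1)^{-1/2} as γ tends to
1; hence the intermediate bound 1 + (γ-1)^{-1/2}. -/
theorem hker_le {ε : ℝ} (hε : 0 ≤ ε) {p q : R3} (h : p ≠ q) :
    hker ε p q ≤ 4 * bracket q * (1 + ‖p - q‖⁻¹) := by
  have hγ := one_lt_gam h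
  have hs0 : 0 < √(gam p q - 1) := Real.sqrt_pos.2 (by linarith)
  have hs1 : √(gam p q - 1) ≤ √(gam p q - 1 + ε) := Real.sqrt_le_sqrt (by linarith)
  have hs2 : 0 < √(gam p q + 1) := Real.sqrt_pos.2 (by linarith)
  have e0 : √(gam p q - 1) ^ 2 = gam p q - 1 := Real.sq_sqrt (by linarith)
  have e2 : √(gam p q + 1) ^ 2 = gam p q + 1 := Real.sq_sqrt (by linarith)
  have h1 : hker ε p q ≤ 1 + 1 / √(gam p q - 1) := by
    unfold hker
    have h3 : gam p q ^ 2 ≤ (√(gam p q - 1) + 1) * √(gam p q + 1) ^ 3 := by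
      have h4 : √(gam p q + 1) ≤ √(gam p q - 1) + 2 := by
        apply Real.sqrt_le_iff.2 ⟨by positivity, by nlinarith⟩
      have h5 : gam p q ≤ (√(gam p q - 1) + 1) * √(gam p q + 1) := by
        have h6 : √(gam p q - 1) ≤ √(gam p q + 1) := Real.sqrt_le_sqrt (by linarith)
        have h7 : 1 ≤ √(gam p q + 1) := Real.one_le_sqrt.2 (by linarith)
        nlinarith
      calc gam p q ^ 2 = gam p q * gam p q := by ring
        _ ≤ ((√(gam p q - 1) + 1) * √(gam p q + 1)) * (gam p q + 1) := by
          gcongr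
          linarith
        _ = _ := by linear_combination -((√(gam p q - 1) + 1) * √(gam p q + 1)) * e2
    calc _ ≤ gam p q ^ 2 / (√(gam p q - 1) * √(gam p q + 1) ^ 3) := by gcongr
      _ ≤ ((√(gam p q - 1) + 1) * √(gam p q + 1) ^ 3)
          / (√(gam p q - 1) * √(gam p q + 1) ^ 3) := by gcongr
      _ = _ := by field_simp
  have h2 := inv_sqrt_gam_sub_one_le' h
  have hq := one_le_bracket q
  have hi : 0 ≤ ‖p - q‖⁻¹ := by positivity
  nlinarith [mul_nonneg (by linarith : 0 ≤ bracket q) hi]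

theorem hker_nonneg (ε : ℝ) (p q : R3) : 0 ≤ hker ε p q := by
  unfold hker
  positivity

/-- The normalisation `den` is chosen so that `norm_sub_sq_le` gives exactly this bound. -/
theorem norm_sub_div_den_le {ε : ℝ} (hε : 0 ≤ ε) (p q : R3) {x : ℝ} (hx : |x| ≤ ‖p - q‖) :
    |x / den ε p q| ≤ 2 := by
  have h1 := norm_sub_sq_le p q
  have h2 := one_le_gam p q
  have h3 : 0 < bracket p * bracket q := mul_pos (bracket_pos p) (bracket_pos q)
  have h4 : ‖p - q‖ ≤ 2 * den ε p q := by
    unfold den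
    rw [show (2 : ℝ) = √(2 ^ 2) by norm_num, ← Real.sqrt_mul (by norm_num)]
    apply Real.le_sqrt_of_sq_le
    nlinarith
  have h5 : 0 ≤ den ε p q := Real.sqrt_nonneg _
  rw [abs_div, abs_of_nonneg h5]
  exact div_le_of_le_mul₀ h5 (by norm_num) (hx.trans h4)

theorem Sym.exists_bound {w : ℝ → R3 → R3 → ℝ} (hw : Sym w) :
    ∃ C, 0 ≤ C ∧ ∀ ε p q, 0 ≤ ε → |w ε p q| ≤ C := by
  have hdir (p : R3) (i : Fin 3) : |p i / bracket p| ≤ 1 := by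
    rw [abs_div, abs_of_pos (bracket_pos p), div_le_one (bracket_pos p)]
    exact abs_coord_le_bracket p i
  have hinv (p : R3) : |1 / bracket p| ≤ 1 := by
    rw [abs_div, abs_of_pos (bracket_pos p), div_le_one (bracket_pos p), abs_one]
    exact one_le_bracket p
  induction hw with
  | const c => exact ⟨|c|, abs_nonneg c, fun _ _ _ _ => le_rfl⟩
  | pdir i => exact ⟨1, zero_le_one, fun _ p _ _ => hdir p i⟩
  | pinv => exact ⟨1, zero_le_one, fun _ p _ _ => hinv p⟩
  | qdir i => exact ⟨1, zero_le_one, fun _ _ q _ => hdir q i⟩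
  | qinv => exact ⟨1, zero_le_one, fun _ _ q _ => hinv q⟩
  | gamma =>
    refine ⟨2, zero_le_two, fun _ p q _ => ?_⟩
    have h3 : 0 < bracket p * bracket q := mul_pos (bracket_pos p) (bracket_pos q)
    rw [abs_div, abs_of_pos h3, abs_of_pos (gam_pos p q), div_le_iff₀ h3]
    exact gam_le p q
  | gammaInv =>
    refine ⟨1, zero_le_one, fun _ p q _ => ?_⟩
    rw [abs_div, abs_of_pos (gam_pos p q), div_le_one (gam_pos p q), abs_one]
    exact one_le_gam p q
  | dtime =>
    exact ⟨2, zero_le_two, fun _ p q h => norm_sub_div_den_le h p q (abs_bracket_sub_le p q)⟩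
  | dspace i =>
    exact ⟨2, zero_le_two, fun _ p q h => norm_sub_div_den_le h p q
      (by simpa using abs_coord_le_norm (p - q) i)⟩
  | add _ _ h1 h2 =>
    obtain ⟨C, hC, h1⟩ := h1
    obtain ⟨D, hD, h2⟩ := h2
    exact ⟨C + D, by positivity, fun ε p q h =>
      (abs_add_le _ _).trans (add_le_add (h1 ε p q h) (h2 ε p q h))⟩
  | mul _ _ h1 h2 =>
    obtain ⟨C, hC, h1⟩ := h1
    obtain ⟨D, hD, h2⟩ := h2
    refine ⟨C * D, by positivity, fun ε p q h => ?_⟩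
    rw [abs_mul]
    exact mul_le_mul (h1 ε p q h) (h2 ε p q h) (abs_nonneg _) hC

/-! ### Gradient bounds -/

theorem bracket_mul_abs_gam_deriv_le (p q v : R3) :
    bracket p * |⟪p, v⟫_ℝ / bracket p * bracket q - ⟪v, q⟫_ℝ|
      ≤ ‖v‖ * ‖bracket q • p - bracket p • q‖ := by
  have hp := bracket_pos p
  have h : bracket p * (⟪p, v⟫_ℝ / bracket p * bracket q - ⟪v, q⟫_ℝ)
      = ⟪v, bracket q • p - bracket p • q⟫_ℝ := by
    rw [inner_sub_right, inner_smul_right, inner_smul_right, real_inner_comm p v]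
    field_simp
  calc _ = |bracket p * (⟪p, v⟫_ℝ / bracket p * bracket q - ⟪v, q⟫_ℝ)| := by
        rw [abs_mul, abs_of_pos hp]
    _ ≤ _ := by
      rw [h]
      exact abs_real_inner_le_norm _ _

theorem hasDerivAt_gam_left (p q v : R3) :
    HasDerivAt (fun s : ℝ => gam (p + s • v) q)
      (⟪p, v⟫_ℝ / bracket p * bracket q - ⟪v, q⟫_ℝ) 0 := by
  simpa using hasDerivAt_gam p q v 0

/-- Two bounds for two purposes: the first controls growth at infinity, the second is relative to γ
- 1 and serves the factors that are singular or inverse in γ. -/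
theorem exists_deriv_gam (p q v : R3) (h : p ≠ q) :
    ∃ G, HasDerivAt (fun s : ℝ => gam (p + s • v) q) G 0 ∧
      bracket p * |G| ≤ ‖v‖ * (2 * (bracket p * bracket q)) ∧
      bracket p * |G| ≤ (gam p q - 1) * (16 * ‖v‖ * (bracket q ^ 3 * (1 + ‖p - q‖⁻¹))) := by
  have hγ := one_lt_gam h
  refine ⟨_, hasDerivAt_gam_left p q v, ?_, ?_⟩
  · exact (bracket_mul_abs_gam_deriv_le p q v).trans (by
      gcongr
      exact norm_bracket_smul_sub_le' p q)
  · have h1 := norm_bracket_smul_sub_div_le h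
    rw [div_le_iff₀ (by linarith)] at h1
    refine (bracket_mul_abs_gam_deriv_le p q v).trans ?_
    calc _ ≤ ‖v‖ * (16 * bracket q ^ 3 * (1 + ‖p - q‖⁻¹) * (gam p q - 1)) := by gcongr
      _ = _ := by ring

/-- The logarithmic derivative in γ is at most 4/(γ-1), and the factor γ-1 in the second bound of
`exists_deriv_gam` cancels it; 64 = 4·16. -/
theorem exists_deriv_hker {ε : ℝ} (hε : 0 ≤ ε) {p q : R3} (h : p ≠ q) (v : R3) :
    ∃ D, HasDerivAt (fun s : ℝ => hker ε (p + s • v) q) D 0 ∧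
      bracket p * |D| ≤ 64 * ‖v‖ * (bracket q ^ 3 * (1 + ‖p - q‖⁻¹)) * hker ε p q := by
  have hγ := one_lt_gam h
  obtain ⟨G, hG, -, hG2⟩ := exists_deriv_gam p q v h
  have hG' : HasDerivAt (fun s : ℝ => gam (p + s • v) (q + s • (0 : R3))) G 0 := by simpa using hG
  have h1 := hasDerivAt_hker (ε := ε) (by linarith) hG'
  simp only [smul_zero, add_zero] at h1
  refine ⟨_, h1, ?_⟩
  have h0 := hker_nonneg ε p q
  have hp := bracket_pos p
  have h3 : |2 / gam p q - 1 / (2 * (gam p q - 1 + ε)) - 3 / (2 * (gam p q + 1))|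
      ≤ 4 / (gam p q - 1) := by
    have e0 : 0 < gam p q - 1 := by linarith
    have e1 : 0 ≤ 2 / gam p q ∧ 2 / gam p q ≤ 2 / (gam p q - 1) :=
      ⟨by positivity, by gcongr; linarith⟩
    have e2 : 0 ≤ 1 / (2 * (gam p q - 1 + ε)) ∧ 1 / (2 * (gam p q - 1 + ε)) ≤ 1 / (gam p q - 1) :=
      ⟨by positivity, by gcongr; linarith⟩
    have e3 : 0 ≤ 3 / (2 * (gam p q + 1)) ∧ 3 / (2 * (gam p q + 1)) ≤ 3 / (gam p q - 1) :=
      ⟨by positivity, by gcongr; linarith⟩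
    have e4 : 4 / (gam p q - 1) = 3 / (gam p q - 1) + 1 / (gam p q - 1) := by ring
    have e5 : 2 / (gam p q - 1) ≤ 4 / (gam p q - 1) := by gcongr; norm_num
    rw [abs_le]
    constructor <;> linarith
  rw [abs_mul, abs_mul, abs_of_nonneg h0]
  calc _ = hker ε p q
        * |2 / gam p q - 1 / (2 * (gam p q - 1 + ε)) - 3 / (2 * (gam p q + 1))|
        * (bracket p * |G|) := by ring
    _ ≤ hker ε p q * (4 / (gam p q - 1))
        * ((gam p q - 1) * (16 * ‖v‖ * (bracket q ^ 3 * (1 + ‖p - q‖⁻¹)))) := by gcongr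
    _ = _ := by
      have : gam p q - 1 ≠ 0 := by linarith
      field_simp
      ring

theorem abs_inner_div_bracket_le (p v : R3) : |⟪p, v⟫_ℝ / bracket p| ≤ ‖v‖ := by
  have hp := bracket_pos p
  rw [abs_div, abs_of_pos hp, div_le_iff₀ hp]
  refine (abs_real_inner_le_norm p v).trans ?_
  nlinarith [norm_lt_bracket p, norm_nonneg v]

/-- Applied with f a difference of brackets or of coordinates. In the quotient rule, f'/`den`
contributes 6 by `bracket_div_sqrt_le`; the bounded factor f/`den` ≤ 2 multiplies the logarithmic
derivative of `den`, which contributes 12. Hence 30 = 6 + 2·12. -/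
theorem exists_deriv_div_den {ε : ℝ} (hε : 0 ≤ ε) {p q : R3} (h : p ≠ q) (v : R3)
    {f : R3 → ℝ} {D : ℝ} (hf : |f p| ≤ ‖p - q‖)
    (hD : HasDerivAt (fun s : ℝ => f (p + s • v)) D 0) (hD' : |D| ≤ ‖v‖) :
    ∃ E, HasDerivAt (fun s : ℝ => f (p + s • v) / den ε (p + s • v) q) E 0 ∧
      bracket p * |E| ≤ 30 * ‖v‖ * (bracket q ^ 3 * (1 + ‖p - q‖⁻¹)) := by
  have hγ := one_lt_gam h
  have hp := bracket_pos p
  have hq := one_le_bracket q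
  have hpos : 0 < gam p q - 1 + ε := by linarith
  obtain ⟨G, hG, -, hG2⟩ := exists_deriv_gam p q v h
  have hG' : HasDerivAt (fun s : ℝ => gam (p + s • v) (q + s • (0 : R3))) G 0 := by simpa using hG
  have h1 : HasDerivAt (fun s : ℝ => den ε (p + s • v) q)
      (den ε p q * (G / (gam p q - 1 + ε) + ⟪p, v⟫_ℝ / bracket p / bracket p + 0) / 2) 0 := by
    simpa using hasDerivAt_den (w := 0) (A := ⟪p, v⟫_ℝ / bracket p / bracket p) (B := 0) hpos hG'
      ((hasDerivAt_bracket p v).congr_deriv (by field_simp))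
      (by simpa using hasDerivAt_const (0 : ℝ) (bracket q))
  have hd := den_pos hpos
  refine ⟨D / den ε p q
    - f p / den ε p q * ((G / (gam p q - 1 + ε) + ⟪p, v⟫_ℝ / bracket p / bracket p) / 2), ?_, ?_⟩
  · refine (hD.div h1 (by simpa using hd.ne')).congr_deriv ?_
    simp only [zero_smul, add_zero]
    field_simp
  · set Q := bracket q ^ 3 * (1 + ‖p - q‖⁻¹) with hQ
    have hi : 0 ≤ ‖p - q‖⁻¹ := by positivity
    have hQ1 : bracket q * (1 + ‖p - q‖⁻¹) ≤ Q := by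
      rw [hQ]
      gcongr
      nlinarith [one_le_pow₀ hq (n := 2)]
    have hQ2 : 1 ≤ Q := by
      refine le_trans ?_ hQ1
      nlinarith
    have b1 : bracket p * |D / den ε p q| ≤ ‖v‖ * (6 * Q) := by
      have e1 := bracket_div_sqrt_le h
      have e2 : √((gam p q - 1) * (bracket p * bracket q)) ≤ den ε p q := by
        unfold den
        have := bracket_pos q
        gcongr
        linarith
      have e3 : 0 < √((gam p q - 1) * (bracket p * bracket q)) :=
        Real.sqrt_pos.2 (mul_pos (by linarith) (mul_pos hp (bracket_pos q)))
      rw [abs_div, abs_of_pos hd]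
      calc _ = |D| * (bracket p / den ε p q) := by ring
        _ ≤ ‖v‖ * (bracket p / √((gam p q - 1) * (bracket p * bracket q))) := by gcongr
        _ ≤ ‖v‖ * (6 * Q) := by
          gcongr
          linarith
    have b2 : |f p / den ε p q| ≤ 2 := norm_sub_div_den_le hε p q hf
    have b3 : bracket p * |G / (gam p q - 1 + ε)| ≤ 16 * ‖v‖ * Q := by
      rw [abs_div, abs_of_pos hpos, ← mul_div_assoc, div_le_iff₀ hpos]
      refine hG2.trans ?_
      nlinarith [mul_nonneg (mul_nonneg (by norm_num : (0 : ℝ) ≤ 16) (norm_nonneg v))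
        (by linarith : 0 ≤ Q)]
    have b4 : bracket p * |⟪p, v⟫_ℝ / bracket p / bracket p| ≤ ‖v‖ := by
      rw [abs_div, abs_of_pos hp, mul_div_cancel₀ _ hp.ne']
      exact abs_inner_div_bracket_le p v
    have b5 : bracket p * |(G / (gam p q - 1 + ε) + ⟪p, v⟫_ℝ / bracket p / bracket p) / 2|
        ≤ 12 * ‖v‖ * Q := by
      rw [abs_div, abs_two]
      have := abs_add_le (G / (gam p q - 1 + ε)) (⟪p, v⟫_ℝ / bracket p / bracket p)
      nlinarith [norm_nonneg v, mul_nonneg (norm_nonneg v) (by linarith : 0 ≤ Q - 1)]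
    calc _ ≤ bracket p * (|D / den ε p q| + |f p / den ε p q|
          * |(G / (gam p q - 1 + ε) + ⟪p, v⟫_ℝ / bracket p / bracket p) / 2|) := by
          gcongr
          rw [← abs_mul]
          exact abs_sub _ _
      _ = bracket p * |D / den ε p q| + |f p / den ε p q|
          * (bracket p * |(G / (gam p q - 1 + ε) + ⟪p, v⟫_ℝ / bracket p / bracket p) / 2|) := by
          ring
      _ ≤ ‖v‖ * (6 * Q) + 2 * (12 * ‖v‖ * Q) := by gcongr
      _ = _ := by ring

/-- Momentum gradients of symbols lose one power of the distance to the diagonal, but gain one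
power of `⟨p⟩`. -/
theorem Sym.exists_grad_bound {w : ℝ → R3 → R3 → ℝ} (hw : Sym w) :
    ∃ C, 0 ≤ C ∧ ∀ ε p q v, 0 ≤ ε → p ≠ q →
      ∃ D, HasDerivAt (fun s : ℝ => w ε (p + s • v) q) D 0 ∧
        bracket p * |D| ≤ C * ‖v‖ * (bracket q ^ 3 * (1 + ‖p - q‖⁻¹)) := by
  -- The weight on the right is at least 1, so quantities that are merely bounded can be absorbed
  -- into it.
  have hQ (p q : R3) : 1 ≤ bracket q ^ 3 * (1 + ‖p - q‖⁻¹) := by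
    have h1 : 1 ≤ bracket q ^ 3 := one_le_pow₀ (one_le_bracket q)
    have h2 : 1 ≤ 1 + ‖p - q‖⁻¹ := by linarith [inv_nonneg.2 (norm_nonneg (p - q))]
    exact one_le_mul_of_one_le_of_one_le h1 h2
  induction hw with
  | const c =>
    exact ⟨0, le_rfl, fun ε p q v _ _ => ⟨0, hasDerivAt_const _ _, by simp⟩⟩
  | pdir i =>
    refine ⟨2, by norm_num, fun ε p q v _ _ => ⟨_, (hasDerivAt_coord p v i).div
      (hasDerivAt_bracket p v) (by simpa using bracket_ne_zero p), ?_⟩⟩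
    have hp := bracket_pos p
    have h1 : |v i| ≤ ‖v‖ := abs_coord_le_norm v i
    have h2 := abs_inner_div_bracket_le p v
    have h3 := abs_coord_le_bracket p i
    simp only [zero_smul, add_zero]
    rw [abs_div, abs_of_pos (by positivity : 0 < bracket p ^ 2), ← mul_div_assoc,
      div_le_iff₀ (by positivity)]
    have h4 : |v i * bracket p - p i * (⟪p, v⟫_ℝ / bracket p)| ≤ 2 * ‖v‖ * bracket p := by
      refine (abs_sub _ _).trans ?_
      rw [abs_mul, abs_mul, abs_of_pos hp]
      nlinarith [mul_le_mul h3 h2 (abs_nonneg _) hp.le]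
    have h5 : bracket p * |v i * bracket p - p i * (⟪p, v⟫_ℝ / bracket p)|
        ≤ 2 * ‖v‖ * bracket p ^ 2 := by nlinarith
    refine h5.trans ?_
    nlinarith [mul_nonneg (mul_nonneg (norm_nonneg v) (sq_nonneg (bracket p)))
      (by linarith [hQ p q] : 0 ≤ bracket q ^ 3 * (1 + ‖p - q‖⁻¹) - 1)]
  | pinv =>
    refine ⟨1, by norm_num, fun ε p q v _ _ => ⟨_, (hasDerivAt_const _ (1 : ℝ)).div
      (hasDerivAt_bracket p v) (by simpa using bracket_ne_zero p), ?_⟩⟩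
    have hp := bracket_pos p
    have h2 := abs_inner_div_bracket_le p v
    simp only [zero_smul, add_zero, zero_mul, one_mul, zero_sub]
    rw [abs_div, abs_of_pos (by positivity : 0 < bracket p ^ 2), abs_neg, ← mul_div_assoc,
      div_le_iff₀ (by positivity)]
    have h5 : bracket p * |⟪p, v⟫_ℝ / bracket p| ≤ ‖v‖ * bracket p ^ 2 := by
      nlinarith [one_le_bracket p, norm_nonneg v,
        mul_nonneg (norm_nonneg v) (by nlinarith [one_le_bracket p] :
          0 ≤ bracket p ^ 2 - bracket p)]
    refine h5.trans ?_
    nlinarith [mul_nonneg (mul_nonneg (norm_nonneg v) (sq_nonneg (bracket p)))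
      (by linarith [hQ p q] : 0 ≤ bracket q ^ 3 * (1 + ‖p - q‖⁻¹) - 1)]
  | qdir i =>
    exact ⟨0, le_rfl, fun ε p q v _ _ => ⟨0, hasDerivAt_const _ _, by simp⟩⟩
  | qinv =>
    exact ⟨0, le_rfl, fun ε p q v _ _ => ⟨0, hasDerivAt_const _ _, by simp⟩⟩
  | gamma =>
    refine ⟨4, by norm_num, fun ε p q v _ h => ?_⟩
    obtain ⟨G, hG, hG1, -⟩ := exists_deriv_gam p q v h
    have hp := bracket_pos p
    have hq := bracket_pos q
    have h2 := abs_inner_div_bracket_le p v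
    refine ⟨_, hG.div ((hasDerivAt_bracket p v).mul_const (bracket q))
      (by simpa using ⟨hp.ne', hq.ne'⟩), ?_⟩
    simp only [zero_smul, add_zero]
    rw [abs_div, abs_of_pos (by positivity : 0 < (bracket p * bracket q) ^ 2), ← mul_div_assoc,
      div_le_iff₀ (by positivity)]
    have h4 : bracket p * |G * (bracket p * bracket q)
        - gam p q * (⟪p, v⟫_ℝ / bracket p * bracket q)| ≤ 4 * ‖v‖ * (bracket p * bracket q) ^ 2 := by
      have e1 := gam_le p q
      have e2 := gam_pos p q
      calc _ ≤ bracket p * (|G * (bracket p * bracket q)|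
            + |gam p q * (⟪p, v⟫_ℝ / bracket p * bracket q)|) := by
            gcongr
            exact abs_sub _ _
        _ = (bracket p * |G|) * (bracket p * bracket q)
            + gam p q * (|⟪p, v⟫_ℝ / bracket p| * (bracket p * bracket q)) := by
            rw [abs_mul G, abs_mul (gam p q), abs_mul (⟪p, v⟫_ℝ / bracket p), abs_of_pos e2,
              abs_of_pos hq, abs_of_pos (mul_pos hp hq)]
            ring
        _ ≤ (‖v‖ * (2 * (bracket p * bracket q))) * (bracket p * bracket q)
            + (2 * (bracket p * bracket q)) * (‖v‖ * (bracket p * bracket q)) := by gcongr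
        _ = _ := by ring
    refine h4.trans ?_
    nlinarith [mul_nonneg (mul_nonneg (norm_nonneg v) (sq_nonneg (bracket p * bracket q)))
      (by linarith [hQ p q] : 0 ≤ bracket q ^ 3 * (1 + ‖p - q‖⁻¹) - 1)]
  | gammaInv =>
    refine ⟨16, by norm_num, fun ε p q v _ h => ?_⟩
    obtain ⟨G, hG, -, hG2⟩ := exists_deriv_gam p q v h
    have hγ := one_lt_gam h
    have hp := bracket_pos p
    refine ⟨_, (hasDerivAt_const _ (1 : ℝ)).div hG (by simpa using (gam_pos p q).ne'), ?_⟩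
    simp only [zero_smul, add_zero, zero_mul, one_mul, zero_sub]
    rw [abs_div, abs_of_pos (by positivity : 0 < gam p q ^ 2), abs_neg, ← mul_div_assoc,
      div_le_iff₀ (by positivity), mul_comm]
    rw [mul_comm] at hG2
    refine hG2.trans ?_
    have : 0 ≤ 16 * ‖v‖ * (bracket q ^ 3 * (1 + ‖p - q‖⁻¹)) :=
      mul_nonneg (by positivity) (by linarith [hQ p q])
    nlinarith [mul_nonneg this (by nlinarith : 0 ≤ gam p q ^ 2 - (gam p q - 1))]
  | dtime =>
    refine ⟨30, by norm_num, fun ε p q v hε h => ?_⟩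
    exact exists_deriv_div_den hε h v (f := fun p => bracket p - bracket q)
      (abs_bracket_sub_le p q) ((hasDerivAt_bracket p v).sub_const _)
      (abs_inner_div_bracket_le p v)
  | dspace i =>
    refine ⟨30, by norm_num, fun ε p q v hε h => ?_⟩
    exact exists_deriv_div_den hε h v (f := fun p => p i - q i)
      (by simpa using abs_coord_le_norm (p - q) i) ((hasDerivAt_coord p v i).sub_const _)
      (abs_coord_le_norm v i)
  | add _ _ h1 h2 =>
    obtain ⟨C, hC, h1⟩ := h1
    obtain ⟨C', hC', h2⟩ := h2
    refine ⟨C + C', by positivity, fun ε p q v hε h => ?_⟩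
    obtain ⟨D, hD, b1⟩ := h1 ε p q v hε h
    obtain ⟨E, hE, b2⟩ := h2 ε p q v hε h
    refine ⟨_, hD.add hE, ?_⟩
    have := abs_add_le D E
    nlinarith [bracket_pos p]
  | @mul x y hv hw h1 h2 =>
    obtain ⟨A, hA, a1⟩ := hv.exists_bound
    obtain ⟨B, hB, a2⟩ := hw.exists_bound
    obtain ⟨C, hC, h1⟩ := h1
    obtain ⟨C', hC', h2⟩ := h2
    refine ⟨C * B + A * C', by positivity, fun ε p q v hε h => ?_⟩
    obtain ⟨D, hD, b1⟩ := h1 ε p q v hε h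
    obtain ⟨E, hE, b2⟩ := h2 ε p q v hε h
    have c1 := a1 ε p q hε
    have c2 := a2 ε p q hε
    have hp := bracket_pos p
    refine ⟨_, hD.mul hE, ?_⟩
    simp only [zero_smul, add_zero]
    have hq := bracket_pos q
    calc _ ≤ (bracket p * |D|) * |y ε p q| + |x ε p q| * (bracket p * |E|) := by
          refine (mul_le_mul_of_nonneg_left (abs_add_le _ _) hp.le).trans (le_of_eq ?_)
          rw [abs_mul, abs_mul]
          ring
      _ ≤ (C * ‖v‖ * (bracket q ^ 3 * (1 + ‖p - q‖⁻¹))) * B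
          + A * (C' * ‖v‖ * (bracket q ^ 3 * (1 + ‖p - q‖⁻¹))) := by gcongr
      _ = _ := by ring

/-! ### Integrals of singular weights -/

theorem integrable_bracket_rpow {s : ℝ} (hs : 3 < s) :
    Integrable (fun q : R3 => bracket q ^ (-s)) := by
  have h := integrable_rpow_neg_one_add_norm_sq (E := R3) (μ := volume) (r := s) (by simpa using hs)
  refine h.congr (Eventually.of_forall fun q => ?_)
  simp only [bracket]
  rw [Real.sqrt_eq_rpow, ← Real.rpow_mul (by positivity)]
  congr 1
  ring

/-- In polar coordinates the density is y²(1 + 1/y)² = (y+1)², so two inverse powers of the distance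
are harmless in dimension three. -/
theorem integrableOn_ball_singular (R : ℝ) :
    IntegrableOn (fun r : R3 => (1 + ‖r‖⁻¹) ^ 2) (Metric.ball 0 R) := by
  refine (integrableOn_fun_norm_addHaar (E := R3) (μ := volume)
    (f := fun y : ℝ => (1 + y⁻¹) ^ 2)).2 ?_
  have h : IntegrableOn (fun y : ℝ => (y + 1) ^ 2) (Set.Ioo 0 R) :=
    ((by fun_prop : Continuous fun y : ℝ => (y + 1) ^ 2).continuousOn.integrableOn_Icc).mono_set
      Set.Ioo_subset_Icc_self
  refine h.congr_fun (fun y hy => ?_) measurableSet_Ioo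
  have : y ≠ 0 := hy.1.ne'
  simp
  field_simp

/-- The weights `⟨q⟩^{-s}(1 + |p - q|^{-1})²` have uniformly bounded integrals for `s > 3`. -/
theorem exists_singular_integral_bound {s : ℝ} (hs : 3 < s) :
    ∃ C, 0 < C ∧ ∀ p : R3,
      Integrable (fun q : R3 => bracket q ^ (-s) * (1 + ‖p - q‖⁻¹) ^ 2) ∧
      ∫ q : R3, bracket q ^ (-s) * (1 + ‖p - q‖⁻¹) ^ 2 ≤ C := by
  set φ : R3 → ℝ := (Metric.ball 0 1).indicator (fun r : R3 => (1 + ‖r‖⁻¹) ^ 2) with hφ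
  have hφi : Integrable φ := by
    rw [hφ, integrable_indicator_iff Metric.isOpen_ball.measurableSet]
    exact integrableOn_ball_singular 1
  have hφ0 (r : R3) : 0 ≤ φ r := Set.indicator_nonneg (fun _ _ => by positivity) r
  have hb := integrable_bracket_rpow hs
  -- At distance at least 1 from p the singular factor is at most 4; closer to p the weight is at
  -- most 1. The remaining term is a translate of the fixed function φ, so the bound is uniform in
  -- p.
  have hle (p q : R3) : bracket q ^ (-s) * (1 + ‖p - q‖⁻¹) ^ 2
      ≤ 4 * bracket q ^ (-s) + φ (p - q) := by
    have h1 : 0 ≤ bracket q ^ (-s) := by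
      have := bracket_pos q
      positivity
    by_cases h : p - q ∈ Metric.ball (0 : R3) 1
    · rw [hφ, Set.indicator_of_mem h]
      have : bracket q ^ (-s) ≤ 1 :=
        Real.rpow_le_one_of_one_le_of_nonpos (one_le_bracket q) (by linarith)
      nlinarith [sq_nonneg (1 + ‖p - q‖⁻¹)]
    · rw [hφ, Set.indicator_of_notMem h]
      simp only [Metric.mem_ball, dist_zero_right, not_lt] at h
      have h2 : ‖p - q‖⁻¹ ≤ 1 := inv_le_one_of_one_le₀ h
      have h3 : 0 ≤ ‖p - q‖⁻¹ := by positivity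
      have h4 : (1 + ‖p - q‖⁻¹) ^ 2 ≤ 4 := by nlinarith
      nlinarith
  have hint (p : R3) : Integrable (fun q => 4 * bracket q ^ (-s) + φ (p - q)) :=
    (hb.const_mul 4).add (hφi.comp_sub_left p)
  refine ⟨4 * (∫ q : R3, bracket q ^ (-s)) + (∫ q, φ q) + 1, ?_, fun p => ?_⟩
  · have h1 : 0 ≤ ∫ q : R3, bracket q ^ (-s) := integral_nonneg fun q => by
      have := bracket_pos q
      positivity
    have h2 : 0 ≤ ∫ q, φ q := integral_nonneg hφ0
    positivity
  · have hi : Integrable (fun q : R3 => bracket q ^ (-s) * (1 + ‖p - q‖⁻¹) ^ 2) := by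
      refine (hint p).mono' ?_ (Eventually.of_forall fun q => ?_)
      · refine Measurable.aestronglyMeasurable ?_
        have := continuous_bracket.measurable
        fun_prop
      · have := bracket_pos q
        rw [Real.norm_eq_abs, abs_of_nonneg (by positivity)]
        exact hle p q
    refine ⟨hi, ?_⟩
    calc _ ≤ ∫ q, (4 * bracket q ^ (-s) + φ (p - q)) := integral_mono hi (hint p) (hle p)
      _ = 4 * (∫ q : R3, bracket q ^ (-s)) + ∫ q, φ q := by
        rw [integral_add (hb.const_mul 4) (hφi.comp_sub_left p), integral_const_mul,
          integral_sub_left_eq_self]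
      _ ≤ _ := by linarith

/-! ### The multiplier `κ` -/

/-- There is an explicit primitive, -cos θ / ((1+P²)√(1+P² sin²θ)); each endpoint contributes
1/(1+P²). -/
theorem integral_kappa (P : ℝ) :
    ∫ θ in (0 : ℝ)..Real.pi, (1 + P ^ 2 * Real.sin θ ^ 2) ^ (-(3 / 2) : ℝ) * Real.sin θ
      = 2 / (1 + P ^ 2) := by
  have hX (θ : ℝ) : 0 < 1 + P ^ 2 * Real.sin θ ^ 2 := by positivity
  have hd (θ : ℝ) : HasDerivAt
      (fun θ => -Real.cos θ / ((1 + P ^ 2) * √(1 + P ^ 2 * Real.sin θ ^ 2)))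
      ((1 + P ^ 2 * Real.sin θ ^ 2) ^ (-(3 / 2) : ℝ) * Real.sin θ) θ := by
    have h1 : HasDerivAt (fun θ => 1 + P ^ 2 * Real.sin θ ^ 2)
        (P ^ 2 * (2 * Real.sin θ * Real.cos θ)) θ := by
      have := (((Real.hasDerivAt_sin θ).pow 2).const_mul (P ^ 2)).const_add 1
      simpa using this
    have hs : 0 < √(1 + P ^ 2 * Real.sin θ ^ 2) := Real.sqrt_pos.2 (hX θ)
    refine ((Real.hasDerivAt_cos θ).neg.div ((h1.sqrt (hX θ).ne').const_mul (1 + P ^ 2))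
      (by positivity)).congr_deriv ?_
    have e1 : (1 + P ^ 2 * Real.sin θ ^ 2) ^ (-(3 / 2) : ℝ)
        = 1 / √(1 + P ^ 2 * Real.sin θ ^ 2) ^ 3 := by
      rw [Real.sqrt_eq_rpow, ← Real.rpow_mul_natCast (hX θ).le, one_div,
        ← Real.rpow_neg (hX θ).le]
      norm_num
    have e2 : √(1 + P ^ 2 * Real.sin θ ^ 2) ^ 2 = 1 + P ^ 2 * Real.sin θ ^ 2 :=
      Real.sq_sqrt (hX θ).le
    have e3 := Real.sin_sq_add_cos_sq θ
    rw [e1]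
    generalize √(1 + P ^ 2 * Real.sin θ ^ 2) = d at *
    have hP : 1 + P ^ 2 ≠ 0 := by positivity
    field_simp
    rw [e2]
    simp only [Pi.neg_apply]
    linear_combination (Real.sin θ * P ^ 2) * e3
  rw [intervalIntegral.integral_eq_sub_of_hasDerivAt (fun θ _ => hd θ)]
  · simp
    field_simp
    norm_num
  · refine Continuous.intervalIntegrable ?_ _ _
    refine Continuous.mul ?_ Real.continuous_sin
    exact Continuous.rpow_const (by fun_prop) fun θ => Or.inl (hX θ).ne'

/-- Makes the multiplier κ a bounded symbol, so the local part of c can be differentiated along with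
the integrals. -/
theorem kappa_eq (p : R3) :
    kappa p = (2 : ℝ) ^ (7 / 2 : ℝ) * Real.pi * 2 * (1 / bracket p) := by
  unfold kappa
  rw [integral_kappa, ← bracket_sq]
  have := bracket_ne_zero p
  field_simp

/-! ### Integral operators with weakly singular kernels -/

/-- A family of kernels, regularised by a parameter, which is compactly supported in `q`, has at
most a singularity of order one on the diagonal, and is differentiable away from it. -/
structure SingKernel (N : ℝ → R3 → R3 → ℝ) : Prop where
  contDiffAt : ∀ ε p q, 0 < gam p q - 1 + ε →
    ContDiffAt ℝ 1 (fun x : ℝ × R3 × R3 => N x.1 x.2.1 x.2.2) (ε, p, q)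
  bound : ∃ C R, 0 ≤ C ∧ 0 < R ∧ (∀ ε p q, R < ‖q‖ → N ε p q = 0) ∧
    ∀ ε p q, 0 ≤ ε → p ≠ q → |N ε p q| ≤ C * (1 + ‖p - q‖⁻¹)

theorem gam_sub_one_add_pos {ε : ℝ} {p q : R3} (hε : 0 ≤ ε) (h : p ≠ q) :
    0 < gam p q - 1 + ε := by
  have := one_lt_gam h
  linarith

theorem gam_sub_one_add_pos' {ε : ℝ} (hε : 0 < ε) (p q : R3) : 0 < gam p q - 1 + ε := by
  have := one_le_gam p q
  linarith

theorem continuous_of_continuousOn_cyl {Ω : Set (ℝ × R3)} {G : Phase → ℝ}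
    (hG : ContinuousOn G (cyl Ω)) {t : ℝ} {x : R3} (h : (t, x) ∈ Ω) :
    Continuous fun q : R3 => G (t, x, q) :=
  hG.comp_continuous (by fun_prop) fun _ => h

theorem isOpen_cyl {Ω : Set (ℝ × R3)} (hΩ : IsOpen Ω) : IsOpen (cyl Ω) :=
  hΩ.preimage (by fun_prop : Continuous fun z : Phase => (z.1, z.2.1))

theorem aestronglyMeasurable_of_continuousAt {f : R3 → ℝ} (p : R3)
    (h : ∀ q, p ≠ q → ContinuousAt f q) : AEStronglyMeasurable f := by
  have h1 : ContinuousOn f {p}ᶜ := fun q hq => (h q fun e => hq e.symm).continuousWithinAt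
  have h2 := h1.aestronglyMeasurable (μ := volume) (measurableSet_singleton p).compl
  rwa [restrict_compl_singleton] at h2

theorem SingKernel.continuousAt {N : ℝ → R3 → R3 → ℝ} (hN : SingKernel N) {ε : ℝ} {p q : R3}
    (h : 0 < gam p q - 1 + ε) :
    ContinuousAt (fun x : ℝ × R3 × R3 => N x.1 x.2.1 x.2.2) (ε, p, q) :=
  (hN.contDiffAt ε p q h).continuousAt

theorem SingKernel.continuousAt_right {N : ℝ → R3 → R3 → ℝ} (hN : SingKernel N) {ε : ℝ}
    {p q : R3} (h : 0 < gam p q - 1 + ε) : ContinuousAt (fun q => N ε p q) q :=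
  ContinuousAt.comp (f := fun q : R3 => (ε, p, q)) (hN.continuousAt h) (by fun_prop)

theorem ae_ne (p : R3) : ∀ᵐ q : R3, p ≠ q := by
  have : ∀ᵐ q : R3, q ∉ ({p} : Set R3) := measure_eq_zero_iff_ae_notMem.1 (measure_singleton p)
  filter_upwards [this] with q hq e
  exact hq e.symm

theorem integrable_singular_ball (p : R3) (R : ℝ) :
    Integrable ((Metric.closedBall (0 : R3) R).indicator fun q => 1 + ‖p - q‖⁻¹) := by
  have h1 : Integrable ((Metric.ball (0 : R3) (R + ‖p‖ + 1)).indicator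
      fun r => (1 + ‖r‖⁻¹) ^ 2) := by
    rw [integrable_indicator_iff Metric.isOpen_ball.measurableSet]
    exact integrableOn_ball_singular _
  refine (h1.comp_sub_left p).mono' ?_ (Eventually.of_forall fun q => ?_)
  · refine Measurable.aestronglyMeasurable ?_
    refine Measurable.indicator (by fun_prop) Metric.isClosed_closedBall.measurableSet
  · have hi : 0 ≤ ‖p - q‖⁻¹ := by positivity
    by_cases hq : q ∈ Metric.closedBall (0 : R3) R
    · have hm : p - q ∈ Metric.ball (0 : R3) (R + ‖p‖ + 1) := by
        simp only [Metric.mem_closedBall, dist_zero_right, Metric.mem_ball] at hq ⊢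
        linarith [norm_sub_le p q]
      rw [Set.indicator_of_mem hq, Set.indicator_of_mem hm, Real.norm_eq_abs,
        abs_of_pos (by positivity)]
      nlinarith
    · rw [Set.indicator_of_notMem hq, norm_zero]
      exact Set.indicator_nonneg (fun _ _ => by positivity) _

theorem SingKernel.integrable {N : ℝ → R3 → R3 → ℝ} (hN : SingKernel N) {ε : ℝ} (hε : 0 ≤ ε)
    (p : R3) {u : R3 → ℝ} (hu : Continuous u) : Integrable (fun q => N ε p q * u q) := by
  obtain ⟨C, R, hC, hR, h0, hb⟩ := hN.bound
  obtain ⟨M, hM⟩ := (isCompact_closedBall (0 : R3) R).exists_bound_of_continuousOn hu.continuousOn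
  refine ((integrable_singular_ball p R).const_mul (C * M)).mono' ?_ ?_
  · exact aestronglyMeasurable_of_continuousAt p fun q hq =>
      (hN.continuousAt_right (gam_sub_one_add_pos hε hq)).mul hu.continuousAt
  · filter_upwards [ae_ne p] with q hq
    by_cases hqR : q ∈ Metric.closedBall (0 : R3) R
    · rw [Set.indicator_of_mem hqR, norm_mul, Real.norm_eq_abs]
      have h1 := hb ε p q hε hq
      have h2 := hM q hqR
      calc _ ≤ (C * (1 + ‖p - q‖⁻¹)) * M := by gcongr
        _ = _ := by ring
    · rw [Set.indicator_of_notMem hqR, h0 ε p q (by simpa using hqR)]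
      simp

/-- Integrals against weakly singular kernels depend continuously on all parameters. -/
theorem SingKernel.continuousOn_integral {N : ℝ → R3 → R3 → ℝ} (hN : SingKernel N)
    {Ω : Set (ℝ × R3)} (hΩ : IsOpen Ω) {G : Phase → ℝ} (hG : ContinuousOn G (cyl Ω)) :
    ContinuousOn (fun x : ℝ × Phase => ∫ q, N x.1 x.2.2.2 q * G (x.2.1, x.2.2.1, q))
      {x | 0 ≤ x.1 ∧ x.2 ∈ cyl Ω} := by
  obtain ⟨C, R, hC, hR, h0, hb⟩ := hN.bound
  rintro ⟨ε₀, t₀, x₀, p₀⟩ ⟨hε₀, hz₀⟩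
  have hz₀' : (t₀, x₀) ∈ Ω := hz₀
  obtain ⟨K, hK, hKΩ, hKc⟩ := local_compact_nhds (hΩ.mem_nhds hz₀')
  have hcomp : IsCompact ((fun y : (ℝ × R3) × R3 => ((y.1.1, y.1.2, y.2) : Phase)) ''
      (K ×ˢ Metric.closedBall (0 : R3) R)) :=
    (hKc.prod (isCompact_closedBall 0 R)).image (by fun_prop)
  obtain ⟨M, hM⟩ := hcomp.exists_bound_of_continuousOn (hG.mono (by
    rintro _ ⟨y, hy, rfl⟩
    exact hKΩ hy.1))
  -- The substitution q = p + r pins the singularity at r = 0, which yields a dominating function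
  -- independent of p.
  have hshift : (fun x : ℝ × Phase => ∫ q, N x.1 x.2.2.2 q * G (x.2.1, x.2.2.1, q))
      = fun x : ℝ × Phase => ∫ r, N x.1 x.2.2.2 (x.2.2.2 + r) * G (x.2.1, x.2.2.1, x.2.2.2 + r) := by
    funext x
    exact (integral_add_left_eq_self (μ := volume)
      (fun q => N x.1 x.2.2.2 q * G (x.2.1, x.2.2.1, q)) x.2.2.2).symm
  rw [hshift]
  have hev : ∀ᶠ x : ℝ × Phase in 𝓝[{x | 0 ≤ x.1 ∧ x.2 ∈ cyl Ω}] (ε₀, t₀, x₀, p₀),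
      0 ≤ x.1 ∧ (x.2.1, x.2.2.1) ∈ K ∧ ‖x.2.2.2 - p₀‖ < 1 := by
    have e1 : ∀ᶠ x : ℝ × Phase in 𝓝 (ε₀, t₀, x₀, p₀), (x.2.1, x.2.2.1) ∈ K :=
      (by fun_prop : Continuous fun x : ℝ × Phase => (x.2.1, x.2.2.1)).continuousAt hK
    have e2 : ∀ᶠ x : ℝ × Phase in 𝓝 (ε₀, t₀, x₀, p₀), ‖x.2.2.2 - p₀‖ < 1 := by
      refine (by fun_prop : Continuous fun x : ℝ × Phase => ‖x.2.2.2 - p₀‖).continuousAt.eventually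
        (Iio_mem_nhds ?_)
      simp
    filter_upwards [self_mem_nhdsWithin, e1.filter_mono nhdsWithin_le_nhds,
      e2.filter_mono nhdsWithin_le_nhds] with x h1 h2 h3
    exact ⟨h1.1, h2, h3⟩
  refine continuousWithinAt_of_dominated
    (bound := fun r => (C * M) * (Metric.closedBall (0 : R3) (R + ‖p₀‖ + 1)).indicator
      (fun r => 1 + ‖0 - r‖⁻¹) r) ?_ ?_ ((integrable_singular_ball 0 _).const_mul _) ?_
  · filter_upwards [hev] with x hx
    have hc : Continuous fun q : R3 => G (x.2.1, x.2.2.1, q) :=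
      continuous_of_continuousOn_cyl hG (hKΩ hx.2.1)
    refine aestronglyMeasurable_of_continuousAt 0 fun r hr => ?_
    have hne : x.2.2.2 ≠ x.2.2.2 + r := fun e => hr (by simpa using e : r = 0).symm
    exact (ContinuousAt.comp (f := fun r : R3 => x.2.2.2 + r)
      (hN.continuousAt_right (gam_sub_one_add_pos hx.1 hne)) (by fun_prop)).mul
      (hc.comp (by fun_prop)).continuousAt
  · filter_upwards [hev] with x hx
    filter_upwards [ae_ne (0 : R3)] with r hr
    have hne : x.2.2.2 ≠ x.2.2.2 + r := fun e => hr (by simpa using e : r = 0).symm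
    by_cases hq : ‖x.2.2.2 + r‖ ≤ R
    · have hrb : r ∈ Metric.closedBall (0 : R3) (R + ‖p₀‖ + 1) := by
        rw [mem_closedBall_zero_iff]
        have e1 : r = (x.2.2.2 + r) - (x.2.2.2 - p₀) - p₀ := by abel
        rw [e1]
        refine (norm_sub_le _ _).trans ?_
        have := norm_sub_le (x.2.2.2 + r) (x.2.2.2 - p₀)
        linarith [hx.2.2]
      rw [Set.indicator_of_mem hrb, norm_mul, Real.norm_eq_abs]
      have h1 := hb x.1 x.2.2.2 (x.2.2.2 + r) hx.1 hne
      have h2 : ‖G (x.2.1, x.2.2.1, x.2.2.2 + r)‖ ≤ M :=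
        hM _ ⟨((x.2.1, x.2.2.1), x.2.2.2 + r), ⟨hx.2.1, by simpa using hq⟩, rfl⟩
      have h3 : x.2.2.2 - (x.2.2.2 + r) = 0 - r := by abel
      rw [h3] at h1
      calc _ ≤ (C * (1 + ‖0 - r‖⁻¹)) * M := by gcongr
        _ = _ := by ring
    · rw [h0 _ _ _ (not_le.1 hq), zero_mul, norm_zero]
      have hM0 : 0 ≤ M := (norm_nonneg _).trans
        (hM _ ⟨((t₀, x₀), 0), ⟨mem_of_mem_nhds hK, by simpa using hR.le⟩, rfl⟩)
      exact mul_nonneg (by positivity) (Set.indicator_nonneg (fun _ _ => by positivity) _)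
  · filter_upwards [ae_ne (0 : R3)] with r hr
    have hne : p₀ ≠ p₀ + r := fun e => hr (by simpa using e : r = 0).symm
    have hzr : ((t₀, x₀, p₀ + r) : Phase) ∈ cyl Ω := hz₀'
    have hGc : ContinuousAt G (t₀, x₀, p₀ + r) := hG.continuousAt ((isOpen_cyl hΩ).mem_nhds hzr)
    refine ContinuousAt.continuousWithinAt (ContinuousAt.mul ?_ ?_)
    · exact ContinuousAt.comp (f := fun x : ℝ × Phase => (x.1, x.2.2.2, x.2.2.2 + r))
        (hN.continuousAt (gam_sub_one_add_pos hε₀ hne)) (by fun_prop)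
    · exact ContinuousAt.comp (f := fun x : ℝ × Phase => ((x.2.1, x.2.2.1, x.2.2.2 + r) : Phase))
        hGc (by fun_prop)

theorem SingKernel.continuousOn_integral_right {N : ℝ → R3 → R3 → ℝ} (hN : SingKernel N)
    {u : R3 → ℝ} (hu : Continuous u) :
    ContinuousOn (fun x : ℝ × R3 => ∫ q, N x.1 x.2 q * u q) {x | 0 ≤ x.1} := by
  have h := hN.continuousOn_integral (Ω := Set.univ) isOpen_univ (G := fun z => u z.2.2)
    (by fun_prop)
  exact h.comp (f := fun x : ℝ × R3 => ((x.1, 0, 0, x.2) : ℝ × Phase)) (by fun_prop)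
    fun x hx => ⟨hx, trivial⟩

/-! ### The regularised operators -/

theorem SingKernel.contDiff {N : ℝ → R3 → R3 → ℝ} (hN : SingKernel N) {ε : ℝ} (hε : 0 < ε) :
    ContDiff ℝ 1 (fun x : R3 × R3 => N ε x.1 x.2) := by
  rw [contDiff_iff_contDiffAt]
  rintro ⟨p, q⟩
  exact ContDiffAt.comp (f := fun x : R3 × R3 => ((ε, x.1, x.2) : ℝ × R3 × R3)) (p, q)
    (hN.contDiffAt ε p q (gam_sub_one_add_pos' hε p q)) (by fun_prop)

theorem SingKernel.hasDerivAt_line {N : ℝ → R3 → R3 → ℝ} (hN : SingKernel N) {ε : ℝ}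
    (hε : 0 < ε) (p q v w : R3) (s : ℝ) :
    HasDerivAt (fun s : ℝ => N ε (p + s • v) (q + s • w))
      (fderiv ℝ (fun x : R3 × R3 => N ε x.1 x.2) (p + s • v, q + s • w) (v, w)) s := by
  have h1 := ((hN.contDiff hε).differentiable one_ne_zero
    (p + s • v, q + s • w)).hasFDerivAt
  have h2 : HasDerivAt (fun s : ℝ => ((p + s • v, q + s • w) : R3 × R3)) (v, w) s := by
    have e (p v : R3) : HasDerivAt (fun s : ℝ => p + s • v) v s := by
      simpa using ((hasDerivAt_id s).smul_const v).const_add p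
    exact (e p v).prodMk (e q w)
  exact h1.comp_hasDerivAt s h2

theorem SingKernel.continuous_fderiv {N : ℝ → R3 → R3 → ℝ} (hN : SingKernel N) {ε : ℝ}
    (hε : 0 < ε) (v : R3 × R3) :
    Continuous fun x : R3 × R3 => fderiv ℝ (fun x : R3 × R3 => N ε x.1 x.2) x v :=
  ((hN.contDiff hε).continuous_fderiv one_ne_zero).clm_apply continuous_const

theorem SingKernel.exists_support {N : ℝ → R3 → R3 → ℝ} (hN : SingKernel N) :
    ∃ R, 0 < R ∧ (∀ ε p q, R < ‖q‖ → N ε p q = 0) ∧ ∀ ε p q v, R < ‖q‖ →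
      fderiv ℝ (fun x : R3 × R3 => N ε x.1 x.2) (p, q) v = 0 := by
  obtain ⟨C, R, hC, hR, h0, hb⟩ := hN.bound
  refine ⟨R, hR, h0, fun ε p q v hq => ?_⟩
  have : (fun x : R3 × R3 => N ε x.1 x.2) =ᶠ[𝓝 (p, q)] fun _ => 0 := by
    have h1 : ∀ᶠ x : R3 × R3 in 𝓝 (p, q), R < ‖x.2‖ :=
      (by fun_prop : Continuous fun x : R3 × R3 => ‖x.2‖).continuousAt.eventually
        (Ioi_mem_nhds hq)
    filter_upwards [h1] with x hx
    exact h0 _ _ _ hx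
  rw [this.fderiv_eq]
  simp

/-- Differentiation of the regularised operators under the integral sign. -/
theorem SingKernel.hasDerivAt_integral {N : ℝ → R3 → R3 → ℝ} (hN : SingKernel N) {ε : ℝ}
    (hε : 0 < ε) (p v : R3) {u : R3 → ℝ} (hu : Continuous u) (s₀ : ℝ) :
    HasDerivAt (fun s : ℝ => ∫ q, N ε (p + s • v) q * u q)
      (∫ q, fderiv ℝ (fun x : R3 × R3 => N ε x.1 x.2) (p + s₀ • v, q) (v, 0) * u q) s₀ := by
  obtain ⟨R, hR, h0, h0'⟩ := hN.exists_support
  have hc := hN.continuous_fderiv hε (v, 0)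
  have hcN := (hN.contDiff hε).continuous
  have hcu : Continuous fun x : ℝ × R3 =>
      fderiv ℝ (fun x : R3 × R3 => N ε x.1 x.2) (p + x.1 • v, x.2) (v, 0) * u x.2 :=
    (hc.comp (by fun_prop : Continuous fun x : ℝ × R3 => ((p + x.1 • v, x.2) : R3 × R3))).mul
      (by fun_prop)
  obtain ⟨M, hM⟩ := ((isCompact_closedBall s₀ 1).prod
    (isCompact_closedBall (0 : R3) R)).exists_bound_of_continuousOn hcu.continuousOn
  have hcN' (s : ℝ) : Continuous fun q : R3 => N ε (p + s • v) q * u q :=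
    (hcN.comp (by fun_prop : Continuous fun q : R3 => ((p + s • v, q) : R3 × R3))).mul hu
  refine (hasDerivAt_integral_of_dominated_loc_of_deriv_le
    (F := fun (s : ℝ) (q : R3) => N ε (p + s • v) q * u q)
    (F' := fun (s : ℝ) (q : R3) =>
      fderiv ℝ (fun x : R3 × R3 => N ε x.1 x.2) (p + s • v, q) (v, 0) * u q)
    (bound := (Metric.closedBall (0 : R3) R).indicator fun _ => M)
    (Metric.ball_mem_nhds s₀ one_pos) ?_ ?_ ?_ ?_ ?_ ?_).2
  · exact Eventually.of_forall fun s => (hcN' s).aestronglyMeasurable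
  · exact hN.integrable hε.le _ hu
  · exact (hcu.comp (by fun_prop : Continuous fun q : R3 => (s₀, q))).aestronglyMeasurable
  · refine Eventually.of_forall fun q s hs => ?_
    by_cases hq : q ∈ Metric.closedBall (0 : R3) R
    · rw [Set.indicator_of_mem hq]
      exact hM (s, q) ⟨Metric.ball_subset_closedBall hs, hq⟩
    · rw [Set.indicator_of_notMem hq, h0' _ _ _ _ (by simpa using hq)]
      simp
  · rw [integrable_indicator_iff Metric.isClosed_closedBall.measurableSet]
    exact integrableOn_const (isCompact_closedBall (0 : R3) R).measure_lt_top.ne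
  · refine Eventually.of_forall fun q s _ => ?_
    have := hN.hasDerivAt_line hε p q v 0 s
    simp only [smul_zero, add_zero] at this
    exact this.mul_const _

/-- Integration by parts moves the derivatives of the regularised kernel that are not tangential
to the boosts onto the density. -/
theorem SingKernel.integral_fderiv {N K : ℝ → R3 → R3 → ℝ} (hN : SingKernel N) {i : Fin 3}
    (hK : ∀ ε p q, 0 < gam p q - 1 + ε →
      HasDerivAt (fun s : ℝ => N ε (p + s • (bracket p • EuclideanSpace.single i (1 : ℝ)))
        (q + s • (bracket q • EuclideanSpace.single i (1 : ℝ)))) (K ε p q) 0)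
    {u u' : R3 → ℝ} (hu : Continuous u) (hu' : Continuous u')
    (huu' : ∀ q, HasLineDerivAt ℝ u (u' q) q (EuclideanSpace.single i 1)) {ε : ℝ} (hε : 0 < ε)
    (p : R3) :
    ∫ q, fderiv ℝ (fun x : R3 × R3 => N ε x.1 x.2) (p, q) (EuclideanSpace.single i 1, 0) * u q
      = (∫ q, (K ε p q + q i / bracket q * N ε p q) / bracket p * u q)
        + ∫ q, bracket q / bracket p * N ε p q * u' q := by
  obtain ⟨R, hR, h0, h0'⟩ := hN.exists_support
  set e : R3 := EuclideanSpace.single i 1 with he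
  set f := fun x : R3 × R3 => N ε x.1 x.2 with hf
  have hp := bracket_ne_zero p
  have hcp : Continuous fun q : R3 => fderiv ℝ f (p, q) (e, 0) :=
    (hN.continuous_fderiv hε (e, 0)).comp (by fun_prop)
  have hcq : Continuous fun q : R3 => fderiv ℝ f (p, q) (0, e) :=
    (hN.continuous_fderiv hε (0, e)).comp (by fun_prop)
  have hcN : Continuous fun q : R3 => N ε p q :=
    (hN.contDiff hε).continuous.comp (by fun_prop : Continuous fun q : R3 => ((p, q) : R3 × R3))
  have hcb : Continuous fun q : R3 => q i / bracket q :=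
    Continuous.div (by fun_prop) continuous_bracket bracket_ne_zero
  -- Chain rule along the boost; this identity is solved for the p-derivative, leaving a
  -- q-derivative to be integrated by parts.
  have hKeq (q : R3) : K ε p q
      = bracket p * fderiv ℝ f (p, q) (e, 0) + bracket q * fderiv ℝ f (p, q) (0, e) := by
    have h1 := hN.hasDerivAt_line hε p q (bracket p • e) (bracket q • e) 0
    have h2 := (hK ε p q (gam_sub_one_add_pos' hε p q)).unique h1
    rw [h2]
    simp only [zero_smul, add_zero]
    rw [← smul_eq_mul, ← smul_eq_mul, ← map_smul, ← map_smul, ← map_add]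
    simp [hf]
  have hint {g : R3 → ℝ} (hg : Continuous g) (hg0 : ∀ q, R < ‖q‖ → g q = 0) : Integrable g := by
    refine hg.integrable_of_hasCompactSupport
      (HasCompactSupport.intro (isCompact_closedBall (0 : R3) R) fun q hq => hg0 q ?_)
    simpa using hq
  have hdN (q : R3) : HasLineDerivAt ℝ (fun q => bracket q * N ε p q)
      (q i / bracket q * N ε p q + bracket q * fderiv ℝ f (p, q) (0, e)) q e := by
    have h1 := hN.hasDerivAt_line hε p q 0 e 0
    have h2 := hasDerivAt_bracket q e
    simp only [smul_zero, add_zero, zero_smul] at h1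
    have h3 := h2.mul h1
    refine h3.congr_deriv ?_
    simp [he, hf, EuclideanSpace.inner_single_right]
  have hi1 : Integrable fun q => u q *
      (q i / bracket q * N ε p q + bracket q * fderiv ℝ f (p, q) (0, e)) := by
    refine hint (by fun_prop) fun q hq => ?_
    rw [h0 _ _ _ hq, h0' _ _ _ _ hq]
    simp
  have hi2 : Integrable fun q => u' q * (bracket q * N ε p q) :=
    hint (by fun_prop) fun q hq => by rw [h0 _ _ _ hq]; simp
  have hi3 : Integrable fun q => u q * (bracket q * N ε p q) :=
    hint (by fun_prop) fun q hq => by rw [h0 _ _ _ hq]; simp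
  -- The product ⟨q⟩N is integrated by parts as a whole; differentiating its factor ⟨q⟩ produces the
  -- term (q_i/⟨q⟩)N of the statement.
  have hibp := integral_bilinear_hasLineDerivAt_right_eq_neg_left_of_integrable
    (μ := (volume : Measure R3)) (B := ContinuousLinearMap.mul ℝ ℝ) hi2 hi1 hi3
    (fun q _ => huu' q) (fun q _ => hdN q)
  simp only [ContinuousLinearMap.mul_apply'] at hibp
  have hA : Integrable fun q => (K ε p q + q i / bracket q * N ε p q) / bracket p * u q := by
    simp_rw [hKeq]
    refine hint ?_ fun q hq => ?_
    · exact ((((continuous_const.mul hcp).add (continuous_bracket.mul hcq)).add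
        (hcb.mul hcN)).div_const _).mul hu
    · rw [h0 _ _ _ hq, h0' _ _ _ _ hq, h0' _ _ _ _ hq]
      simp
  have e1 : ∫ q, bracket q / bracket p * N ε p q * u' q
      = (bracket p)⁻¹ * ∫ q, u' q * (bracket q * N ε p q) := by
    rw [← integral_const_mul]
    congr 1
    funext q
    field_simp
  have e2 : ∫ q, u' q * (bracket q * N ε p q)
      = - ∫ q, u q * (q i / bracket q * N ε p q + bracket q * fderiv ℝ f (p, q) (0, e)) := by
    rw [hibp, neg_neg]
  rw [e1, e2, mul_neg, ← sub_eq_add_neg, ← integral_const_mul,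
    ← integral_sub hA (hi1.const_mul _)]
  congr 1
  funext q
  have hq := bracket_ne_zero q
  rw [hKeq]
  field_simp
  ring

/-- Momentum derivatives of integrals against weakly singular kernels. -/
theorem SingKernel.hasLineDerivAt_integral {N K : ℝ → R3 → R3 → ℝ} (hN : SingKernel N)
    {i : Fin 3}
    (hK : ∀ ε p q, 0 < gam p q - 1 + ε →
      HasDerivAt (fun s : ℝ => N ε (p + s • (bracket p • EuclideanSpace.single i (1 : ℝ)))
        (q + s • (bracket q • EuclideanSpace.single i (1 : ℝ)))) (K ε p q) 0)
    (hN1 : SingKernel fun ε p q => (K ε p q + q i / bracket q * N ε p q) / bracket p)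
    (hN2 : SingKernel fun ε p q => bracket q / bracket p * N ε p q)
    {u u' : R3 → ℝ} (hu : Continuous u) (hu' : Continuous u')
    (huu' : ∀ q, HasLineDerivAt ℝ u (u' q) q (EuclideanSpace.single i 1)) (p : R3) :
    HasLineDerivAt ℝ (fun p => ∫ q, N 0 p q * u q)
      ((∫ q, (K 0 p q + q i / bracket q * N 0 p q) / bracket p * u q)
        + ∫ q, bracket q / bracket p * N 0 p q * u' q) p (EuclideanSpace.single i 1) := by
  set e : R3 := EuclideanSpace.single i 1 with he
  set D : ℝ → R3 → ℝ := fun ε p =>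
    (∫ q, (K ε p q + q i / bracket q * N ε p q) / bracket p * u q)
      + ∫ q, bracket q / bracket p * N ε p q * u' q with hD
  set F : ℝ → R3 → ℝ := fun ε p => ∫ q, N ε p q * u q with hF
  have hDc : ContinuousOn (fun x : ℝ × R3 => D x.1 x.2) {x | 0 ≤ x.1} :=
    (hN1.continuousOn_integral_right hu).add (hN2.continuousOn_integral_right hu')
  have hFc : ContinuousOn (fun x : ℝ × R3 => F x.1 x.2) {x | 0 ≤ x.1} :=
    hN.continuousOn_integral_right hu
  have hDl (ε : ℝ) (hε : 0 ≤ ε) : Continuous fun s : ℝ => D ε (p + s • e) :=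
    hDc.comp_continuous (f := fun s : ℝ => (ε, p + s • e)) (by fun_prop) fun _ => hε
  -- For ε > 0 the kernel is smooth and the formula holds in integrated form along the line. The
  -- limit ε → 0 is taken in this integrated identity, so the singular kernel itself is never
  -- differentiated under the integral sign.
  have hpos (ε : ℝ) (hε : 0 < ε) (s : ℝ) :
      ∫ r in (0 : ℝ)..s, D ε (p + r • e) = F ε (p + s • e) - F ε p := by
    have h1 : ∀ r ∈ Set.uIcc 0 s, HasDerivAt (fun s : ℝ => F ε (p + s • e)) (D ε (p + r • e)) r := by
      intro r _
      refine (hN.hasDerivAt_integral hε p e hu r).congr_deriv ?_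
      exact hN.integral_fderiv hK hu hu' huu' hε _
    rw [intervalIntegral.integral_eq_sub_of_hasDerivAt h1 ((hDl ε hε.le).intervalIntegrable _ _)]
    simp
  have hlim {H : ℝ → R3 → ℝ} (hH : ContinuousOn (fun x : ℝ × R3 => H x.1 x.2) {x | 0 ≤ x.1})
      (p : R3) : Tendsto (fun ε => H ε p) (𝓝[>] 0) (𝓝 (H 0 p)) := by
    have h1 := hH (0, p) (show (0 : ℝ) ≤ 0 from le_rfl)
    refine h1.tendsto.comp (f := fun ε : ℝ => (ε, p)) (tendsto_nhdsWithin_iff.2 ⟨?_, ?_⟩)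
    · exact ((by fun_prop : Continuous fun ε : ℝ => (ε, p)).tendsto 0).mono_left
        nhdsWithin_le_nhds
    · filter_upwards [self_mem_nhdsWithin] with ε hε
      exact le_of_lt hε
  -- Both sides pass to the limit because `D` and `F` are jointly continuous up to ε = 0; continuity
  -- of `D 0` then allows differentiation at s = 0.
  have hzero (s : ℝ) : ∫ r in (0 : ℝ)..s, D 0 (p + r • e) = F 0 (p + s • e) - F 0 p := by
    have hcomp : IsCompact (Set.Icc (0 : ℝ) 1 ×ˢ Set.uIcc 0 s) := isCompact_Icc.prod isCompact_uIcc
    obtain ⟨M, hM⟩ := hcomp.exists_bound_of_continuousOn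
      (f := fun x : ℝ × ℝ => D x.1 (p + x.2 • e))
      (hDc.comp (f := fun x : ℝ × ℝ => (x.1, p + x.2 • e)) (by fun_prop) fun x hx => hx.1.1)
    have hev : ∀ᶠ ε : ℝ in 𝓝[>] 0, 0 < ε ∧ ε ≤ 1 := by
      filter_upwards [self_mem_nhdsWithin, nhdsWithin_le_nhds (Iic_mem_nhds zero_lt_one)]
        with ε h1 h2
      exact ⟨h1, h2⟩
    have hI : Tendsto (fun ε => ∫ r in (0 : ℝ)..s, D ε (p + r • e)) (𝓝[>] 0)
        (𝓝 (∫ r in (0 : ℝ)..s, D 0 (p + r • e))) := by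
      refine intervalIntegral.tendsto_integral_filter_of_dominated_convergence (fun _ => M)
        ?_ ?_ (by simp) ?_
      · filter_upwards [hev] with ε hε
        exact (hDl ε hε.1.le).aestronglyMeasurable
      · filter_upwards [hev] with ε hε
        exact Eventually.of_forall fun r hr =>
          hM (ε, r) ⟨⟨hε.1.le, hε.2⟩, Set.uIoc_subset_uIcc hr⟩
      · exact Eventually.of_forall fun r _ => hlim hDc _
    refine tendsto_nhds_unique hI (((hlim hFc _).sub (hlim hFc _)).congr' ?_)
    filter_upwards [hev] with ε hε
    exact (hpos ε hε.1 s).symm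
  have hder : HasDerivAt (fun s => ∫ r in (0 : ℝ)..s, D 0 (p + r • e)) (D 0 (p + (0 : ℝ) • e)) 0 :=
    intervalIntegral.integral_hasDerivAt_right ((hDl 0 le_rfl).intervalIntegrable _ _)
      ((hDl 0 le_rfl).stronglyMeasurableAtFilter _ _) (hDl 0 le_rfl).continuousAt
  simp only [hzero, zero_smul, add_zero] at hder
  have := hder.add_const (F 0 p)
  simpa [HasLineDerivAt] using this

/-! ### Cut-off kernels -/

/-- Smooth functions vanishing for large arguments. -/
structure IsCut (ψ : ℝ → ℝ) : Prop where
  smooth : ContDiff ℝ (⊤ : ℕ∞) ψ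
  vanish : ∃ R, ∀ s, R < s → ψ s = 0

theorem IsCut.exists_bound {ψ : ℝ → ℝ} (hψ : IsCut ψ) : ∃ B, 0 ≤ B ∧ ∀ s, 0 ≤ s → |ψ s| ≤ B := by
  obtain ⟨R, hR⟩ := hψ.vanish
  obtain ⟨B, hB⟩ := (isCompact_Icc (a := 0) (b := R)).exists_bound_of_continuousOn
    hψ.smooth.continuous.continuousOn
  refine ⟨max B 0, le_max_right _ _, fun s hs => ?_⟩
  rcases le_or_gt s R with h | h
  · exact (hB s ⟨hs, h⟩).trans (le_max_left _ _)
  · rw [hR s h, abs_zero]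
    exact le_max_right _ _

/-- The boost derivative of ψ(δ⟨q⟩²) is 2(q_i/⟨q⟩) sψ'(s) at s = δ⟨q⟩². Since sψ'(s) is again a
cut-off, differentiation costs nothing as δ tends to 0. -/
theorem IsCut.euler {ψ : ℝ → ℝ} (hψ : IsCut ψ) : IsCut fun s => s * deriv ψ s where
  smooth := by
    refine contDiff_id.mul ?_
    exact (contDiff_infty_iff_deriv.1 hψ.smooth).2
  vanish := by
    obtain ⟨R, hR⟩ := hψ.vanish
    refine ⟨R, fun s hs => ?_⟩
    have : ψ =ᶠ[𝓝 s] fun _ => 0 := by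
      filter_upwards [Ioi_mem_nhds hs] with r hr
      exact hR r hr
    rw [this.deriv_eq]
    simp

/-- The kernel `h_ε(γ) ψ(δ⟨q⟩²) w ⟨q⟩^j ⟨p⟩^{-n}`. -/
noncomputable def kern (ψ : ℝ → ℝ) (w : ℝ → R3 → R3 → ℝ) (j n : ℕ) (δ ε : ℝ) (p q : R3) : ℝ :=
  hker ε p q * ψ (δ * bracket q ^ 2) * w ε p q * bracket q ^ j / bracket p ^ n

theorem contDiffAt_kern {ψ : ℝ → ℝ} (hψ : IsCut ψ) {w : ℝ → R3 → R3 → ℝ} (hw : Sym w) (j n : ℕ)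
    (δ : ℝ) {ε : ℝ} {p q : R3} (h : 0 < gam p q - 1 + ε) :
    ContDiffAt ℝ 1 (fun x : ℝ × R3 × R3 => kern ψ w j n δ x.1 x.2.1 x.2.2) (ε, p, q) := by
  have hb := contDiff_bracket
  have hp : ContDiff ℝ 1 (fun x : ℝ × R3 × R3 => bracket x.2.1) := hb.comp (by fun_prop)
  have hq : ContDiff ℝ 1 (fun x : ℝ × R3 × R3 => bracket x.2.2) := hb.comp (by fun_prop)
  have hψ1 : ContDiff ℝ 1 ψ := hψ.smooth.of_le (by exact_mod_cast le_top)
  unfold kern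
  refine ContDiffAt.div ?_ (hp.pow n).contDiffAt (pow_ne_zero _ (bracket_ne_zero p))
  refine (((contDiffAt_hker h).mul ?_).mul (hw.contDiffAt h)).mul (hq.pow j).contDiffAt
  exact (hψ1.comp (contDiff_const.mul (hq.pow 2))).contDiffAt

theorem exists_kern_bound {ψ : ℝ → ℝ} (hψ : IsCut ψ) {w : ℝ → R3 → R3 → ℝ} (hw : Sym w)
    (j n : ℕ) : ∃ C, 0 ≤ C ∧ ∀ δ ε p q, 0 ≤ δ → 0 ≤ ε → p ≠ q →
      |kern ψ w j n δ ε p q| ≤ C * (bracket q ^ (j + 1) * (1 + ‖p - q‖⁻¹)) / bracket p ^ n := by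
  obtain ⟨B, hB, hψB⟩ := hψ.exists_bound
  obtain ⟨A, hA, hwA⟩ := hw.exists_bound
  refine ⟨4 * B * A, by positivity, fun δ ε p q hδ hε h => ?_⟩
  have hp := bracket_pos p
  have hq := bracket_pos q
  have h1 := hker_le hε h
  have h2 := hψB (δ * bracket q ^ 2) (by positivity)
  have h3 := hwA ε p q hε
  unfold kern
  rw [abs_div, abs_mul, abs_mul, abs_mul, abs_of_nonneg (hker_nonneg ε p q),
    abs_of_pos (pow_pos hq j), abs_of_pos (pow_pos hp n),
    div_le_div_iff_of_pos_right (pow_pos hp n)]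
  calc _ ≤ (4 * bracket q * (1 + ‖p - q‖⁻¹)) * B * A * bracket q ^ j := by gcongr
    _ = _ := by ring

theorem kern_eq_zero {ψ : ℝ → ℝ} (hψ : IsCut ψ) (w : ℝ → R3 → R3 → ℝ) (j n : ℕ) {δ : ℝ}
    (hδ : 0 < δ) : ∃ R, 0 < R ∧ ∀ ε p q, R < ‖q‖ → kern ψ w j n δ ε p q = 0 := by
  obtain ⟨R, hR⟩ := hψ.vanish
  refine ⟨|R| / δ + 1, by positivity, fun ε p q hq => ?_⟩
  have h1 : R < δ * bracket q ^ 2 := by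
    rw [bracket_sq]
    have e1 : 0 ≤ |R| / δ := by positivity
    have e2 : |R| / δ < 1 + ‖q‖ ^ 2 := by nlinarith
    rw [div_lt_iff₀ hδ] at e2
    linarith [le_abs_self R]
  unfold kern
  rw [hR _ h1]
  simp

theorem singKernel_kern {ψ : ℝ → ℝ} (hψ : IsCut ψ) {w : ℝ → R3 → R3 → ℝ} (hw : Sym w) (j n : ℕ)
    {δ : ℝ} (hδ : 0 < δ) : SingKernel fun ε p q => kern ψ w j n δ ε p q where
  contDiffAt _ _ _ h := contDiffAt_kern hψ hw j n δ h
  bound := by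
    obtain ⟨C, hC, hb⟩ := exists_kern_bound hψ hw j n
    obtain ⟨R, hR, h0⟩ := kern_eq_zero hψ w j n hδ
    refine ⟨C * (1 + R) ^ (j + 1), R, by positivity, hR, h0, fun ε p q hε h => ?_⟩
    by_cases hq : R < ‖q‖
    · rw [h0 ε p q hq, abs_zero]
      positivity
    · refine (hb δ ε p q hδ.le hε h).trans ?_
      have h1 : bracket q ≤ 1 + R := by
        have := abs_bracket_sub_le q 0
        have e : bracket (0 : R3) = 1 := by simp [bracket]
        rw [e, sub_zero] at this
        linarith [le_abs_self (bracket q - 1)]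
      have h2 : 1 ≤ bracket p ^ n := one_le_pow₀ (one_le_bracket p)
      have h3 := bracket_pos q
      calc _ ≤ C * (bracket q ^ (j + 1) * (1 + ‖p - q‖⁻¹)) := div_le_self (by positivity) h2
        _ ≤ C * ((1 + R) ^ (j + 1) * (1 + ‖p - q‖⁻¹)) := by gcongr
        _ = _ := by ring

/-- Gradient bound for the kernels, uniform in both regularisation parameters. -/
theorem exists_kern_grad_bound {ψ : ℝ → ℝ} (hψ : IsCut ψ) {w : ℝ → R3 → R3 → ℝ} (hw : Sym w)
    (j n : ℕ) : ∃ C, 0 ≤ C ∧ ∀ δ ε p q v, 0 ≤ δ → 0 ≤ ε → p ≠ q →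
      ∃ D, HasDerivAt (fun s : ℝ => kern ψ w j n δ ε (p + s • v) q) D 0 ∧
        bracket p * |D| ≤ C * ‖v‖ * (bracket q ^ (j + 4) * (1 + ‖p - q‖⁻¹) ^ 2)
          / bracket p ^ n := by
  obtain ⟨B, hB, hψB⟩ := hψ.exists_bound
  obtain ⟨A, hA, hwA⟩ := hw.exists_bound
  obtain ⟨A', hA', hwA'⟩ := hw.exists_grad_bound
  refine ⟨4 * B * (64 * A + A' + n * A), by positivity, fun δ ε p q v hδ hε h => ?_⟩
  have hp := bracket_pos p
  have hq := one_le_bracket q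
  have hq0 := bracket_pos q
  have h1 := hker_le hε h
  have h1' := hker_nonneg ε p q
  have h2 := hψB (δ * bracket q ^ 2) (by positivity)
  have h3 := hwA ε p q hε
  obtain ⟨Dh, hDh, bh⟩ := exists_deriv_hker hε h v
  obtain ⟨Dw, hDw, bw⟩ := hwA' ε p q v hε h
  have hb := hasDerivAt_bracket p v
  have hbv := abs_inner_div_bracket_le p v
  set Q := bracket q ^ 3 * (1 + ‖p - q‖⁻¹) with hQ
  have hi : 0 ≤ ‖p - q‖⁻¹ := by positivity
  have hQ1 : 1 ≤ Q :=
    one_le_mul_of_one_le_of_one_le (one_le_pow₀ hq) (by linarith)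
  refine ⟨ψ (δ * bracket q ^ 2) * bracket q ^ j / bracket p ^ n
    * (Dh * w ε p q + hker ε p q * Dw
      - n * (hker ε p q * w ε p q * (⟪p, v⟫_ℝ / bracket p)) / bracket p), ?_, ?_⟩
  · have hd := ((((hDh.mul_const (ψ (δ * bracket q ^ 2))).mul hDw).mul_const
      (bracket q ^ j)).div (hb.pow n) (by simp [bracket_ne_zero p]))
    unfold kern
    refine hd.congr_deriv ?_
    simp only [Pi.mul_apply, Pi.pow_apply, zero_smul, add_zero]
    -- The power rule involves the truncated `n - 1`, so n = 0 is treated apart.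
    rcases n with _ | n
    · simp
      ring
    · simp only [Nat.add_sub_cancel]
      field_simp
      ring
  · have b1 : bracket p * |Dh * w ε p q + hker ε p q * Dw
        - n * (hker ε p q * w ε p q * (⟪p, v⟫_ℝ / bracket p)) / bracket p|
        ≤ hker ε p q * ((64 * A + A' + n * A) * ‖v‖ * Q) := by
      have e1 : bracket p * |Dh * w ε p q| ≤ (64 * ‖v‖ * Q * hker ε p q) * A := by
        rw [abs_mul, ← mul_assoc]
        gcongr
      have e2 : bracket p * |hker ε p q * Dw| ≤ hker ε p q * (A' * ‖v‖ * Q) := by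
        rw [abs_mul, abs_of_nonneg h1', mul_left_comm]
        gcongr
      have e3 : bracket p * |n * (hker ε p q * w ε p q * (⟪p, v⟫_ℝ / bracket p)) / bracket p|
          ≤ n * (hker ε p q * A * ‖v‖) := by
        rw [abs_div, abs_of_pos hp, mul_div_cancel₀ _ hp.ne', abs_mul, abs_mul, abs_mul,
          abs_of_nonneg h1', Nat.abs_cast]
        gcongr
      have e4 : (n : ℝ) * (hker ε p q * A * ‖v‖) ≤ hker ε p q * (n * A * ‖v‖ * Q) := by
        calc _ = hker ε p q * (n * A * ‖v‖ * 1) := by ring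
          _ ≤ _ := by gcongr
      calc _ ≤ bracket p * (|Dh * w ε p q| + |hker ε p q * Dw|
            + |n * (hker ε p q * w ε p q * (⟪p, v⟫_ℝ / bracket p)) / bracket p|) := by
            gcongr
            exact (abs_sub _ _).trans (add_le_add (abs_add_le _ _) le_rfl)
        _ ≤ _ := by
          rw [mul_add, mul_add]
          linarith
    rw [abs_mul, abs_div, abs_mul, abs_of_pos (pow_pos hq0 j), abs_of_pos (pow_pos hp n)]
    calc _ = |ψ (δ * bracket q ^ 2)| * bracket q ^ j / bracket p ^ n * (bracket p *
          |Dh * w ε p q + hker ε p q * Dw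
            - n * (hker ε p q * w ε p q * (⟪p, v⟫_ℝ / bracket p)) / bracket p|) := by ring
      _ ≤ B * bracket q ^ j / bracket p ^ n * ((4 * bracket q * (1 + ‖p - q‖⁻¹))
          * ((64 * A + A' + n * A) * ‖v‖ * Q)) := by
          refine mul_le_mul (by gcongr) (b1.trans (by gcongr)) (by positivity) (by positivity)
      _ = _ := by
        rw [hQ]
        ring

/-- The boost derivative of a kernel is a sum of two kernels of the same type. -/
theorem exists_kern_boost {ψ : ℝ → ℝ} (hψ : IsCut ψ) {w : ℝ → R3 → R3 → ℝ} (hw : Sym w)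
    (j n : ℕ) (i : Fin 3) : ∃ w', Sym w' ∧ ∀ δ ε p q, 0 < gam p q - 1 + ε →
      HasDerivAt (fun s : ℝ =>
          kern ψ w j n δ ε (p + s • (bracket p • EuclideanSpace.single i (1 : ℝ)))
          (q + s • (bracket q • EuclideanSpace.single i (1 : ℝ))))
        (kern (fun s => s * deriv ψ s) (fun ε p q => 2 * (q i / bracket q) * w ε p q) j n δ ε p q
          + kern ψ w' j n δ ε p q) 0 := by
  obtain ⟨w₁, hw₁, h₁⟩ := hw.exists_boost i
  refine ⟨_, hw₁.add ((((Sym.const j).mul (Sym.qdir i)).sub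
    ((Sym.const n).mul (Sym.pdir i))).mul hw), fun δ ε p q h => ?_⟩
  have hp := hasDerivAt_boost_bracket p i
  have hq := hasDerivAt_boost_bracket q i
  have hp0 := bracket_ne_zero p
  have hq0 := bracket_ne_zero q
  have hψ1 : HasDerivAt (fun s : ℝ => ψ (δ * bracket (q + s • (bracket q •
      EuclideanSpace.single i (1 : ℝ))) ^ 2))
      (deriv ψ (δ * bracket q ^ 2) * (δ * (2 * bracket q * q i))) 0 := by
    have e1 : HasDerivAt ψ (deriv ψ (δ * bracket q ^ 2)) (δ * bracket (q + (0 : ℝ) • (bracket q •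
      EuclideanSpace.single i (1 : ℝ))) ^ 2) := by
      simpa using ((hψ.smooth.differentiable (by simp)) (δ * bracket q ^ 2)).hasDerivAt
    refine (e1.comp (0 : ℝ) ((hq.pow 2).const_mul δ)).congr_deriv ?_
    simp
  have hd := ((((hasDerivAt_boost_hker h i).mul hψ1).mul (h₁ ε p q h)).mul (hq.pow j)).div
    (hp.pow n) (by simp [hp0])
  unfold kern
  refine hd.congr_deriv ?_
  simp only [Pi.mul_apply, Pi.pow_apply, zero_smul, add_zero]
  rcases n with _ | n <;> rcases j with _ | j <;> simp <;> field_simp <;> ring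

/-! ### Kernels away from the diagonal -/

/-- Symbols that are bounded, with all their derivatives in `p`, when `q` is large compared with
`p`. -/
inductive FarSym : (R3 → R3 → ℝ) → Prop
  | const (c : ℝ) : FarSym (fun _ _ => c)
  | pcoord (i : Fin 3) : FarSym (fun p _ => p i)
  | pinv : FarSym (fun p _ => 1 / bracket p)
  | qdir (i : Fin 3) : FarSym (fun _ q => q i / bracket q)
  | qinv : FarSym (fun _ q => 1 / bracket q)
  | gamma : FarSym (fun p q => gam p q / bracket q)
  | gammaInv : FarSym (fun p q => bracket q / gam p q)
  | gammaSubInv : FarSym (fun p q => bracket q / (gam p q - 1))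
  | gammaAddInv : FarSym (fun p q => bracket q / (gam p q + 1))
  | hker : FarSym (fun p q => hker 0 p q)
  | add {v w} (hv : FarSym v) (hw : FarSym w) : FarSym (fun p q => v p q + w p q)
  | mul {v w} (hv : FarSym v) (hw : FarSym w) : FarSym (fun p q => v p q * w p q)

theorem FarSym.neg {w : R3 → R3 → ℝ} (hw : FarSym w) : FarSym (fun p q => - w p q) := by
  simpa using (FarSym.const (-1)).mul hw

theorem FarSym.sub {v w : R3 → R3 → ℝ} (hv : FarSym v) (hw : FarSym w) :
    FarSym (fun p q => v p q - w p q) := by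
  simpa [sub_eq_add_neg] using hv.add hw.neg

theorem FarSym.continuousAt {f : R3 → R3 → ℝ} (hf : FarSym f) {p q : R3} (h : p ≠ q) :
    ContinuousAt (fun x : R3 × R3 => f x.1 x.2) (p, q) := by
  have hγ := one_lt_gam h
  have hp : Continuous (fun x : R3 × R3 => bracket x.1) := by fun_prop
  have hq : Continuous (fun x : R3 × R3 => bracket x.2) := by fun_prop
  have hg := continuous_gam
  induction hf with
  | const c => exact continuousAt_const
  | pcoord i => exact (by fun_prop : Continuous fun x : R3 × R3 => x.1 i).continuousAt
  | pinv => exact continuousAt_const.div hp.continuousAt (bracket_ne_zero p)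
  | qdir i =>
    exact (by fun_prop : Continuous fun x : R3 × R3 => x.2 i).continuousAt.div hq.continuousAt
      (bracket_ne_zero q)
  | qinv => exact continuousAt_const.div hq.continuousAt (bracket_ne_zero q)
  | gamma => exact hg.continuousAt.div hq.continuousAt (bracket_ne_zero q)
  | gammaInv => exact hq.continuousAt.div hg.continuousAt (gam_pos p q).ne'
  | gammaSubInv =>
    exact hq.continuousAt.div (hg.continuousAt.sub continuousAt_const)
      (by simpa using (by linarith : gam p q - 1 ≠ 0))
  | gammaAddInv =>
    exact hq.continuousAt.div (hg.continuousAt.add continuousAt_const)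
      (by simpa using (by linarith : gam p q + 1 ≠ 0))
  | hker =>
    exact ContinuousAt.comp (x := (p, q)) (f := fun x : R3 × R3 => ((0, x.1, x.2) : ℝ × R3 × R3))
      (g := fun x : ℝ × R3 × R3 => RelLandau.hker x.1 x.2.1 x.2.2)
      (contDiffAt_hker (gam_sub_one_add_pos le_rfl h)).continuousAt (by fun_prop)
  | add _ _ h1 h2 => exact h1.add h2
  | mul _ _ h1 h2 => exact h1.mul h2

/-- The derivative ∂_{p_i}γ equals ⟨q⟩ times the far symbol p_i/⟨p⟩ - q_i/⟨q⟩. The factor ⟨q⟩ is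
compensated by the normalisations ⟨q⟩/γ and ⟨q⟩/(γ±1), so the class is closed under ∂_p without any
integration by parts. -/
theorem FarSym.exists_deriv {f : R3 → R3 → ℝ} (hf : FarSym f) (i : Fin 3) :
    ∃ f', FarSym f' ∧ ∀ p q, p ≠ q →
      HasDerivAt (fun s : ℝ => f (p + s • EuclideanSpace.single i (1 : ℝ)) q) (f' p q) 0 := by
  have hγ' (p q : R3) : HasDerivAt (fun s : ℝ => gam (p + s • EuclideanSpace.single i (1 : ℝ)) q)
      (bracket q * (p i * (1 / bracket p) - q i / bracket q)) 0 := by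
    refine (hasDerivAt_gam_left p q _).congr_deriv ?_
    have := bracket_ne_zero p
    have := bracket_ne_zero q
    simp [EuclideanSpace.inner_single_left, EuclideanSpace.inner_single_right]
    field_simp
  have hb (p : R3) : HasDerivAt (fun s : ℝ => bracket (p + s • EuclideanSpace.single i (1 : ℝ)))
      (p i / bracket p) 0 :=
    (hasDerivAt_bracket p _).congr_deriv (by simp [EuclideanSpace.inner_single_right])
  have hE : FarSym fun p q => p i * (1 / bracket p) - q i / bracket q :=
    ((FarSym.pcoord i).mul .pinv).sub (.qdir i)
  induction hf with
  | const c => exact ⟨_, .const 0, fun _ _ _ => hasDerivAt_const _ _⟩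
  | pcoord j =>
    refine ⟨_, .const (if j = i then 1 else 0), fun p q _ => ?_⟩
    refine (hasDerivAt_coord p _ j).congr_deriv ?_
    simp
  | pinv =>
    refine ⟨_, ((FarSym.pcoord i).mul ((FarSym.pinv.mul .pinv).mul .pinv)).neg, fun p q _ => ?_⟩
    have hp := bracket_ne_zero p
    refine ((hasDerivAt_const _ (1 : ℝ)).div (hb p) (by simpa using hp)).congr_deriv ?_
    simp
    field_simp
  | qdir j => exact ⟨_, .const 0, fun _ _ _ => hasDerivAt_const _ _⟩
  | qinv => exact ⟨_, .const 0, fun _ _ _ => hasDerivAt_const _ _⟩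
  | gamma =>
    refine ⟨_, hE, fun p q _ => ?_⟩
    have hq := bracket_ne_zero q
    refine ((hγ' p q).div_const _).congr_deriv ?_
    rw [mul_div_cancel_left₀ _ hq]
  | gammaInv =>
    refine ⟨_, ((FarSym.gammaInv.mul .gammaInv).mul hE).neg, fun p q _ => ?_⟩
    have h0 := (gam_pos p q).ne'
    refine ((hasDerivAt_const _ (bracket q)).div (hγ' p q) (by simpa using h0)).congr_deriv ?_
    simp only [zero_smul, add_zero, zero_mul, zero_sub]
    field_simp
  | gammaSubInv =>
    refine ⟨_, ((FarSym.gammaSubInv.mul .gammaSubInv).mul hE).neg, fun p q h => ?_⟩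
    have h0 : gam p q - 1 ≠ 0 := by linarith [one_lt_gam h]
    refine ((hasDerivAt_const _ (bracket q)).div ((hγ' p q).sub_const 1)
      (by simpa using h0)).congr_deriv ?_
    simp only [zero_smul, add_zero, zero_mul, zero_sub]
    field_simp
  | gammaAddInv =>
    refine ⟨_, ((FarSym.gammaAddInv.mul .gammaAddInv).mul hE).neg, fun p q h => ?_⟩
    have h0 : gam p q + 1 ≠ 0 := by linarith [gam_pos p q]
    refine ((hasDerivAt_const _ (bracket q)).div ((hγ' p q).add_const 1)
      (by simpa using h0)).congr_deriv ?_
    simp only [zero_smul, add_zero, zero_mul, zero_sub]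
    field_simp
  | hker =>
    refine ⟨_, (FarSym.hker.mul ((((FarSym.const 2).mul .gammaInv).sub
      ((FarSym.const (1 / 2)).mul .gammaSubInv)).sub
      ((FarSym.const (3 / 2)).mul .gammaAddInv))).mul hE, fun p q h => ?_⟩
    have h1 : gam p q - 1 ≠ 0 := by linarith [one_lt_gam h]
    have h2 : gam p q + 1 ≠ 0 := by linarith [gam_pos p q]
    have h0 := (gam_pos p q).ne'
    have hG : HasDerivAt (fun s : ℝ => gam (p + s • EuclideanSpace.single i (1 : ℝ))
      (q + s • (0 : R3))) (bracket q * (p i * (1 / bracket p) - q i / bracket q)) 0 := by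
      simpa only [smul_zero, add_zero] using hγ' p q
    have := hasDerivAt_hker (gam_sub_one_add_pos le_rfl h) hG
    simp only [smul_zero, add_zero] at this
    refine this.congr_deriv ?_
    field_simp
  | add hv hw h1 h2 =>
    obtain ⟨v', hv', h1⟩ := h1
    obtain ⟨w', hw', h2⟩ := h2
    exact ⟨_, hv'.add hw', fun p q h => (h1 p q h).add (h2 p q h)⟩
  | mul hv hw h1 h2 =>
    obtain ⟨v', hv', h1⟩ := h1
    obtain ⟨w', hw', h2⟩ := h2
    refine ⟨_, (hv'.mul hw).add (hv.mul hw'), fun p q h => ?_⟩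
    refine ((h1 p q h).mul (h2 p q h)).congr_deriv ?_
    simp

theorem hker_le_two {p q : R3} (h : 2 ≤ gam p q) : hker 0 p q ≤ 2 := by
  unfold hker
  have h1 : 0 < √(gam p q - 1 + 0) := Real.sqrt_pos.2 (by linarith)
  have h2 : 0 < √(gam p q + 1) := Real.sqrt_pos.2 (by linarith)
  have e1 : √(gam p q - 1 + 0) ^ 2 = gam p q - 1 := by rw [Real.sq_sqrt] <;> linarith
  have e2 : √(gam p q + 1) ^ 2 = gam p q + 1 := Real.sq_sqrt (by linarith)
  rw [div_le_iff₀ (by positivity)]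
  apply le_of_sq_le_sq _ (by positivity)
  calc (gam p q ^ 2) ^ 2 = gam p q * gam p q ^ 3 := by ring
    _ ≤ (2 * (gam p q - 1)) * (gam p q + 1) ^ 3 := by
      gcongr <;> linarith
    _ ≤ 4 * (gam p q - 1) * (gam p q + 1) ^ 3 := by
      have : 0 ≤ (gam p q - 1) * (gam p q + 1) ^ 3 :=
        mul_nonneg (by linarith) (pow_nonneg (by linarith) 3)
      nlinarith
    _ = (2 * (√(gam p q - 1 + 0) * √(gam p q + 1) ^ 3)) ^ 2 := by
      rw [mul_pow, mul_pow, ← pow_mul, mul_comm 3 2, pow_mul, e1, e2]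
      ring

/-- Where ⟨q⟩ > 4⟨p⟩, the inequality ⟨q⟩ ≤ 2⟨p⟩γ forces γ > 2 and makes γ comparable to ⟨q⟩ for
bounded p. The dependence on R is harmless: far parts enter only qualitatively. -/
theorem FarSym.exists_bound {f : R3 → R3 → ℝ} (hf : FarSym f) (R : ℝ) :
    ∃ C, 0 ≤ C ∧ ∀ p q, bracket p ≤ R → 4 * bracket p < bracket q → |f p q| ≤ C := by
  have hγ (p q : R3) (h : 4 * bracket p < bracket q) :
      2 < gam p q ∧ bracket q ≤ 2 * bracket p * gam p q := by
    have h1 := bracket_le_two_mul_gam q p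
    rw [gam_comm] at h1
    have := bracket_pos p
    exact ⟨by nlinarith, h1⟩
  induction hf with
  | const c => exact ⟨|c|, abs_nonneg c, fun _ _ _ _ => le_rfl⟩
  | pcoord i =>
    exact ⟨|R|, abs_nonneg _, fun p q h _ =>
      (abs_coord_le_bracket p i).trans (h.trans (le_abs_self R))⟩
  | pinv =>
    refine ⟨1, zero_le_one, fun p q _ _ => ?_⟩
    rw [abs_div, abs_of_pos (bracket_pos p), div_le_one (bracket_pos p), abs_one]
    exact one_le_bracket p
  | qdir i =>
    refine ⟨1, zero_le_one, fun p q _ _ => ?_⟩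
    rw [abs_div, abs_of_pos (bracket_pos q), div_le_one (bracket_pos q)]
    exact abs_coord_le_bracket q i
  | qinv =>
    refine ⟨1, zero_le_one, fun p q _ _ => ?_⟩
    rw [abs_div, abs_of_pos (bracket_pos q), div_le_one (bracket_pos q), abs_one]
    exact one_le_bracket q
  | gamma =>
    refine ⟨2 * |R|, by positivity, fun p q h _ => ?_⟩
    have hq := bracket_pos q
    rw [abs_div, abs_of_pos hq, abs_of_pos (gam_pos p q), div_le_iff₀ hq]
    have := gam_le p q
    have := le_abs_self R
    nlinarith
  | gammaInv =>
    refine ⟨2 * |R|, by positivity, fun p q h h' => ?_⟩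
    obtain ⟨h1, h2⟩ := hγ p q h'
    rw [abs_div, abs_of_pos (bracket_pos q), abs_of_pos (gam_pos p q), div_le_iff₀ (gam_pos p q)]
    have := le_abs_self R
    nlinarith
  | gammaSubInv =>
    refine ⟨4 * |R|, by positivity, fun p q h h' => ?_⟩
    obtain ⟨h1, h2⟩ := hγ p q h'
    have h3 : 0 < gam p q - 1 := by linarith
    rw [abs_div, abs_of_pos (bracket_pos q), abs_of_pos h3, div_le_iff₀ h3]
    have := le_abs_self R
    have := bracket_pos p
    nlinarith
  | gammaAddInv =>
    refine ⟨2 * |R|, by positivity, fun p q h h' => ?_⟩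
    obtain ⟨h1, h2⟩ := hγ p q h'
    have h3 : 0 < gam p q + 1 := by linarith
    rw [abs_div, abs_of_pos (bracket_pos q), abs_of_pos h3, div_le_iff₀ h3]
    have := le_abs_self R
    have := bracket_pos p
    nlinarith
  | hker =>
    refine ⟨2, zero_le_two, fun p q h h' => ?_⟩
    rw [abs_of_nonneg (hker_nonneg _ _ _)]
    exact hker_le_two (hγ p q h').1.le
  | add _ _ h1 h2 =>
    obtain ⟨C, hC, h1⟩ := h1
    obtain ⟨D, hD, h2⟩ := h2
    exact ⟨C + D, by positivity, fun p q h h' =>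
      (abs_add_le _ _).trans (add_le_add (h1 p q h h') (h2 p q h h'))⟩
  | mul _ _ h1 h2 =>
    obtain ⟨C, hC, h1⟩ := h1
    obtain ⟨D, hD, h2⟩ := h2
    refine ⟨C * D, by positivity, fun p q h h' => ?_⟩
    rw [abs_mul]
    exact mul_le_mul (h1 p q h h') (h2 p q h h') (abs_nonneg _) hC

/-! ### Far symbols multiplied by the complementary cut-off. -/

/-- A smooth cut-off, equal to one on `s ≤ 1` and to zero on `s ≥ 2`. -/
noncomputable def cutoff (s : ℝ) : ℝ := Real.smoothTransition (2 - s)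

theorem isCut_cutoff : IsCut cutoff where
  smooth := Real.smoothTransition.contDiff.comp (contDiff_const.sub contDiff_id)
  vanish := ⟨2, fun _ hs => Real.smoothTransition.zero_of_nonpos (by linarith)⟩

theorem cutoff_of_le_one {s : ℝ} (hs : s ≤ 1) : cutoff s = 1 :=
  Real.smoothTransition.one_of_one_le (by linarith)

theorem abs_one_sub_cutoff_le (s : ℝ) : |1 - cutoff s| ≤ 1 := by
  have h1 := Real.smoothTransition.nonneg (2 - s)
  have h2 := Real.smoothTransition.le_one (2 - s)
  unfold cutoff
  rw [abs_le]
  constructor <;> linarith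

/-- The kernel `f (1 - χ(δ⟨q⟩²))`. -/
noncomputable def farKern (f : R3 → R3 → ℝ) (δ : ℝ) (p q : R3) : ℝ :=
  f p q * (1 - cutoff (δ * bracket q ^ 2))

theorem farKern_of_le {f : R3 → R3 → ℝ} {δ : ℝ} {p q : R3} (h : δ * bracket q ^ 2 ≤ 1) :
    farKern f δ p q = 0 := by
  unfold farKern
  rw [cutoff_of_le_one h]
  simp

/-- The condition on p is the one defining `dom`: it keeps the support of the complementary cut-off
away from the diagonal. -/
theorem four_mul_bracket_lt {δ : ℝ} (hδ : 0 < δ) {p q : R3} (hp : 16 * (δ * bracket p ^ 2) < 1)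
    (hq : 1 < δ * bracket q ^ 2) : 4 * bracket p < bracket q := by
  have h1 : (4 * bracket p) ^ 2 < bracket q ^ 2 := by nlinarith
  exact lt_of_pow_lt_pow_left₀ 2 (bracket_pos q).le h1

theorem ne_of_four_mul_bracket_lt {p q : R3} (h : 4 * bracket p < bracket q) : p ≠ q := by
  rintro rfl
  linarith [bracket_pos p]

theorem FarSym.exists_farKern_bound {f : R3 → R3 → ℝ} (hf : FarSym f) (R : ℝ) :
    ∃ C, 0 ≤ C ∧ ∀ δ p q, 0 < δ → bracket p ≤ R → 16 * (δ * bracket p ^ 2) < 1 →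
      |farKern f δ p q| ≤ C := by
  obtain ⟨C, hC, hb⟩ := hf.exists_bound R
  refine ⟨C, hC, fun δ p q hδ hR hp => ?_⟩
  rcases le_or_gt (δ * bracket q ^ 2) 1 with h | h
  · rw [farKern_of_le h, abs_zero]
    exact hC
  · unfold farKern
    rw [abs_mul]
    calc _ ≤ C * 1 := by
          have := hb p q hR (four_mul_bracket_lt hδ hp h)
          have := abs_one_sub_cutoff_le (δ * bracket q ^ 2)
          gcongr
      _ = C := mul_one C

theorem FarSym.continuousAt_farKern {f : R3 → R3 → ℝ} (hf : FarSym f) {δ : ℝ} {p q : R3}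
    (h : p ≠ q) : ContinuousAt (fun x : R3 × R3 => farKern f δ x.1 x.2) (p, q) := by
  unfold farKern
  refine (hf.continuousAt h).mul ?_
  have := isCut_cutoff.smooth.continuous
  fun_prop

theorem FarSym.continuousAt_farKern_left {f : R3 → R3 → ℝ} (hf : FarSym f) {δ : ℝ} (hδ : 0 < δ)
    {p : R3} (hp : 16 * (δ * bracket p ^ 2) < 1) (q : R3) :
    ContinuousAt (fun p => farKern f δ p q) p := by
  rcases le_or_gt (δ * bracket q ^ 2) 1 with h | h
  · simp only [farKern_of_le h]
    exact continuousAt_const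
  · exact ContinuousAt.comp (f := fun p : R3 => ((p, q) : R3 × R3)) (hf.continuousAt_farKern
      (ne_of_four_mul_bracket_lt (four_mul_bracket_lt hδ hp h))) (by fun_prop)

theorem FarSym.aestronglyMeasurable_farKern {f : R3 → R3 → ℝ} (hf : FarSym f) {δ : ℝ} (p : R3)
    {u : R3 → ℝ} (hu : Continuous u) : AEStronglyMeasurable fun q => farKern f δ p q * u q :=
  aestronglyMeasurable_of_continuousAt p fun _ h =>
    (ContinuousAt.comp (f := fun q : R3 => ((p, q) : R3 × R3)) (hf.continuousAt_farKern h)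
      (by fun_prop)).mul hu.continuousAt

theorem FarSym.exists_farKern_deriv {f : R3 → R3 → ℝ} (hf : FarSym f) (i : Fin 3) :
    ∃ f', FarSym f' ∧ ∀ δ p q, 0 < δ → 16 * (δ * bracket p ^ 2) < 1 →
      HasDerivAt (fun s : ℝ => farKern f δ (p + s • EuclideanSpace.single i (1 : ℝ)) q)
        (farKern f' δ p q) 0 := by
  obtain ⟨f', hf', hd⟩ := hf.exists_deriv i
  refine ⟨f', hf', fun δ p q hδ hp => ?_⟩
  rcases le_or_gt (δ * bracket q ^ 2) 1 with h | h
  · simp only [farKern_of_le h]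
    exact hasDerivAt_const _ _
  · exact (hd p q (ne_of_four_mul_bracket_lt (four_mul_bracket_lt hδ hp h))).mul_const _

/-! ### The operators occurring in derivatives of the coefficients -/

/-- Operators acting on a family `G` of functions on phase space, indexed by momentum
multi-indices; the operators of order `γ` involve the members of order at most `γ`. The
parameter `δ` splits the kernels into a compactly supported and a regular part. -/
inductive Op : (Fin 3 → ℕ) → (ℝ → ((Fin 3 → ℕ) → Phase → ℝ) → Phase → ℝ) → Prop
  | near {γ γ' : Fin 3 → ℕ} {ψ : ℝ → ℝ} {w : ℝ → R3 → R3 → ℝ} {j : ℕ} (hψ : IsCut ψ) (hw : Sym w)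
      (hγ : γ' ≤ γ) (hj : j ≤ order γ) :
      Op γ (fun δ G z => ∫ q, kern ψ w j (order γ) δ 0 z.2.2 q * G γ' (z.1, z.2.1, q))
  | far {γ : Fin 3 → ℕ} {f : R3 → R3 → ℝ} (hf : FarSym f) :
      Op γ (fun δ G z => ∫ q, farKern f δ z.2.2 q * G 0 (z.1, z.2.1, q))
  | loc {γ γ' : Fin 3 → ℕ} {w : ℝ → R3 → R3 → ℝ} {j : ℕ} (hw : Sym w) (hγ : γ' ≤ γ)
      (hj : j ≤ order γ) : Op γ (fun _ G z =>
        w 1 z.2.2 z.2.2 * bracket z.2.2 ^ j / bracket z.2.2 ^ order γ * G γ' z)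
  | add {γ : Fin 3 → ℕ} {A B : ℝ → ((Fin 3 → ℕ) → Phase → ℝ) → Phase → ℝ} (hA : Op γ A)
      (hB : Op γ B) : Op γ (fun δ G z => A δ G z + B δ G z)

/-- The part of the cylinder where the splitting with parameter `δ` is admissible. -/
def dom (Ω : Set (ℝ × R3)) (δ : ℝ) : Set Phase :=
  {z | z ∈ cyl Ω ∧ 16 * (δ * bracket z.2.2 ^ 2) < 1}

theorem isOpen_dom {Ω : Set (ℝ × R3)} (hΩ : IsOpen Ω) (δ : ℝ) : IsOpen (dom Ω δ) := by
  refine (isOpen_cyl hΩ).inter ?_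
  have : Continuous fun z : Phase => 16 * (δ * bracket z.2.2 ^ 2) := by fun_prop
  exact isOpen_Iio.preimage this

/-- The regularity of a family that the operators of order `γ` require. -/
structure Reg (Ω : Set (ℝ × R3)) (γ : Fin 3 → ℕ) (G : (Fin 3 → ℕ) → Phase → ℝ) : Prop where
  cont : ∀ γ' ≤ γ, ContinuousOn (G γ') (cyl Ω)
  dominated : ∀ y ∈ Ω, ∃ w : R3 → ℝ, Integrable w ∧
    ∀ᶠ y' in 𝓝 y, ∀ q : R3, |G 0 (y'.1, y'.2, q)| ≤ w q

theorem order_add_single (γ : Fin 3 → ℕ) (i : Fin 3) :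
    order (γ + Pi.single i 1) = order γ + 1 := by
  unfold order
  simp [Finset.sum_add_distrib]

theorem SingKernel.add {M N : ℝ → R3 → R3 → ℝ} (hM : SingKernel M) (hN : SingKernel N) :
    SingKernel fun ε p q => M ε p q + N ε p q where
  contDiffAt ε p q h := (hM.contDiffAt ε p q h).add (hN.contDiffAt ε p q h)
  bound := by
    obtain ⟨C, R, hC, hR, h0, hb⟩ := hM.bound
    obtain ⟨C', R', hC', hR', h0', hb'⟩ := hN.bound
    refine ⟨C + C', max R R', by positivity, by positivity, fun ε p q hq => ?_,
      fun ε p q hε h => ?_⟩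
    · rw [h0 _ _ _ ((le_max_left _ _).trans_lt hq), h0' _ _ _ ((le_max_right _ _).trans_lt hq),
        add_zero]
    · refine (abs_add_le _ _).trans ?_
      rw [add_mul]
      exact add_le_add (hb ε p q hε h) (hb' ε p q hε h)

/-! ### Continuity of the operators and differentiation in time and space. -/

theorem hasDerivAt_of_hasLineDerivAt {E : Type*} [NormedAddCommGroup E] [NormedSpace ℝ E]
    {f : E → ℝ} {z v : E} {s f' : ℝ} (h : HasLineDerivAt ℝ f f' (z + s • v) v) :
    HasDerivAt (fun s : ℝ => f (z + s • v)) f' s := by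
  have h1 : HasDerivAt (fun r : ℝ => f (z + s • v + r • v)) f' (s - s) := by
    rw [sub_self]
    exact h
  have h2 := h1.comp_sub_const s s
  refine h2.congr_of_eventuallyEq (Eventually.of_forall fun r => ?_)
  simp only
  congr 1
  module

/-- Differentiation in directions that do not change the momentum, under the integral sign. -/
theorem hasLineDerivAt_integral_base {Ω : Set (ℝ × R3)} {z v : Phase} (hv : v.2.2 = 0)
    {N : R3 → R3 → ℝ} {G G' : Phase → ℝ} (hz : z ∈ cyl Ω) (hΩ : IsOpen Ω)
    (hNm : ∀ u : R3 → ℝ, Continuous u → AEStronglyMeasurable fun q => N z.2.2 q * u q)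
    (hNi : Integrable fun q => N z.2.2 q * G (z.1, z.2.1, q))
    (hG : ContinuousOn G (cyl Ω)) (hG' : ContinuousOn G' (cyl Ω))
    (hd : ∀ z ∈ cyl Ω, HasLineDerivAt ℝ G (G' z) z v) {b : R3 → ℝ} (hb : Integrable b)
    {V : Set (ℝ × R3)} (hV : V ∈ 𝓝 ((z.1, z.2.1) : ℝ × R3))
    (hdom : ∀ᵐ q, ∀ y ∈ V, |N z.2.2 q * G' (y.1, y.2, q)| ≤ b q) :
    HasLineDerivAt ℝ (fun z => ∫ q, N z.2.2 q * G (z.1, z.2.1, q))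
      (∫ q, N z.2.2 q * G' (z.1, z.2.1, q)) z v := by
  obtain ⟨t, x, p⟩ := z
  obtain ⟨vt, vx, vp⟩ := v
  simp only at hv hNm hNi hV hdom ⊢
  subst hv
  have hz' : (t, x) ∈ Ω := hz
  have hc : Continuous fun s : ℝ => ((t + s • vt, x + s • vx) : ℝ × R3) := by fun_prop
  have hS : {s : ℝ | ((t + s • vt, x + s • vx) : ℝ × R3) ∈ V ∩ Ω} ∈ 𝓝 (0 : ℝ) := by
    refine hc.continuousAt.preimage_mem_nhds ?_
    simpa using ⟨hV, hΩ.mem_nhds hz'⟩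
  have h := hasDerivAt_integral_of_dominated_loc_of_deriv_le (μ := (volume : Measure R3))
    (F := fun (s : ℝ) q => N p q * G (t + s • vt, x + s • vx, q))
    (F' := fun (s : ℝ) q => N p q * G' (t + s • vt, x + s • vx, q)) (x₀ := (0 : ℝ))
    (bound := b) hS ?_ ?_ ?_ ?_ hb ?_
  · simpa [HasLineDerivAt] using h.2
  · filter_upwards [hS] with s hs
    exact hNm _ (continuous_of_continuousOn_cyl hG hs.2)
  · simpa using hNi
  · simp only [zero_smul, add_zero]
    exact hNm _ (continuous_of_continuousOn_cyl hG' hz')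
  · filter_upwards [hdom] with q hq s hs
    exact hq _ hs.1
  · refine Eventually.of_forall fun q s hs => ?_
    have h1 := hd (t + s • vt, x + s • vx, q) hs.2
    have h2 : ((t + s • vt, x + s • vx, q) : Phase) = (t, x, q) + s • (vt, vx, 0) := by simp
    rw [h2] at h1
    have h3 := (hasDerivAt_of_hasLineDerivAt h1).const_mul (N p q)
    simpa using h3

theorem Reg.continuous_zero {Ω : Set (ℝ × R3)} {γ : Fin 3 → ℕ} {G : (Fin 3 → ℕ) → Phase → ℝ}
    (hG : Reg Ω γ G) {t : ℝ} {x : R3} (h : (t, x) ∈ Ω) : Continuous fun q => G 0 (t, x, q) :=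
  continuous_of_continuousOn_cyl (hG.cont 0 zero_le) h

theorem FarSym.integrable {f : R3 → R3 → ℝ} (hf : FarSym f) {Ω : Set (ℝ × R3)} {γ : Fin 3 → ℕ}
    {G : (Fin 3 → ℕ) → Phase → ℝ} (hG : Reg Ω γ G) {δ : ℝ} (hδ : 0 < δ) {z : Phase}
    (hz : z ∈ dom Ω δ) : Integrable fun q => farKern f δ z.2.2 q * G 0 (z.1, z.2.1, q) := by
  obtain ⟨C, hC, hb⟩ := hf.exists_farKern_bound (bracket z.2.2)
  obtain ⟨w, hw, hw'⟩ := hG.dominated (z.1, z.2.1) hz.1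
  refine (hw.const_mul C).mono' (hf.aestronglyMeasurable_farKern _ (hG.continuous_zero hz.1))
    (Eventually.of_forall fun q => ?_)
  rw [norm_mul, Real.norm_eq_abs, Real.norm_eq_abs]
  exact mul_le_mul (hb δ _ q hδ le_rfl hz.2) (hw'.self_of_nhds q) (abs_nonneg _) hC

/-- On the diagonal γ - 1 = 0, so the regularisation must be kept positive for `den` not to vanish;
the value ε = 1 is a convenient choice. -/
theorem contDiff_sym_diag {w : ℝ → R3 → R3 → ℝ} (hw : Sym w) :
    ContDiff ℝ 1 fun p : R3 => w 1 p p := by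
  rw [contDiff_iff_contDiffAt]
  intro p
  exact ContDiffAt.comp (f := fun p : R3 => ((1, p, p) : ℝ × R3 × R3))
    (g := fun x : ℝ × R3 × R3 => w x.1 x.2.1 x.2.2) p
    (hw.contDiffAt (gam_sub_one_add_pos' one_pos p p)) (by fun_prop)

theorem Op.continuousOn {γ : Fin 3 → ℕ} {A : ℝ → ((Fin 3 → ℕ) → Phase → ℝ) → Phase → ℝ}
    (hA : Op γ A) {Ω : Set (ℝ × R3)} (hΩ : IsOpen Ω) {G : (Fin 3 → ℕ) → Phase → ℝ}
    (hG : Reg Ω γ G) {δ : ℝ} (hδ : 0 < δ) : ContinuousOn (A δ G) (dom Ω δ) := by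
  induction hA with
  | @near γ' ψ w j hψ hw hγ hj =>
    have h := (singKernel_kern hψ hw j (order γ) hδ).continuousOn_integral hΩ (hG.cont γ' hγ)
    exact h.comp (f := fun z : Phase => ((0, z) : ℝ × Phase)) (by fun_prop)
      fun z hz => ⟨le_rfl, hz.1⟩
  | @far f hf =>
    intro z₀ hz₀
    obtain ⟨C, hC, hb⟩ := hf.exists_farKern_bound (bracket z₀.2.2 + 1)
    obtain ⟨w, hw, hw'⟩ := hG.dominated (z₀.1, z₀.2.1) hz₀.1
    refine ContinuousAt.continuousWithinAt ?_
    have e1 : ∀ᶠ z in 𝓝 z₀, z ∈ dom Ω δ := (isOpen_dom hΩ δ).mem_nhds hz₀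
    have e2 : ∀ᶠ z : Phase in 𝓝 z₀, bracket z.2.2 < bracket z₀.2.2 + 1 := by
      have hc : Continuous fun z : Phase => bracket z.2.2 := by fun_prop
      exact hc.continuousAt.eventually (Iio_mem_nhds (by linarith))
    have e3 : ∀ᶠ z : Phase in 𝓝 z₀, ∀ q, |G 0 (z.1, z.2.1, q)| ≤ w q :=
      (by fun_prop : Continuous fun z : Phase => ((z.1, z.2.1) : ℝ × R3)).continuousAt.eventually
        hw'
    refine continuousAt_of_dominated (bound := fun q => C * w q) ?_ ?_ (hw.const_mul C) ?_
    · filter_upwards [e1] with z hz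
      exact hf.aestronglyMeasurable_farKern _ (hG.continuous_zero hz.1)
    · filter_upwards [e1, e2, e3] with z h1 h2 h3
      refine Eventually.of_forall fun q => ?_
      rw [norm_mul, Real.norm_eq_abs, Real.norm_eq_abs]
      exact mul_le_mul (hb δ _ q hδ h2.le h1.2) (h3 q) (abs_nonneg _) hC
    · refine Eventually.of_forall fun q => ContinuousAt.mul ?_ ?_
      · exact ContinuousAt.comp (f := fun z : Phase => z.2.2)
          (hf.continuousAt_farKern_left hδ hz₀.2 q) (by fun_prop)
      · have hm : ((z₀.1, z₀.2.1, q) : Phase) ∈ cyl Ω := hz₀.1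
        exact ContinuousAt.comp (f := fun z : Phase => ((z.1, z.2.1, q) : Phase))
          ((hG.cont 0 zero_le).continuousAt ((isOpen_cyl hΩ).mem_nhds hm)) (by fun_prop)
  | @loc γ' w j hw hγ hj =>
    have h1 : Continuous fun z : Phase => w 1 z.2.2 z.2.2 * bracket z.2.2 ^ j
        / bracket z.2.2 ^ order γ :=
      Continuous.div (((contDiff_sym_diag hw).continuous.comp (by fun_prop)).mul (by fun_prop))
        (by fun_prop)
        fun z => pow_ne_zero _ (bracket_ne_zero _)
    exact h1.continuousOn.mul ((hG.cont γ' hγ).mono fun z hz => hz.1)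
  | add _ _ h1 h2 => exact h1.add h2

theorem Op.hasLineDerivAt_base {γ : Fin 3 → ℕ}
    {A : ℝ → ((Fin 3 → ℕ) → Phase → ℝ) → Phase → ℝ} (hA : Op γ A) {Ω : Set (ℝ × R3)}
    (hΩ : IsOpen Ω) {G G' : (Fin 3 → ℕ) → Phase → ℝ} (hG : Reg Ω γ G) (hG' : Reg Ω γ G')
    {v : Phase} (hv : v.2.2 = 0)
    (hd : ∀ γ' ≤ γ, ∀ z ∈ cyl Ω, HasLineDerivAt ℝ (G γ') (G' γ' z) z v) {δ : ℝ} (hδ : 0 < δ)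
    {z : Phase} (hz : z ∈ dom Ω δ) : HasLineDerivAt ℝ (A δ G) (A δ G' z) z v := by
  induction hA with
  | @near γ' ψ w j hψ hw hγ hj =>
    have hN := singKernel_kern hψ hw j (order γ) hδ
    have hz' : (z.1, z.2.1) ∈ Ω := hz.1
    obtain ⟨R, hR, h0⟩ := kern_eq_zero hψ w j (order γ) hδ
    obtain ⟨K, hK, hKΩ, hKc⟩ := local_compact_nhds (hΩ.mem_nhds hz')
    have hcomp : IsCompact ((fun y : (ℝ × R3) × R3 => ((y.1.1, y.1.2, y.2) : Phase)) ''
        (K ×ˢ Metric.closedBall (0 : R3) R)) :=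
      (hKc.prod (isCompact_closedBall 0 R)).image (by fun_prop)
    obtain ⟨M, hM⟩ := hcomp.exists_bound_of_continuousOn ((hG'.cont γ' hγ).mono (by
      rintro _ ⟨y, hy, rfl⟩
      exact hKΩ hy.1))
    refine hasLineDerivAt_integral_base (N := fun p q => kern ψ w j (order γ) δ 0 p q) hv hz.1 hΩ
      (fun u hu => (hN.integrable le_rfl _ hu).aestronglyMeasurable)
      (hN.integrable le_rfl _ (continuous_of_continuousOn_cyl (hG.cont γ' hγ) hz'))
      (hG.cont γ' hγ) (hG'.cont γ' hγ) (hd γ' hγ)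
      (hN.integrable le_rfl z.2.2 (continuous_const (y := M))).norm hK
      (Eventually.of_forall fun q y hy => ?_)
    by_cases hq : ‖q‖ ≤ R
    · have h2 : ‖G' γ' (y.1, y.2, q)‖ ≤ M := hM _ ⟨(y, q), ⟨hy, by simpa using hq⟩, rfl⟩
      rw [abs_mul, norm_mul, Real.norm_eq_abs, Real.norm_eq_abs]
      exact mul_le_mul_of_nonneg_left (h2.trans (le_abs_self M)) (abs_nonneg _)
    · rw [h0 _ _ _ (not_le.1 hq)]
      simp
  | @far f hf =>
    obtain ⟨C, hC, hb⟩ := hf.exists_farKern_bound (bracket z.2.2)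
    obtain ⟨w, hw, hw'⟩ := hG'.dominated (z.1, z.2.1) hz.1
    refine hasLineDerivAt_integral_base (N := farKern f δ) hv hz.1 hΩ
      (fun u hu => hf.aestronglyMeasurable_farKern _ hu) (hf.integrable hG hδ hz)
      (hG.cont 0 zero_le) (hG'.cont 0 zero_le) (hd 0 zero_le) (hw.const_mul C) hw'
      (Eventually.of_forall fun q y hy => ?_)
    rw [abs_mul]
    exact mul_le_mul (hb δ _ q hδ le_rfl hz.2) (hy q) (abs_nonneg _) hC
  | @loc γ' w j hw hγ hj =>
    have h := HasDerivAt.const_mul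
      (w 1 z.2.2 z.2.2 * bracket z.2.2 ^ j / bracket z.2.2 ^ order γ) (hd γ' hγ z hz.1)
    simp only [HasLineDerivAt, Prod.snd_add, Prod.smul_snd, hv, smul_zero, add_zero]
    exact h
  | add _ _ h1 h2 => exact h1.add h2

theorem mem_dom_add_smul_dirP {Ω : Set (ℝ × R3)} {δ : ℝ} {z : Phase} (hz : z ∈ dom Ω δ)
    (i : Fin 3) : ∀ᶠ s : ℝ in 𝓝 0,
      16 * (δ * bracket (z.2.2 + s • EuclideanSpace.single i (1 : ℝ)) ^ 2) < 1 ∧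
      bracket (z.2.2 + s • EuclideanSpace.single i (1 : ℝ)) ≤ bracket z.2.2 + 1 := by
  have hc : Continuous fun s : ℝ => bracket (z.2.2 + s • EuclideanSpace.single i (1 : ℝ)) := by
    fun_prop
  have e1 : ∀ᶠ s : ℝ in 𝓝 0,
      16 * (δ * bracket (z.2.2 + s • EuclideanSpace.single i (1 : ℝ)) ^ 2) < 1 :=
    (by fun_prop : Continuous fun s : ℝ => 16 * (δ * bracket (z.2.2 + s •
      EuclideanSpace.single i (1 : ℝ)) ^ 2)).continuousAt.eventually
      (Iio_mem_nhds (by simpa using hz.2))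
  have e2 : ∀ᶠ s : ℝ in 𝓝 0,
      bracket (z.2.2 + s • EuclideanSpace.single i (1 : ℝ)) < bracket z.2.2 + 1 :=
    hc.continuousAt.eventually (Iio_mem_nhds (by simp))
  filter_upwards [e1, e2] with s h1 h2
  exact ⟨h1, h2.le⟩

/-- The momentum derivative of an operator of order `γ` is an operator of order `γ + e_i`. -/
theorem Op.exists_deriv {γ : Fin 3 → ℕ} {A : ℝ → ((Fin 3 → ℕ) → Phase → ℝ) → Phase → ℝ}
    (hA : Op γ A) (i : Fin 3) : ∃ A', Op (γ + Pi.single i 1) A' ∧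
      ∀ (Ω : Set (ℝ × R3)) (G : (Fin 3 → ℕ) → Phase → ℝ) (δ : ℝ), IsOpen Ω → 0 < δ →
        Reg Ω (γ + Pi.single i 1) G →
        (∀ γ' ≤ γ, ∀ z ∈ cyl Ω, HasLineDerivAt ℝ (G γ') (G (γ' + Pi.single i 1) z) z (dirP i)) →
        ∀ z ∈ dom Ω δ, HasLineDerivAt ℝ (A δ G) (A' δ G z) z (dirP i) := by
  have hle (γ : Fin 3 → ℕ) : γ ≤ γ + Pi.single i 1 := le_self_add
  induction hA with
  | @near γ' ψ w j hψ hw hγ hj =>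
    obtain ⟨w', hw', hK⟩ := exists_kern_boost hψ hw j (order γ) i
    have hj' : j ≤ order (γ + Pi.single i 1) := by rw [order_add_single]; omega
    have hj1 : j + 1 ≤ order (γ + Pi.single i 1) := by rw [order_add_single]; omega
    have hw1 : Sym fun ε p q => 2 * (q i / bracket q) * w ε p q :=
      ((Sym.const 2).mul (.qdir i)).mul hw
    have hw2 : Sym fun ε p q => w' ε p q + q i / bracket q * w ε p q :=
      hw'.add ((Sym.qdir i).mul hw)
    -- The three near operators come from the derivative of the cut-off, from the boost derivative
    -- of the symbol and weights together with the derivative of ⟨q⟩ in the integration by parts,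
    -- and from the derivative falling on the density. Only the last raises the power of ⟨q⟩ and the
    -- index of the density.
    refine ⟨_, ((Op.near hψ.euler hw1 (hγ.trans (hle γ)) hj').add
      (Op.near hψ hw2 (hγ.trans (hle γ)) hj')).add
      (Op.near hψ hw (add_le_add_left hγ (Pi.single i 1)) hj1), fun Ω G δ hΩ hδ hG hd z hz => ?_⟩
    have hz' : (z.1, z.2.1) ∈ Ω := hz.1
    have hu : Continuous fun q => G γ' (z.1, z.2.1, q) :=
      continuous_of_continuousOn_cyl (hG.cont γ' (hγ.trans (hle γ))) hz'
    have hu' : Continuous fun q => G (γ' + Pi.single i 1) (z.1, z.2.1, q) :=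
      continuous_of_continuousOn_cyl (hG.cont _ (add_le_add_left hγ (Pi.single i 1))) hz'
    have hN := singKernel_kern hψ hw j (order γ) hδ
    have hS1 := singKernel_kern hψ.euler hw1 j (order (γ + Pi.single i 1)) hδ
    have hS2 := singKernel_kern hψ hw2 j (order (γ + Pi.single i 1)) hδ
    have hS3 := singKernel_kern hψ hw (j + 1) (order (γ + Pi.single i 1)) hδ
    have e1 : (fun ε p q => (kern (fun s => s * deriv ψ s)
          (fun ε p q => 2 * (q i / bracket q) * w ε p q) j (order γ) δ ε p q
          + kern ψ w' j (order γ) δ ε p q + q i / bracket q * kern ψ w j (order γ) δ ε p q)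
          / bracket p)
        = fun ε p q => kern (fun s => s * deriv ψ s)
          (fun ε p q => 2 * (q i / bracket q) * w ε p q) j (order (γ + Pi.single i 1)) δ ε p q
          + kern ψ (fun ε p q => w' ε p q + q i / bracket q * w ε p q) j
            (order (γ + Pi.single i 1)) δ ε p q := by
      funext ε p q
      have hp := bracket_ne_zero p
      unfold kern
      rw [order_add_single, pow_succ]
      field_simp
      ring
    have e2 : (fun ε p q => bracket q / bracket p * kern ψ w j (order γ) δ ε p q)
        = fun ε p q => kern ψ w (j + 1) (order (γ + Pi.single i 1)) δ ε p q := by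
      funext ε p q
      have hp := bracket_ne_zero p
      unfold kern
      rw [order_add_single, pow_succ, pow_succ]
      field_simp
      ring
    have h := hN.hasLineDerivAt_integral (hK δ) (by rw [e1]; exact hS1.add hS2)
      (by rw [e2]; exact hS3) hu hu' (fun q => ?_) z.2.2
    · have e1' := fun q => congrFun (congrFun (congrFun e1 0) z.2.2) q
      have e2' := fun q => congrFun (congrFun (congrFun e2 0) z.2.2) q
      simp only at e1' e2'
      simp only [e1', e2', add_mul] at h
      rw [integral_add (hS1.integrable le_rfl _ hu) (hS2.integrable le_rfl _ hu)] at h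
      simpa [HasLineDerivAt, dirP] using h
    · have := hd γ' hγ (z.1, z.2.1, q) hz'
      simpa [HasLineDerivAt, dirP] using this
  | @far f hf =>
    obtain ⟨f', hf', hder⟩ := hf.exists_farKern_deriv i
    -- Only the kernel is differentiated, so the density remains `G 0`, the one member of the family
    -- for which domination is available.
    refine ⟨_, Op.far hf', fun Ω G δ hΩ hδ hG hd z hz => ?_⟩
    obtain ⟨C, hC, hb⟩ := hf'.exists_farKern_bound (bracket z.2.2 + 1)
    obtain ⟨w, hw, hw'⟩ := hG.dominated (z.1, z.2.1) hz.1
    have hu := hG.continuous_zero (t := z.1) (x := z.2.1) hz.1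
    have hS := mem_dom_add_smul_dirP hz i
    have h := hasDerivAt_integral_of_dominated_loc_of_deriv_le (μ := (volume : Measure R3))
      (F := fun (s : ℝ) q => farKern f δ (z.2.2 + s • EuclideanSpace.single i (1 : ℝ)) q
        * G 0 (z.1, z.2.1, q))
      (F' := fun (s : ℝ) q => farKern f' δ (z.2.2 + s • EuclideanSpace.single i (1 : ℝ)) q
        * G 0 (z.1, z.2.1, q)) (x₀ := (0 : ℝ)) (bound := fun q => C * w q) hS ?_ ?_ ?_ ?_
      (hw.const_mul C) ?_
    · simpa [HasLineDerivAt, dirP] using h.2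
    · exact Eventually.of_forall fun s => hf.aestronglyMeasurable_farKern _ hu
    · simpa using hf.integrable hG hδ hz
    · exact hf'.aestronglyMeasurable_farKern _ hu
    · refine Eventually.of_forall fun q s hs => ?_
      rw [norm_mul, Real.norm_eq_abs, Real.norm_eq_abs]
      exact mul_le_mul (hb δ _ q hδ hs.2 hs.1) (hw'.self_of_nhds q) (abs_nonneg _) hC
    · refine Eventually.of_forall fun q s hs => HasDerivAt.mul_const ?_ _
      have h1 := (hder δ (z.2.2 + s • EuclideanSpace.single i (1 : ℝ)) q hδ hs.1)
      have h2 : HasDerivAt (fun r : ℝ => farKern f δ (z.2.2 + s • EuclideanSpace.single i (1 : ℝ)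
          + r • EuclideanSpace.single i (1 : ℝ)) q)
          (farKern f' δ (z.2.2 + s • EuclideanSpace.single i (1 : ℝ)) q) (s - s) := by
        rw [sub_self]
        exact h1
      refine (h2.comp_sub_const s s).congr_of_eventuallyEq (Eventually.of_forall fun r => ?_)
      simp only
      congr 1
      module
  | @loc γ' w j hw hγ hj =>
    obtain ⟨w', hw', hK⟩ := hw.exists_boost i
    have hw1 : Sym fun ε p q => w' ε p q + ((j : ℝ) - order γ) * (p i / bracket p) * w ε p q :=
      hw'.add (((Sym.const ((j : ℝ) - order γ)).mul (.pdir i)).mul hw)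
    have hj' : j ≤ order (γ + Pi.single i 1) := by rw [order_add_single]; omega
    have hj1 : j + 1 ≤ order (γ + Pi.single i 1) := by rw [order_add_single]; omega
    refine ⟨_, (Op.loc hw1 (hγ.trans (hle γ)) hj').add
      (Op.loc hw (add_le_add_left hγ (Pi.single i 1)) hj1), fun Ω G δ hΩ hδ hG hd z hz => ?_⟩
    have hp := bracket_ne_zero z.2.2
    set e : R3 := EuclideanSpace.single i 1 with he
    -- At a point (p,p) the boost moves both arguments along the diagonal with speed ⟨p⟩; rescaling
    -- time by 1/⟨p⟩ gives the ordinary derivative.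
    have hw0 : HasDerivAt (fun s : ℝ => w 1 (z.2.2 + s • e) (z.2.2 + s • e))
        (w' 1 z.2.2 z.2.2 / bracket z.2.2) 0 := by
      have h1 := hK 1 z.2.2 z.2.2 (gam_sub_one_add_pos' one_pos _ _)
      have h2 : HasDerivAt (fun s : ℝ => s / bracket z.2.2) (1 / bracket z.2.2) 0 :=
        (hasDerivAt_id (0 : ℝ)).div_const _
      have h3 := HasDerivAt.comp (0 : ℝ) (by simpa using h1) h2
      rw [mul_one_div] at h3
      refine h3.congr_of_eventuallyEq (Eventually.of_forall fun s => ?_)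
      simp only [Function.comp, smul_smul, div_mul_cancel₀ _ hp]
    have hb : HasDerivAt (fun s : ℝ => bracket (z.2.2 + s • e)) (z.2.2 i / bracket z.2.2) 0 :=
      (hasDerivAt_bracket _ _).congr_deriv (by simp [he, EuclideanSpace.inner_single_right])
    have hGd := hd γ' hγ z hz.1
    have h := ((hw0.mul (hb.pow j)).div (hb.pow (order γ)) (by simp [hp])).mul
      (show HasDerivAt (fun s : ℝ => G γ' (z + s • dirP i)) _ 0 from hGd)
    have hzs (s : ℝ) : (z + s • dirP i).2.2 = z.2.2 + s • e := rfl
    simp only [HasLineDerivAt, hzs]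
    refine h.congr_deriv ?_
    simp only [Pi.mul_apply, Pi.pow_apply, Pi.div_apply, zero_smul, add_zero, order_add_single]
    generalize order γ = n
    rcases n with _ | n <;> rcases j with _ | j <;>
      simp [-mul_eq_mul_left_iff, -mul_eq_mul_right_iff] <;> field_simp <;> ring
  | add hA hB h1 h2 =>
    obtain ⟨A', hA', h1⟩ := h1
    obtain ⟨B', hB', h2⟩ := h2
    exact ⟨_, hA'.add hB', fun Ω G δ hΩ hδ hG hd z hz =>
      (h1 Ω G δ hΩ hδ hG hd z hz).add (h2 Ω G δ hΩ hδ hG hd z hz)⟩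

/-! ### Uniform bounds for the operators -/

theorem bracket_pow_mul_rpow (q : R3) (a : ℕ) (s : ℝ) :
    bracket q ^ a * bracket q ^ (-s) = bracket q ^ (-(s - a)) := by
  rw [← Real.rpow_natCast, ← Real.rpow_add (bracket_pos q)]
  congr 1
  ring

/-- The kernel costs ⟨q⟩^{j+1}, and integrability in three dimensions needs more than three further
powers: hence j + 4 < s. The constant does not depend on δ. -/
theorem exists_near_bound {ψ : ℝ → ℝ} (hψ : IsCut ψ) {w : ℝ → R3 → R3 → ℝ} (hw : Sym w)
    (j n : ℕ) {s : ℝ} (hs : (j : ℝ) + 4 < s) :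
    ∃ C, 0 ≤ C ∧ ∀ (δ : ℝ) (u : R3 → ℝ) (M : ℝ) (p : R3), 0 ≤ δ → 0 ≤ M →
      (∀ q, |u q| ≤ M * bracket q ^ (-s)) →
      |∫ q, kern ψ w j n δ 0 p q * u q| ≤ C * M / bracket p ^ n := by
  obtain ⟨C, hC, hb⟩ := exists_kern_bound hψ hw j n
  obtain ⟨J, hJ, hint⟩ := exists_singular_integral_bound (s := s - (j + 1 : ℕ))
    (by push_cast; linarith)
  refine ⟨C * J, by positivity, fun δ u M p hδ hM hu => ?_⟩
  have hp := bracket_pos p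
  obtain ⟨hi, hle⟩ := hint p
  have h1 : ∀ᵐ q, ‖kern ψ w j n δ 0 p q * u q‖ ≤ C * M / bracket p ^ n *
      (bracket q ^ (-(s - (j + 1 : ℕ))) * (1 + ‖p - q‖⁻¹) ^ 2) := by
    filter_upwards [ae_ne p] with q hq
    have hq0 := bracket_pos q
    have e1 := hb δ 0 p q hδ le_rfl hq
    have e2 : 1 + ‖p - q‖⁻¹ ≤ (1 + ‖p - q‖⁻¹) ^ 2 := by
      have : 0 ≤ ‖p - q‖⁻¹ := by positivity
      nlinarith
    rw [norm_mul, Real.norm_eq_abs, Real.norm_eq_abs, ← bracket_pow_mul_rpow]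
    calc _ ≤ (C * (bracket q ^ (j + 1) * (1 + ‖p - q‖⁻¹)) / bracket p ^ n)
          * (M * bracket q ^ (-s)) := mul_le_mul e1 (hu q) (abs_nonneg _) (by positivity)
      _ ≤ (C * (bracket q ^ (j + 1) * (1 + ‖p - q‖⁻¹) ^ 2) / bracket p ^ n)
          * (M * bracket q ^ (-s)) := by gcongr
      _ = _ := by ring
  rw [← Real.norm_eq_abs]
  calc _ ≤ ∫ q, C * M / bracket p ^ n *
      (bracket q ^ (-(s - (j + 1 : ℕ))) * (1 + ‖p - q‖⁻¹) ^ 2) :=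
        norm_integral_le_of_norm_le (hi.const_mul _) h1
    _ ≤ C * M / bracket p ^ n * J := by
      rw [integral_const_mul]
      gcongr
    _ = _ := by ring

theorem bracket_add_smul_ge {p p' : R3} (h : ‖p - p'‖ ≤ bracket p' / 2) {s : ℝ}
    (hs : s ∈ Set.Icc (0 : ℝ) 1) : bracket p' / 2 ≤ bracket (p' + s • (p - p')) := by
  have h1 := abs_bracket_sub_le p' (p' + s • (p - p'))
  have h2 : ‖p' - (p' + s • (p - p'))‖ ≤ ‖p - p'‖ := by
    rw [sub_add_cancel_left, norm_neg, norm_smul, Real.norm_eq_abs, abs_of_nonneg hs.1]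
    exact mul_le_of_le_one_left (norm_nonneg _) hs.2
  linarith [le_abs_self (bracket p' - bracket (p' + s • (p - p')))]

/-- The near operators map weighted bounded functions to Lipschitz functions of the momentum. -/
theorem exists_near_lipschitz {ψ : ℝ → ℝ} (hψ : IsCut ψ) {w : ℝ → R3 → R3 → ℝ} (hw : Sym w)
    (j n : ℕ) {s : ℝ} (hs : (j : ℝ) + 7 < s) :
    ∃ C, 0 ≤ C ∧ ∀ (δ : ℝ) (u : R3 → ℝ) (M : ℝ) (p p' : R3), 0 < δ → 0 ≤ M → Continuous u →
      (∀ q, |u q| ≤ M * bracket q ^ (-s)) → ‖p - p'‖ ≤ bracket p' / 2 →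
      |(∫ q, kern ψ w j n δ 0 p q * u q) - ∫ q, kern ψ w j n δ 0 p' q * u q|
        ≤ C * M * ‖p - p'‖ / bracket p' ^ (n + 1) := by
  obtain ⟨C, hC, hb⟩ := exists_kern_grad_bound hψ hw j n
  obtain ⟨J, hJ, hint⟩ := exists_singular_integral_bound (s := s - (j + 4 : ℕ))
    (by push_cast; linarith)
  -- The factor 2^{n+1} comes from ⟨P⟩ ≥ ⟨p'⟩/2 along the segment from p' to p. The threshold j + 7
  -- is the cost j + 4 of the kernel gradient plus the dimension.
  refine ⟨C * J * 2 ^ (n + 1), by positivity, fun δ u M p p' hδ hM hu hub hpp => ?_⟩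
  have hN := singKernel_kern hψ hw j n hδ
  set v := p - p' with hv
  have hp' := bracket_pos p'
  set K := C * J * 2 ^ (n + 1) * M * ‖v‖ / bracket p' ^ (n + 1) with hK
  -- The mean value inequality is applied to the smooth kernels with ε > 0; the gradient bound is
  -- uniform in ε and survives the limit.
  have hreg (ε : ℝ) (hε : 0 < ε) :
      |(∫ q, kern ψ w j n δ ε p q * u q) - ∫ q, kern ψ w j n δ ε p' q * u q| ≤ K := by
    have hder (r : ℝ) := hN.hasDerivAt_integral hε p' v hu r
    have hbound : ∀ r ∈ Set.Ico (0 : ℝ) 1, ‖∫ q, fderiv ℝ (fun x : R3 × R3 =>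
        kern ψ w j n δ ε x.1 x.2) (p' + r • v, q) (v, 0) * u q‖ ≤ K := by
      intro r hr
      have hP := bracket_add_smul_ge hpp ⟨hr.1, hr.2.le⟩
      set P := p' + r • v with hPdef
      have hP0 := bracket_pos P
      obtain ⟨hi, hle⟩ := hint P
      have h1 : ∀ᵐ q, ‖fderiv ℝ (fun x : R3 × R3 => kern ψ w j n δ ε x.1 x.2) (P, q) (v, 0)
          * u q‖ ≤ C * ‖v‖ * M / bracket P ^ (n + 1) *
          (bracket q ^ (-(s - (j + 4 : ℕ))) * (1 + ‖P - q‖⁻¹) ^ 2) := by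
        filter_upwards [ae_ne P] with q hq
        have hq0 := bracket_pos q
        obtain ⟨D, hD, hDb⟩ := hb δ ε P q v hδ.le hε.le hq
        have e0 := hN.hasDerivAt_line hε P q v 0 0
        simp only [smul_zero, add_zero, zero_smul] at e0
        rw [← hD.unique e0, norm_mul, Real.norm_eq_abs, Real.norm_eq_abs, ← bracket_pow_mul_rpow]
        have e1 : |D| ≤ C * ‖v‖ * (bracket q ^ (j + 4) * (1 + ‖P - q‖⁻¹) ^ 2)
            / bracket P ^ (n + 1) := by
          rw [pow_succ (bracket P), ← div_div, le_div_iff₀ hP0]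
          linarith
        calc _ ≤ (C * ‖v‖ * (bracket q ^ (j + 4) * (1 + ‖P - q‖⁻¹) ^ 2) / bracket P ^ (n + 1))
              * (M * bracket q ^ (-s)) := mul_le_mul e1 (hub q) (abs_nonneg _) (by positivity)
          _ = _ := by ring
      calc _ ≤ ∫ q, C * ‖v‖ * M / bracket P ^ (n + 1) *
          (bracket q ^ (-(s - (j + 4 : ℕ))) * (1 + ‖P - q‖⁻¹) ^ 2) :=
            norm_integral_le_of_norm_le (hi.const_mul _) h1
        _ ≤ C * ‖v‖ * M / bracket P ^ (n + 1) * J := by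
          rw [integral_const_mul]
          gcongr
        _ ≤ C * ‖v‖ * M / (bracket p' / 2) ^ (n + 1) * J := by gcongr
        _ = K := by
          rw [hK, div_pow]
          field_simp
    have h2 := norm_image_sub_le_of_norm_deriv_le_segment_01'
      (f := fun r : ℝ => ∫ q, kern ψ w j n δ ε (p' + r • v) q * u q) (C := K)
      (fun r _ => (hder r).hasDerivWithinAt) hbound
    simpa [hv] using h2
  have hF := hN.continuousOn_integral_right hu
  have hlim (p : R3) : Tendsto (fun ε => ∫ q, kern ψ w j n δ ε p q * u q) (𝓝[>] 0)
      (𝓝 (∫ q, kern ψ w j n δ 0 p q * u q)) := by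
    have h1 := hF (0, p) (show (0 : ℝ) ≤ 0 from le_rfl)
    refine h1.tendsto.comp (f := fun ε : ℝ => (ε, p)) (tendsto_nhdsWithin_iff.2 ⟨?_, ?_⟩)
    · exact ((by fun_prop : Continuous fun ε : ℝ => (ε, p)).tendsto 0).mono_left
        nhdsWithin_le_nhds
    · filter_upwards [self_mem_nhdsWithin] with ε hε
      exact le_of_lt hε
  refine le_of_tendsto ((hlim p).sub (hlim p')).abs ?_
  filter_upwards [self_mem_nhdsWithin] with ε hε
  exact hreg ε hε

/-- For fixed q the complementary cut-off vanishes once δ⟨q⟩² ≤ 1, so dominated convergence applies.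
Far operators therefore leave no trace in the quantitative bounds. -/
theorem FarSym.tendsto_zero {f : R3 → R3 → ℝ} (hf : FarSym f) (p : R3) {u : R3 → ℝ}
    (hu : Continuous u) (hui : Integrable u) :
    Tendsto (fun δ => ∫ q, farKern f δ p q * u q) (𝓝[>] 0) (𝓝 0) := by
  obtain ⟨C, hC, hb⟩ := hf.exists_farKern_bound (bracket p)
  have hsmall (c : ℝ) : ∀ᶠ δ : ℝ in 𝓝[>] 0, δ * c < 1 := by
    have : Tendsto (fun δ : ℝ => δ * c) (𝓝 0) (𝓝 (0 * c)) :=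
      (by fun_prop : Continuous fun δ : ℝ => δ * c).tendsto 0
    rw [zero_mul] at this
    exact (this.eventually (Iio_mem_nhds one_pos)).filter_mono nhdsWithin_le_nhds
  suffices h : Tendsto (fun δ => ∫ q, farKern f δ p q * u q) (𝓝[>] 0) (𝓝 (∫ _ : R3, (0 : ℝ))) by
    simpa using h
  refine tendsto_integral_filter_of_dominated_convergence (fun q => C * ‖u q‖) ?_ ?_
    (hui.norm.const_mul C) ?_
  · exact Eventually.of_forall fun δ => hf.aestronglyMeasurable_farKern p hu
  · filter_upwards [self_mem_nhdsWithin, hsmall (16 * bracket p ^ 2)] with δ h1 h2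
    refine Eventually.of_forall fun q => ?_
    rw [norm_mul, Real.norm_eq_abs]
    exact mul_le_mul_of_nonneg_right (hb δ p q h1 le_rfl (by linarith)) (norm_nonneg _)
  · refine Eventually.of_forall fun q => tendsto_const_nhds.congr' ?_
    filter_upwards [hsmall (bracket q ^ 2)] with δ hδ
    rw [farKern_of_le hδ.le, zero_mul]

theorem integrable_of_decay {k Ck : ℝ} (hk : 3 < k) {u : R3 → ℝ} (hu : Continuous u)
    (hb : ∀ q, |u q| ≤ Ck * bracket q ^ (-k)) : Integrable u :=
  ((integrable_bracket_rpow hk).const_mul Ck).mono' hu.aestronglyMeasurable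
    (Eventually.of_forall hb)

/-- Near and local terms are bounded uniformly in δ; the whole far contribution is put into the
error B. When `A δ G` represents a derivative of a coefficient its value does not depend on δ, so
letting δ → 0 removes B. -/
theorem Op.exists_pointwise {γ : Fin 3 → ℕ} {A : ℝ → ((Fin 3 → ℕ) → Phase → ℝ) → Phase → ℝ}
    (hA : Op γ A) {k : ℝ} (hk : 9 + (order γ : ℝ) < k) :
    ∃ C, 0 ≤ C ∧ ∀ (Ω : Set (ℝ × R3)) (G : (Fin 3 → ℕ) → Phase → ℝ) (Ck : ℝ), 0 ≤ Ck →
      Reg Ω γ G → (∀ γ' ≤ γ, ∀ z ∈ cyl Ω, |G γ' z| ≤ Ck * bracket z.2.2 ^ (-k)) →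
      ∀ z ∈ cyl Ω, ∃ B : ℝ → ℝ, Tendsto B (𝓝[>] 0) (𝓝 0) ∧ ∀ δ, 0 < δ →
        |A δ G z| ≤ C * Ck / bracket z.2.2 ^ order γ + B δ := by
  induction hA with
  | @near γ' ψ w j hψ hw hγ hj =>
    have hj' : (j : ℝ) ≤ order γ := by exact_mod_cast hj
    obtain ⟨C, hC, hb⟩ := exists_near_bound hψ hw j (order γ) (s := k) (by linarith)
    refine ⟨C, hC, fun Ω G Ck hCk hG hdec z hz => ⟨0, tendsto_const_nhds, fun δ hδ => ?_⟩⟩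
    simp only [Pi.zero_apply, add_zero]
    exact hb δ _ Ck z.2.2 hδ.le hCk fun q => hdec γ' hγ (z.1, z.2.1, q) hz
  | @far f hf =>
    refine ⟨0, le_rfl, fun Ω G Ck hCk hG hdec z hz =>
      ⟨fun δ => |∫ q, farKern f δ z.2.2 q * G 0 (z.1, z.2.1, q)|, ?_, fun δ hδ => by simp⟩⟩
    have hu := hG.continuous_zero (t := z.1) (x := z.2.1) hz
    have hn : (0 : ℝ) ≤ order γ := Nat.cast_nonneg _
    have := (hf.tendsto_zero z.2.2 hu (integrable_of_decay (k := k) (by linarith) hu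
      fun q => hdec 0 zero_le (z.1, z.2.1, q) hz)).abs
    simpa using this
  | @loc γ' w j hw hγ hj =>
    have hj' : (j : ℝ) ≤ order γ := by exact_mod_cast hj
    obtain ⟨C, hC, hb⟩ := hw.exists_bound
    refine ⟨C, hC, fun Ω G Ck hCk hG hdec z hz => ⟨0, tendsto_const_nhds, fun δ hδ => ?_⟩⟩
    simp only [Pi.zero_apply, add_zero]
    have hp := bracket_pos z.2.2
    rw [abs_mul, abs_div, abs_mul, abs_of_pos (pow_pos hp j), abs_of_pos (pow_pos hp _)]
    have h1 := hb 1 z.2.2 z.2.2 zero_le_one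
    have h2 : bracket z.2.2 ^ j * bracket z.2.2 ^ (-k) ≤ 1 := by
      rw [bracket_pow_mul_rpow]
      exact Real.rpow_le_one_of_one_le_of_nonpos (one_le_bracket _) (by linarith)
    calc _ ≤ C * bracket z.2.2 ^ j / bracket z.2.2 ^ order γ * (Ck * bracket z.2.2 ^ (-k)) := by
          have := hdec γ' hγ z hz
          gcongr
      _ = C * Ck / bracket z.2.2 ^ order γ * (bracket z.2.2 ^ j * bracket z.2.2 ^ (-k)) := by ring
      _ ≤ C * Ck / bracket z.2.2 ^ order γ * 1 := by gcongr
      _ = _ := mul_one _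
  | add _ _ h1 h2 =>
    obtain ⟨C, hC, h1⟩ := h1
    obtain ⟨C', hC', h2⟩ := h2
    refine ⟨C + C', by positivity, fun Ω G Ck hCk hG hdec z hz => ?_⟩
    obtain ⟨B, hB, h1⟩ := h1 Ω G Ck hCk hG hdec z hz
    obtain ⟨B', hB', h2⟩ := h2 Ω G Ck hCk hG hdec z hz
    refine ⟨fun δ => B δ + B' δ, by simpa using hB.add hB', fun δ hδ => ?_⟩
    refine (abs_add_le _ _).trans ((add_le_add (h1 δ hδ) (h2 δ hδ)).trans (le_of_eq ?_))
    ring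

/-! ### The Lorentzian distance -/

theorem par_of_eq_smul {a : ℝ} {e p : R3} (hp : p = a • e) (ha : 0 < a) (he : ‖e‖ = 1) (w : R3) :
    par p w = ⟪w, e⟫_ℝ • e := by
  have h1 : ‖p‖⁻¹ • p = e := by
    rw [hp, norm_smul, he, mul_one, Real.norm_eq_abs, abs_of_pos ha, smul_smul,
      inv_mul_cancel₀ ha.ne', one_smul]
  rw [par, h1]

theorem exists_unit_direction {p : R3} (hp : p ≠ 0) :
    ∃ (a : ℝ) (e : R3), 0 < a ∧ ‖e‖ = 1 ∧ p = a • e ∧ a ≤ bracket p ∧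
      bracket p ^ 2 = 1 + a ^ 2 := by
  have h := norm_pos_iff.2 hp
  refine ⟨‖p‖, ‖p‖⁻¹ • p, h, by simp [norm_smul, h.ne'], ?_, (norm_lt_bracket p).le, bracket_sq p⟩
  rw [smul_smul, mul_inv_cancel₀ h.ne', one_smul]

theorem abs_inner_le_of_norm_eq_one {e : R3} (he : ‖e‖ = 1) (w : R3) : |⟪w, e⟫_ℝ| ≤ ‖w‖ := by
  simpa [he] using abs_real_inner_le_norm w e

/-- Undoing a boost of the space-time variables. -/
theorem abs_time_sub_le (z z' : Phase) : |z.1 - z'.1| ≤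
    bracket z'.2.2 * (|(boostInv z' z).1| + ‖(boostInv z' z).2.1‖) := by
  obtain ⟨t, x, p⟩ := z
  obtain ⟨t', x', p'⟩ := z'
  simp only [boostInv]
  rcases eq_or_ne p' 0 with rfl | hp
  · simp [bracket]
  obtain ⟨a, e, ha, he, hpe, hab, hb⟩ := exists_unit_direction hp
  have hb1 := one_le_bracket p'
  simp only [perp, par_of_eq_smul hpe ha he]
  set b := bracket p'
  set ξ := x - x'
  set T := b * (t - t') - ⟪p', ξ⟫_ℝ with hT
  set X := ξ - ⟪ξ, e⟫_ℝ • e + b • ⟪ξ, e⟫_ℝ • e - (t - t') • p' with hX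
  have hXe : ⟪X, e⟫_ℝ = b * ⟪ξ, e⟫_ℝ - a * (t - t') := by
    simp only [hX, hpe, inner_sub_left, inner_add_left, real_inner_smul_left,
      real_inner_self_eq_norm_sq, he]
    ring
  have hTe : T = b * (t - t') - a * ⟪ξ, e⟫_ℝ := by
    rw [hT, hpe, real_inner_smul_left, real_inner_comm]
  -- The inverse boost in the plane of time and e, with b² - a² = 1.
  have h1 : t - t' = b * T + a * ⟪X, e⟫_ℝ := by
    rw [hXe, hTe]
    linear_combination (-(t - t')) * hb
  have h2 := abs_inner_le_of_norm_eq_one he X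
  rw [h1]
  refine (abs_add_le _ _).trans ?_
  rw [abs_mul, abs_mul, abs_of_pos ha, abs_of_pos (lt_of_lt_of_le one_pos hb1), mul_add]
  gcongr

theorem norm_space_sub_le (z z' : Phase) : ‖z.2.1 - z'.2.1‖ ≤
    bracket z'.2.2 * (|(boostInv z' z).1| + ‖(boostInv z' z).2.1‖) := by
  obtain ⟨t, x, p⟩ := z
  obtain ⟨t', x', p'⟩ := z'
  simp only [boostInv]
  rcases eq_or_ne p' 0 with rfl | hp
  · simp [bracket, perp, par]
  obtain ⟨a, e, ha, he, hpe, hab, hb⟩ := exists_unit_direction hp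
  have hb1 := one_le_bracket p'
  simp only [perp, par_of_eq_smul hpe ha he]
  set b := bracket p'
  set ξ := x - x'
  set T := b * (t - t') - ⟪p', ξ⟫_ℝ with hT
  set X := ξ - ⟪ξ, e⟫_ℝ • e + b • ⟪ξ, e⟫_ℝ • e - (t - t') • p' with hX
  have hXe : ⟪X, e⟫_ℝ = b * ⟪ξ, e⟫_ℝ - a * (t - t') := by
    simp only [hX, hpe, inner_sub_left, inner_add_left, real_inner_smul_left,
      real_inner_self_eq_norm_sq, he]
    ring
  have hTe : T = b * (t - t') - a * ⟪ξ, e⟫_ℝ := by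
    rw [hT, hpe, real_inner_smul_left, real_inner_comm]
  have h1 : ξ = X + (a * T + (b - 1) * ⟪X, e⟫_ℝ) • e := by
    have h : a * T + (b - 1) * ⟪X, e⟫_ℝ = ⟪ξ, e⟫_ℝ - ⟪X, e⟫_ℝ := by
      rw [hXe, hTe]
      linear_combination ⟪ξ, e⟫_ℝ * hb
    rw [h, hXe, hX, hpe]
    module
  have h2 := abs_inner_le_of_norm_eq_one he X
  have h3 : ‖ξ‖ ≤ ‖X‖ + |a * T + (b - 1) * ⟪X, e⟫_ℝ| := by
    nth_rw 1 [h1]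
    refine (norm_add_le _ _).trans ?_
    rw [norm_smul, he, mul_one, Real.norm_eq_abs]
  have h4 : |a * T + (b - 1) * ⟪X, e⟫_ℝ| ≤ b * |T| + (b - 1) * ‖X‖ := by
    refine (abs_add_le _ _).trans ?_
    rw [abs_mul, abs_mul, abs_of_pos ha, abs_of_nonneg (sub_nonneg.2 hb1)]
    have : 0 ≤ b - 1 := sub_nonneg.2 hb1
    gcongr
  linarith

/-- The boosted momentum P satisfies ⟨P⟩ = γ(p,p') by Lorentz invariance, so γ - 1 ≤ |P|. Undoing
the boost expresses p - p' as P plus a multiple of e controlled by γ - 1 and |P|. -/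
theorem norm_momentum_sub_le (z z' : Phase) : ‖z.2.2 - z'.2.2‖ ≤
    2 * bracket z'.2.2 * ‖(boostInv z' z).2.2‖ := by
  obtain ⟨t, x, p⟩ := z
  obtain ⟨t', x', p'⟩ := z'
  simp only [boostInv]
  rcases eq_or_ne p' 0 with rfl | hp
  · simp [bracket, perp, par]
    linarith [norm_nonneg p]
  obtain ⟨a, e, ha, he, hpe, hab, hb⟩ := exists_unit_direction hp
  have hb1 := one_le_bracket p'
  simp only [perp, par_of_eq_smul hpe ha he]
  have hγ1 := one_le_gam p p'
  have hp0 := bracket_sq p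
  set b := bracket p'
  set P := p - ⟪p, e⟫_ℝ • e + b • ⟪p, e⟫_ℝ • e - bracket p • p' with hP
  have hPe : ⟪P, e⟫_ℝ = b * ⟪p, e⟫_ℝ - a * bracket p := by
    simp only [hP, hpe, inner_sub_left, inner_add_left, real_inner_smul_left,
      real_inner_self_eq_norm_sq, he]
    ring
  have hγ : gam p p' = b * bracket p - a * ⟪p, e⟫_ℝ := by
    rw [gam, hpe, real_inner_smul_right, ← hpe]
    ring
  have hP2 : P = p + (⟪P, e⟫_ℝ - ⟪p, e⟫_ℝ) • e := by
    rw [hPe, hP, hpe]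
    module
  have hPn : ‖P‖ ^ 2 = ‖p‖ ^ 2 + 2 * (⟪P, e⟫_ℝ - ⟪p, e⟫_ℝ) * ⟪p, e⟫_ℝ
      + (⟪P, e⟫_ℝ - ⟪p, e⟫_ℝ) ^ 2 := by
    nth_rw 1 [hP2]
    rw [norm_add_sq_real, real_inner_smul_right, norm_smul, he, mul_one, Real.norm_eq_abs, sq_abs]
    ring
  have hγ2 : gam p p' ^ 2 = 1 + ‖P‖ ^ 2 := by
    rw [hPn, hγ, hPe]
    linear_combination (bracket p ^ 2 - ⟪p, e⟫_ℝ ^ 2) * hb + hp0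
  have hγP : gam p p' - 1 ≤ ‖P‖ := by nlinarith [norm_nonneg P]
  have h1 : p - p' = P + (a * (gam p p' - 1) + (b - 1) * ⟪P, e⟫_ℝ) • e := by
    have h : a * (gam p p' - 1) + (b - 1) * ⟪P, e⟫_ℝ = ⟪p, e⟫_ℝ - ⟪P, e⟫_ℝ - a := by
      rw [hPe, hγ]
      linear_combination ⟪p, e⟫_ℝ * hb
    rw [h]
    nth_rw 1 [hP2]
    rw [hpe]
    module
  have h2 := abs_inner_le_of_norm_eq_one he P
  have h3 : ‖p - p'‖ ≤ ‖P‖ + |a * (gam p p' - 1) + (b - 1) * ⟪P, e⟫_ℝ| := by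
    nth_rw 1 [h1]
    refine (norm_add_le _ _).trans ?_
    rw [norm_smul, he, mul_one, Real.norm_eq_abs]
  have h4 : |a * (gam p p' - 1) + (b - 1) * ⟪P, e⟫_ℝ| ≤ b * ‖P‖ + (b - 1) * ‖P‖ := by
    refine (abs_add_le _ _).trans ?_
    rw [abs_mul, abs_mul, abs_of_pos ha, abs_of_nonneg (sub_nonneg.2 hb1),
      abs_of_nonneg (sub_nonneg.2 hγ1)]
    have : 0 ≤ b - 1 := sub_nonneg.2 hb1
    gcongr
  linarith

theorem distL_nonneg (z z' : Phase) : 0 ≤ distL z z' := by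
  unfold distL kinNorm
  positivity

theorem abs_boost_time_le (z z' : Phase) : |(boostInv z' z).1| ≤ distL z z' ^ 2 := by
  have h : |(boostInv z' z).1| ^ (1 / 2 : ℝ) ≤ distL z z' := by
    rw [distL, kinNorm, add_assoc]
    exact le_add_of_nonneg_right (by positivity)
  calc _ = (|(boostInv z' z).1| ^ (1 / 2 : ℝ)) ^ 2 := by
        rw [← Real.rpow_natCast, ← Real.rpow_mul (abs_nonneg _)]
        norm_num
    _ ≤ _ := by gcongr

theorem norm_boost_space_le (z z' : Phase) : ‖(boostInv z' z).2.1‖ ≤ distL z z' ^ 3 := by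
  have h : ‖(boostInv z' z).2.1‖ ^ (1 / 3 : ℝ) ≤ distL z z' := by
    rw [distL, kinNorm, add_right_comm]
    exact le_add_of_nonneg_left (by positivity)
  calc _ = (‖(boostInv z' z).2.1‖ ^ (1 / 3 : ℝ)) ^ 3 := by
        rw [← Real.rpow_natCast, ← Real.rpow_mul (norm_nonneg _)]
        norm_num
    _ ≤ _ := by gcongr

theorem norm_boost_momentum_le (z z' : Phase) : ‖(boostInv z' z).2.2‖ ≤ distL z z' :=
  le_add_of_nonneg_left (by positivity)

theorem norm_momentum_sub_le_distL (z z' : Phase) :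
    ‖z.2.2 - z'.2.2‖ ≤ 2 * bracket z'.2.2 * distL z z' :=
  (norm_momentum_sub_le z z').trans (mul_le_mul_of_nonneg_left (norm_boost_momentum_le z z')
    (by have := bracket_pos z'.2.2; positivity))

/-- Needed because the Hölder quotient at distance zero has the default value 0 and carries no
information. -/
theorem eq_of_distL_eq_zero {z z' : Phase} (h : distL z z' = 0) : z = z' := by
  have h1 := abs_boost_time_le z z'
  have h2 := norm_boost_space_le z z'
  have h3 := norm_momentum_sub_le_distL z z'
  have hb := bracket_pos z'.2.2
  rw [h] at h1 h2 h3
  have hs : |(boostInv z' z).1| + ‖(boostInv z' z).2.1‖ ≤ 0 := by norm_num at h1 h2 ⊢; simp [h1, h2]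
  have h4 := (abs_time_sub_le z z').trans (mul_nonpos_of_nonneg_of_nonpos hb.le hs)
  have h5 := (norm_space_sub_le z z').trans (mul_nonpos_of_nonneg_of_nonpos hb.le hs)
  rw [mul_zero] at h3
  refine Prod.ext (sub_eq_zero.1 (abs_nonpos_iff.1 h4)) (Prod.ext (sub_eq_zero.1 ?_)
    (sub_eq_zero.1 ?_))
  · exact norm_le_zero_iff.1 h5
  · exact norm_le_zero_iff.1 h3

theorem norm_par_le (p w : R3) : ‖par p w‖ ≤ ‖w‖ := by
  rcases eq_or_ne p 0 with rfl | hp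
  · simp [par]
  obtain ⟨a, e, ha, he, hpe, -, -⟩ := exists_unit_direction hp
  rw [par_of_eq_smul hpe ha he, norm_smul, he, mul_one, Real.norm_eq_abs]
  exact abs_inner_le_of_norm_eq_one he w

theorem par_self (p : R3) : par p p = p := by
  rcases eq_or_ne p 0 with rfl | hp
  · simp [par]
  obtain ⟨a, e, ha, he, hpe, -, -⟩ := exists_unit_direction hp
  rw [par_of_eq_smul hpe ha he]
  nth_rw 1 [hpe]
  rw [real_inner_smul_left, real_inner_self_eq_norm_sq, he, hpe]
  simp

/-- Points with equal momentum: the distance after transport to the momentum `q`. -/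
theorem distL_transport_le (z z' : Phase) (q : R3) (hd : distL z z' ≤ 1) :
    distL (z.1, z.2.1, q) (z'.1, z'.2.1, q)
      ≤ 5 * (√(bracket q * bracket z'.2.2) * distL z z' ^ (2 / 3 : ℝ)) := by
  set d := distL z z' with hdd
  have hd0 : 0 ≤ d := distL_nonneg z z'
  have hq := one_le_bracket q
  have hb := one_le_bracket z'.2.2
  set m := bracket q * bracket z'.2.2 with hm
  have hm1 : 1 ≤ m := one_le_mul_of_one_le_of_one_le hq hb
  -- In the frame of z' the time shift is at most d² and the space shift at most d³, but a change of
  -- frame mixes the two, leaving d² = D³ for both. The cube root of the space shift gives D; the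
  -- square root of the time shift gives D^{3/2} ≤ D. The two changes of frame cost m, of which both
  -- roots are at most √m since m ≥ 1.
  set D := d ^ (2 / 3 : ℝ) with hD
  have hD0 : 0 ≤ D := by positivity
  have hD1 : D ≤ 1 := Real.rpow_le_one hd0 hd (by norm_num)
  have hD3 : d ^ 2 = D ^ 3 := by
    rw [hD, ← Real.rpow_natCast, ← Real.rpow_natCast, ← Real.rpow_mul hd0]
    norm_num
  have h1 := abs_boost_time_le z z'
  have h2 := norm_boost_space_le z z'
  rw [← hdd] at h1 h2
  have h3 : d ^ 3 ≤ d ^ 2 := by nlinarith [sq_nonneg d]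
  have h4 := abs_time_sub_le z z'
  have h5 := norm_space_sub_le z z'
  have hS : |z.1 - z'.1| + ‖z.2.1 - z'.2.1‖ ≤ 4 * bracket z'.2.2 * D ^ 3 := by
    have : bracket z'.2.2 * (|(boostInv z' z).1| + ‖(boostInv z' z).2.1‖)
        ≤ bracket z'.2.2 * (d ^ 2 + d ^ 2) := by gcongr; linarith
    rw [← hD3]
    linarith
  have hqn := (norm_lt_bracket q).le
  have hT : |bracket q * (z.1 - z'.1) - ⟪q, z.2.1 - z'.2.1⟫_ℝ| ≤ 8 * m * D ^ 3 := by
    have e1 : |bracket q * (z.1 - z'.1) - ⟪q, z.2.1 - z'.2.1⟫_ℝ|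
        ≤ bracket q * |z.1 - z'.1| + bracket q * ‖z.2.1 - z'.2.1‖ := by
      refine (abs_sub _ _).trans (add_le_add ?_ ?_)
      · rw [abs_mul, abs_of_pos (bracket_pos q)]
      · exact (abs_real_inner_le_norm _ _).trans (by gcongr)
    have e2 := mul_le_mul_of_nonneg_left hS (bracket_pos q).le
    have e3 : 0 ≤ m * D ^ 3 := by positivity
    rw [hm] at e3 ⊢
    linarith
  have hX : ‖perp q (z.2.1 - z'.2.1) + bracket q • par q (z.2.1 - z'.2.1) - (z.1 - z'.1) • q‖
      ≤ 8 * m * D ^ 3 := by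
    set ξ := z.2.1 - z'.2.1
    have e0 : perp q ξ + bracket q • par q ξ - (z.1 - z'.1) • q
        = ξ + (bracket q - 1) • par q ξ - (z.1 - z'.1) • q := by
      unfold perp
      module
    have e1 : ‖ξ + (bracket q - 1) • par q ξ - (z.1 - z'.1) • q‖
        ≤ ‖ξ‖ + (bracket q - 1) * ‖ξ‖ + |z.1 - z'.1| * bracket q := by
      refine (norm_sub_le _ _).trans (add_le_add ((norm_add_le _ _).trans
        (add_le_add le_rfl ?_)) ?_)
      · rw [norm_smul, Real.norm_eq_abs, abs_of_nonneg (sub_nonneg.2 hq)]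
        exact mul_le_mul_of_nonneg_left (norm_par_le _ _) (sub_nonneg.2 hq)
      · rw [norm_smul, Real.norm_eq_abs]
        gcongr
    have e2 := mul_le_mul_of_nonneg_left hS (bracket_pos q).le
    have e3 : 0 ≤ m * D ^ 3 := by positivity
    rw [e0]
    rw [hm] at e3 ⊢
    linarith
  set Q := √m * D with hQ
  have hQ0 : 0 ≤ Q := by positivity
  have hmsq : √m ^ 2 = m := Real.sq_sqrt (by linarith)
  have hm1' : 1 ≤ √m := Real.one_le_sqrt.2 hm1
  have hY2 : 8 * m * D ^ 3 ≤ (3 * Q) ^ 2 := by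
    have : m * D ^ 3 ≤ m * D ^ 2 := by
      gcongr ?_ * ?_
      exact pow_le_pow_of_le_one hD0 hD1 (by norm_num)
    have h0 : 0 ≤ m * D ^ 2 := by positivity
    rw [hQ, mul_pow, mul_pow, hmsq]
    linarith
  have hY3 : 8 * m * D ^ 3 ≤ (2 * Q) ^ 3 := by
    have : (2 * Q) ^ 3 = 8 * (√m ^ 2 * √m) * D ^ 3 := by rw [hQ]; ring
    rw [this, hmsq]
    gcongr
    nlinarith
  have e1 : |bracket q * (z.1 - z'.1) - ⟪q, z.2.1 - z'.2.1⟫_ℝ| ^ (1 / 2 : ℝ) ≤ 3 * Q := by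
    calc _ ≤ ((3 * Q) ^ 2) ^ (1 / 2 : ℝ) := by gcongr; exact hT.trans hY2
      _ = _ := by
        rw [← Real.rpow_natCast, ← Real.rpow_mul (by positivity)]
        norm_num
  have e2 : ‖perp q (z.2.1 - z'.2.1) + bracket q • par q (z.2.1 - z'.2.1)
      - (z.1 - z'.1) • q‖ ^ (1 / 3 : ℝ) ≤ 2 * Q := by
    calc _ ≤ ((2 * Q) ^ 3) ^ (1 / 3 : ℝ) := by gcongr; exact hX.trans hY3
      _ = _ := by
        rw [← Real.rpow_natCast, ← Real.rpow_mul (by positivity)]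
        norm_num
  -- The boost attached to q brings q itself to rest.
  have e3 : ‖perp q q + bracket q • par q q - bracket q • q‖ = 0 := by
    simp [perp, par_self]
  simp only [distL, kinNorm, boostInv, e3]
  linarith

/-! ### Comparison of weights -/

theorem exists_rpow_sub_one_le (s : ℝ) :
    ∃ C, 0 ≤ C ∧ ∀ r : ℝ, |r - 1| ≤ 1 / 2 → |r ^ s - 1| ≤ C * |r - 1| := by
  have hpos : ∀ r ∈ Set.Icc (1 / 2 : ℝ) (3 / 2), r ≠ 0 := fun r hr => by
    have := hr.1
    positivity
  have hc : ContinuousOn (fun r : ℝ => s * r ^ (s - 1)) (Set.Icc (1 / 2) (3 / 2)) :=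
    continuousOn_const.mul (continuousOn_id.rpow_const fun r hr => Or.inl (hpos r hr))
  obtain ⟨C, hC⟩ := isCompact_Icc.exists_bound_of_continuousOn hc
  have h1 : (1 : ℝ) ∈ Set.Icc (1 / 2 : ℝ) (3 / 2) := by norm_num
  refine ⟨C, (norm_nonneg _).trans (hC 1 h1), fun r hr => ?_⟩
  have hr' : r ∈ Set.Icc (1 / 2 : ℝ) (3 / 2) := by
    rw [abs_le] at hr
    constructor <;> linarith
  have h := (convex_Icc (1 / 2 : ℝ) (3 / 2)).norm_image_sub_le_of_norm_hasDerivWithin_le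
    (fun x hx => (Real.hasDerivAt_rpow_const (p := s) (Or.inl (hpos x hx))).hasDerivWithinAt)
    hC h1 hr'
  simpa using h

/-- Powers of the bracket vary slowly. -/
theorem exists_bracket_rpow_sub_le (s : ℝ) :
    ∃ C, 0 ≤ C ∧ ∀ p p' : R3, ‖p - p'‖ ≤ bracket p' / 2 →
      |bracket p ^ s - bracket p' ^ s| ≤ C * bracket p' ^ s * (‖p - p'‖ / bracket p') := by
  obtain ⟨C, hC, h⟩ := exists_rpow_sub_one_le s
  refine ⟨C, hC, fun p p' hp => ?_⟩
  have hp0 := bracket_pos p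
  have hp'0 := bracket_pos p'
  have h1 : |bracket p / bracket p' - 1| ≤ ‖p - p'‖ / bracket p' := by
    rw [div_sub_one hp'0.ne', abs_div, abs_of_pos hp'0]
    gcongr
    exact abs_bracket_sub_le p p'
  have h2 : ‖p - p'‖ / bracket p' ≤ 1 / 2 := by
    rw [div_le_iff₀ hp'0]
    linarith
  have h3 := h _ (h1.trans h2)
  have h4 : bracket p ^ s - bracket p' ^ s
      = bracket p' ^ s * ((bracket p / bracket p') ^ s - 1) := by
    rw [Real.div_rpow hp0.le hp'0.le]
    field_simp
  rw [h4, abs_mul, abs_of_pos (Real.rpow_pos_of_pos hp'0 s)]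
  calc _ ≤ bracket p' ^ s * (C * (‖p - p'‖ / bracket p')) := by
        gcongr
        exact h3.trans (by gcongr)
    _ = _ := by ring

theorem exists_bracket_rpow_le (s : ℝ) :
    ∃ C, 0 ≤ C ∧ ∀ p p' : R3, ‖p - p'‖ ≤ bracket p' / 2 →
      bracket p ^ s ≤ C * bracket p' ^ s := by
  obtain ⟨C, hC, h⟩ := exists_bracket_rpow_sub_le s
  refine ⟨C + 1, by positivity, fun p p' hp => ?_⟩
  have hp'0 := bracket_pos p'
  have hs := Real.rpow_pos_of_pos hp'0 s
  have h1 := (le_abs_self _).trans (h p p' hp)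
  have h2 : ‖p - p'‖ / bracket p' ≤ 1 := by
    rw [div_le_one hp'0]
    linarith
  have h3 : C * bracket p' ^ s * (‖p - p'‖ / bracket p') ≤ C * bracket p' ^ s * 1 := by gcongr
  linarith

theorem fderiv_eq_sum_coord {f : R3 → ℝ} (p v : R3) :
    fderiv ℝ f p v = ∑ i, v i * fderiv ℝ f p (EuclideanSpace.single i 1) := by
  have h : v = ∑ i, v i • EuclideanSpace.single i (1 : ℝ) := by
    ext j
    simp [Finset.sum_apply, Pi.single_apply]
  nth_rw 1 [h]
  simp

/-- Along the diagonal the boost is ⟨p⟩∂_{p_i}, and its action on a symbol is a bounded symbol; the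
gradient is thus O(1/⟨p⟩). The factor 2 compares brackets along the segment. -/
theorem Sym.exists_diag_lipschitz {w : ℝ → R3 → R3 → ℝ} (hw : Sym w) :
    ∃ C, 0 ≤ C ∧ ∀ p p' : R3, ‖p - p'‖ ≤ bracket p' / 2 →
      |w 1 p p - w 1 p' p'| ≤ C * (‖p - p'‖ / bracket p') := by
  choose w' hw' hK using hw.exists_boost
  choose C hC hb using fun i => (hw' i).exists_bound
  have hf := contDiff_sym_diag hw
  have hC0 : 0 ≤ ∑ i, C i := Finset.sum_nonneg fun i _ => hC i
  refine ⟨(∑ i, C i) * 2, by positivity, fun p p' hp => ?_⟩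
  have hp'0 := bracket_pos p'
  have hfd (P : R3) : HasFDerivAt (fun p => w 1 p p) (fderiv ℝ (fun p => w 1 p p) P) P :=
    (hf.differentiable one_ne_zero).differentiableAt.hasFDerivAt
  have hcoord (P : R3) (i : Fin 3) :
      |fderiv ℝ (fun p => w 1 p p) P (EuclideanSpace.single i 1)| ≤ C i / bracket P := by
    have hP := bracket_pos P
    have h1 := (hfd P).hasLineDerivAt (bracket P • EuclideanSpace.single i (1 : ℝ))
    have h2 := hK i 1 P P (gam_sub_one_add_pos' one_pos P P)
    have h3 := h1.unique h2
    rw [map_smul, smul_eq_mul] at h3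
    rw [le_div_iff₀ hP, mul_comm]
    nth_rw 1 [← abs_of_pos hP]
    rw [← abs_mul, h3]
    exact hb i 1 P P zero_le_one
  have h := norm_image_sub_le_of_norm_deriv_le_segment_01'
    (f := fun r : ℝ => w 1 (p' + r • (p - p')) (p' + r • (p - p')))
    (f' := fun r : ℝ => fderiv ℝ (fun p => w 1 p p) (p' + r • (p - p')) (p - p'))
    (C := (∑ i, C i) * 2 * (‖p - p'‖ / bracket p')) ?_ ?_
  · simpa using h
  · intro r _
    have h1 : HasDerivAt (fun r : ℝ => p' + r • (p - p')) (p - p') r := by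
      simpa using ((hasDerivAt_id r).smul_const (p - p')).const_add p'
    exact ((hfd _).comp_hasDerivAt r h1).hasDerivWithinAt
  · intro r hr
    have hP := bracket_add_smul_ge hp ⟨hr.1, hr.2.le⟩
    set P := p' + r • (p - p')
    have hP0 := bracket_pos P
    rw [fderiv_eq_sum_coord, Real.norm_eq_abs]
    refine (Finset.abs_sum_le_sum_abs _ _).trans ?_
    rw [Finset.sum_mul, Finset.sum_mul]
    refine Finset.sum_le_sum fun i _ => ?_
    rw [abs_mul]
    calc _ ≤ ‖p - p'‖ * (C i / bracket P) := by
          have := abs_coord_le_norm (p - p') i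
          have := hcoord P i
          gcongr
      _ ≤ ‖p - p'‖ * (C i / (bracket p' / 2)) := by
          have := hC i
          gcongr
      _ = _ := by ring

/-! ### Hölder bounds for the operators -/

/-- The weighted Hölder bound on a function, in terms of explicit inequalities. -/
structure HolderBound (Ω : Set (ℝ × R3)) (α ℓ M : ℝ) (u : Phase → ℝ) : Prop where
  sup : ∀ z ∈ cyl Ω, |weighted ℓ u z| ≤ M
  diff : ∀ z ∈ cyl Ω, ∀ z' ∈ cyl Ω, |weighted ℓ u z - weighted ℓ u z'| ≤ M * distL z z' ^ α

theorem HolderBound.abs_le {Ω : Set (ℝ × R3)} {α ℓ M : ℝ} {u : Phase → ℝ}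
    (h : HolderBound Ω α ℓ M u) {z : Phase} (hz : z ∈ cyl Ω) :
    |u z| ≤ M * bracket z.2.2 ^ (-ℓ) := by
  have h1 := h.sup z hz
  have hp := Real.rpow_pos_of_pos (bracket_pos z.2.2) ℓ
  rw [weighted, abs_mul, abs_of_pos hp] at h1
  rw [Real.rpow_neg (bracket_pos _).le, ← div_eq_mul_inv, le_div_iff₀ hp]
  linarith

/-- Both points carry the same momentum q, so the weight ⟨q⟩^ℓ factors out of the difference.
Raising `distL_transport_le` to the power α costs ⟨q⟩^{α/2}, paid by the decay, and ⟨p'⟩^{α/2},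
which remains. -/
theorem HolderBound.abs_transport_sub_le {Ω : Set (ℝ × R3)} {α ℓ M : ℝ} {u : Phase → ℝ}
    (h : HolderBound Ω α ℓ M u) (hα : 0 < α) (hα1 : α < 1) (hM : 0 ≤ M) {z z' : Phase}
    (hz : z ∈ cyl Ω) (hz' : z' ∈ cyl Ω) (hd : distL z z' ≤ 1) (q : R3) :
    |u (z.1, z.2.1, q) - u (z'.1, z'.2.1, q)|
      ≤ 5 * M * (bracket z'.2.2 ^ (α / 2) * distL z z' ^ (2 * α / 3))
        * bracket q ^ (-(ℓ - α / 2)) := by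
  have hq := bracket_pos q
  have hb := bracket_pos z'.2.2
  have hd0 := distL_nonneg z z'
  have h1 := h.diff (z.1, z.2.1, q) hz (z'.1, z'.2.1, q) hz'
  have hp := Real.rpow_pos_of_pos hq ℓ
  simp only [weighted] at h1
  rw [← mul_sub, abs_mul, abs_of_pos hp] at h1
  have h2 : distL (z.1, z.2.1, q) (z'.1, z'.2.1, q) ^ α
      ≤ 5 * (bracket q ^ (α / 2) * bracket z'.2.2 ^ (α / 2) * distL z z' ^ (2 * α / 3)) := by
    calc _ ≤ (5 * (√(bracket q * bracket z'.2.2) * distL z z' ^ (2 / 3 : ℝ))) ^ α :=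
          Real.rpow_le_rpow (distL_nonneg _ _) (distL_transport_le z z' q hd) hα.le
      _ = 5 ^ α * (bracket q ^ (α / 2) * bracket z'.2.2 ^ (α / 2)
            * distL z z' ^ (2 * α / 3)) := by
          rw [Real.mul_rpow (by norm_num) (by positivity), Real.mul_rpow (by positivity)
            (by positivity), Real.sqrt_eq_rpow, ← Real.rpow_mul (by positivity),
            ← Real.rpow_mul hd0, Real.mul_rpow hq.le hb.le]
          ring_nf
      _ ≤ 5 ^ (1 : ℝ) * (bracket q ^ (α / 2) * bracket z'.2.2 ^ (α / 2)
            * distL z z' ^ (2 * α / 3)) := by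
          gcongr
          norm_num
      _ = _ := by rw [Real.rpow_one]
  have h3 : bracket q ^ (-(ℓ - α / 2)) = bracket q ^ (α / 2) / bracket q ^ ℓ := by
    rw [← Real.rpow_sub hq]
    ring_nf
  rw [h3, mul_div_assoc', le_div_iff₀ hp]
  calc _ = bracket q ^ ℓ * |u (z.1, z.2.1, q) - u (z'.1, z'.2.1, q)| := mul_comm _ _
    _ ≤ M * (5 * (bracket q ^ (α / 2) * bracket z'.2.2 ^ (α / 2) * distL z z' ^ (2 * α / 3))) :=
        h1.trans (mul_le_mul_of_nonneg_left h2 hM)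
    _ = _ := by ring

theorem pow_div_pow_mul_rpow_eq (p : R3) (j n : ℕ) (ℓ x : ℝ) :
    bracket p ^ j / bracket p ^ n * x
      = bracket p ^ ((j : ℝ) - n - ℓ) * (bracket p ^ ℓ * x) := by
  have hp := bracket_pos p
  rw [← mul_assoc, ← Real.rpow_add hp, sub_add_cancel, Real.rpow_sub hp, Real.rpow_natCast,
    Real.rpow_natCast]

/-- The Hölder bound for products of slowly varying functions. -/
theorem abs_mul_sub_mul_le {a b c a' b' c' A B C x D : ℝ} (ha' : |a'| ≤ A) (hb : |b| ≤ B)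
    (hb' : |b'| ≤ B) (hc : |c| ≤ C) (ha : |a - a'| ≤ A * x) (hbb : |b - b'| ≤ B * x)
    (hcc : |c - c'| ≤ C * x) (hx : x ≤ D) :
    |a * (b * c) - a' * (b' * c')| ≤ 3 * (A * (B * C)) * D := by
  have hA := (abs_nonneg _).trans ha'
  have hB := (abs_nonneg _).trans hb
  have hC := (abs_nonneg _).trans hc
  have e : a * (b * c) - a' * (b' * c')
      = (a - a') * (b * c) + a' * ((b - b') * c) + a' * (b' * (c - c')) := by ring
  have h0 : 0 ≤ A * (B * C) := by positivity
  have h1 : |(a - a') * (b * c)| ≤ A * x * (B * C) := by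
    rw [abs_mul, abs_mul]
    exact mul_le_mul ha (mul_le_mul hb hc (abs_nonneg _) hB) (by positivity)
      ((abs_nonneg _).trans ha)
  have h2 : |a' * ((b - b') * c)| ≤ A * (B * x * C) := by
    rw [abs_mul, abs_mul]
    exact mul_le_mul ha' (mul_le_mul hbb hc (abs_nonneg _) ((abs_nonneg _).trans hbb))
      (by positivity) hA
  have h3 : |a' * (b' * (c - c'))| ≤ A * (B * (C * x)) := by
    rw [abs_mul, abs_mul]
    exact mul_le_mul ha' (mul_le_mul hb' hcc (abs_nonneg _) hB) (by positivity) hA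
  rw [e]
  refine (abs_add_three _ _ _).trans ?_
  nlinarith

theorem rpow_le_rpow_of_le_one {d s t : ℝ} (hd : 0 ≤ d) (hd1 : d ≤ 1) (hs : 0 < s) (hst : s ≤ t) :
    d ^ t ≤ d ^ s :=
  Real.rpow_le_rpow_of_exponent_ge_of_imp hd hd1 hst fun _ h => absurd h (hs.trans_le hst).ne'

/-- For near operators the intermediate quantity has the kernel at the momentum of z and the density
at the base point of z'. The change of density is handled by `exists_near_bound` with decay ℓ - α/2,
the change of kernel by `exists_near_lipschitz`. Far operators again go into the error B. -/
theorem Op.exists_holder {γ : Fin 3 → ℕ} {A : ℝ → ((Fin 3 → ℕ) → Phase → ℝ) → Phase → ℝ}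
    (hA : Op γ A) {α ℓ : ℝ} (hα : 0 < α) (hα1 : α < 1) (hℓ : 9 + (order γ : ℝ) < ℓ) :
    ∃ C, 0 ≤ C ∧ ∀ (Ω : Set (ℝ × R3)) (G : (Fin 3 → ℕ) → Phase → ℝ) (M : ℝ), 0 ≤ M →
      Reg Ω γ G → (∀ γ' ≤ γ, HolderBound Ω α ℓ M (G γ')) →
      ∀ z ∈ cyl Ω, ∀ z' ∈ cyl Ω, distL z z' ≤ 1 / 4 →
        ∃ B : ℝ → ℝ, Tendsto B (𝓝[>] 0) (𝓝 0) ∧ ∀ δ, 0 < δ →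
          |A δ G z - A δ G z'| ≤ C * M * (bracket z'.2.2 ^ (α / 2) / bracket z'.2.2 ^ order γ)
            * distL z z' ^ (2 * α / 3) + B δ := by
  -- The threshold 1/4 makes |p-p'| ≤ 2⟨p'⟩d at most ⟨p'⟩/2, so that the brackets at both points are
  -- comparable.
  have hpp {z z' : Phase} (hd : distL z z' ≤ 1 / 4) : ‖z.2.2 - z'.2.2‖ ≤ bracket z'.2.2 / 2 := by
    have h1 := norm_momentum_sub_le_distL z z'
    have h2 := mul_le_mul_of_nonneg_left hd (bracket_pos z'.2.2).le
    linarith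
  have hpp' (z z' : Phase) : ‖z.2.2 - z'.2.2‖ / bracket z'.2.2 ≤ 2 * distL z z' := by
    rw [div_le_iff₀ (bracket_pos _)]
    have h1 := norm_momentum_sub_le_distL z z'
    linarith
  have hdd {z z' : Phase} (hd : distL z z' ≤ 1 / 4) : distL z z' ≤ distL z z' ^ (2 * α / 3) := by
    nth_rw 1 [← Real.rpow_one (distL z z')]
    exact rpow_le_rpow_of_le_one (distL_nonneg _ _) (by linarith) (by positivity) (by linarith)
  have hb1 (p : R3) : 1 ≤ bracket p ^ (α / 2) :=
    Real.one_le_rpow (one_le_bracket _) (by positivity)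
  have hn : (0 : ℝ) ≤ order γ := Nat.cast_nonneg _
  induction hA with
  | @near γ' ψ w j hψ hw hγ hj =>
    have hj' : (j : ℝ) ≤ order γ := by exact_mod_cast hj
    obtain ⟨C, hC, hb⟩ := exists_near_bound hψ hw j (order γ) (s := ℓ - α / 2) (by linarith)
    obtain ⟨C', hC', hb'⟩ := exists_near_lipschitz hψ hw j (order γ) (s := ℓ) (by linarith)
    refine ⟨C * 5 * 2 ^ order γ + 2 * C', by positivity, fun Ω G M hM hG hdec z hz z' hz' hd =>
      ⟨0, tendsto_const_nhds, fun δ hδ => ?_⟩⟩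
    simp only [Pi.zero_apply, add_zero]
    have hu := continuous_of_continuousOn_cyl (hG.cont γ' hγ) (t := z.1) (x := z.2.1) hz
    have hu' := continuous_of_continuousOn_cyl (hG.cont γ' hγ) (t := z'.1) (x := z'.2.1) hz'
    have hN := singKernel_kern hψ hw j (order γ) hδ
    have hp := bracket_pos z.2.2
    have hp' := bracket_pos z'.2.2
    have hd0 := distL_nonneg z z'
    set D := distL z z' ^ (2 * α / 3) with hD
    have e1 := hb δ (fun q => G γ' (z.1, z.2.1, q) - G γ' (z'.1, z'.2.1, q))
      (5 * M * (bracket z'.2.2 ^ (α / 2) * D)) z.2.2 hδ.le (by positivity)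
      fun q => (hdec γ' hγ).abs_transport_sub_le hα hα1 hM hz hz' (by linarith) q
    have e2 := hb' δ (fun q => G γ' (z'.1, z'.2.1, q)) M z.2.2 z'.2.2 hδ hM hu'
      (fun q => (hdec γ' hγ).abs_le (z := (z'.1, z'.2.1, q)) hz') (hpp hd)
    simp only [mul_sub] at e1
    rw [integral_sub (hN.integrable le_rfl _ hu) (hN.integrable le_rfl _ hu')] at e1
    have hhalf : bracket z'.2.2 / 2 ≤ bracket z.2.2 := by
      have := abs_bracket_sub_le z.2.2 z'.2.2
      have := neg_le_of_abs_le this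
      have := hpp hd
      linarith
    have e3 : C * (5 * M * (bracket z'.2.2 ^ (α / 2) * D)) / bracket z.2.2 ^ order γ
        ≤ C * 5 * 2 ^ order γ * (M * (bracket z'.2.2 ^ (α / 2) / bracket z'.2.2 ^ order γ) * D) := by
      calc _ ≤ C * (5 * M * (bracket z'.2.2 ^ (α / 2) * D)) / (bracket z'.2.2 / 2) ^ order γ := by
            gcongr
        _ = _ := by
            rw [div_pow]
            field_simp
    have e4 : C' * M * ‖z.2.2 - z'.2.2‖ / bracket z'.2.2 ^ (order γ + 1)
        ≤ 2 * C' * (M * (bracket z'.2.2 ^ (α / 2) / bracket z'.2.2 ^ order γ) * D) := by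
      calc _ = C' * M / bracket z'.2.2 ^ order γ * (‖z.2.2 - z'.2.2‖ / bracket z'.2.2) := by
            rw [pow_succ]
            field_simp
        _ ≤ C' * M / bracket z'.2.2 ^ order γ * (2 * D) := by
            gcongr
            exact (hpp' z z').trans (by linarith [hdd hd])
        _ = C' * M * 1 / bracket z'.2.2 ^ order γ * (2 * D) := by rw [mul_one]
        _ ≤ C' * M * bracket z'.2.2 ^ (α / 2) / bracket z'.2.2 ^ order γ * (2 * D) := by
            have := hb1 z'.2.2
            gcongr
        _ = _ := by ring
    refine (abs_sub_le _ (∫ q, kern ψ w j (order γ) δ 0 z.2.2 q * G γ' (z'.1, z'.2.1, q)) _).trans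
      ((add_le_add (e1.trans e3) (e2.trans e4)).trans (le_of_eq ?_))
    ring
  | @far f hf =>
    refine ⟨0, le_rfl, fun Ω G M hM hG hdec z hz z' hz' hd =>
      ⟨fun δ => |(∫ q, farKern f δ z.2.2 q * G 0 (z.1, z.2.1, q))
        - ∫ q, farKern f δ z'.2.2 q * G 0 (z'.1, z'.2.1, q)|, ?_, fun δ hδ => by simp⟩⟩
    have hlim {z : Phase} (hz : z ∈ cyl Ω) := hf.tendsto_zero z.2.2
      (hG.continuous_zero (t := z.1) (x := z.2.1) hz)
      (integrable_of_decay (k := ℓ) (by linarith) (hG.continuous_zero hz)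
        fun q => (hdec 0 zero_le).abs_le (z := (z.1, z.2.1, q)) hz)
    simpa using ((hlim hz).sub (hlim hz')).abs
  | @loc γ' w j hw hγ hj =>
    have hj' : (j : ℝ) ≤ order γ := by exact_mod_cast hj
    obtain ⟨C₁, hC₁, hb₁⟩ := hw.exists_bound
    obtain ⟨C₂, hC₂, hb₂⟩ := hw.exists_diag_lipschitz
    obtain ⟨C₃, hC₃, hb₃⟩ := exists_bracket_rpow_sub_le ((j : ℝ) - order γ - ℓ)
    obtain ⟨C₄, hC₄, hb₄⟩ := exists_bracket_rpow_le ((j : ℝ) - order γ - ℓ)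
    refine ⟨3 * ((C₁ + 2 * C₂) * (1 + 2 * C₃ + C₄)), by positivity,
      fun Ω G M hM hG hdec z hz z' hz' hd => ⟨0, tendsto_const_nhds, fun δ hδ => ?_⟩⟩
    simp only [Pi.zero_apply, add_zero]
    have hp' := bracket_pos z'.2.2
    have hd0 := distL_nonneg z z'
    set D := distL z z' ^ (2 * α / 3) with hD
    have hD0 : 0 ≤ D := by positivity
    have hdD : distL z z' ≤ D := hdd hd
    set R := bracket z'.2.2 ^ ((j : ℝ) - order γ - ℓ) with hR
    have hR0 : 0 < R := Real.rpow_pos_of_pos hp' _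
    have h := hpp hd
    have h' := hpp' z z'
    have hRle : R ≤ bracket z'.2.2 ^ (α / 2) / bracket z'.2.2 ^ order γ := by
      rw [← Real.rpow_natCast, ← Real.rpow_sub hp', hR]
      exact Real.rpow_le_rpow_of_exponent_le (one_le_bracket _) (by linarith)
    -- A local term is a product of three Hölder factors: a symbol on the diagonal, a power of the
    -- bracket, and the weighted density.
    have key : |w 1 z.2.2 z.2.2 * (bracket z.2.2 ^ ((j : ℝ) - order γ - ℓ) * weighted ℓ (G γ') z)
        - w 1 z'.2.2 z'.2.2 * (R * weighted ℓ (G γ') z')|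
        ≤ 3 * ((C₁ + 2 * C₂) * ((1 + 2 * C₃ + C₄) * R * M)) * D := by
      refine abs_mul_sub_mul_le (x := D) ?_ ?_ ?_ ((hdec γ' hγ).sup z hz) ?_ ?_ ?_ le_rfl
      · exact (hb₁ 1 _ _ zero_le_one).trans (by linarith)
      · rw [abs_of_pos (Real.rpow_pos_of_pos (bracket_pos _) _)]
        refine (hb₄ _ _ h).trans ?_
        gcongr
        linarith
      · rw [abs_of_pos hR0]
        exact le_mul_of_one_le_left hR0.le (by linarith)
      · refine (hb₂ _ _ h).trans ?_
        calc _ ≤ C₂ * (2 * D) := by gcongr; linarith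
          _ = (2 * C₂) * D := by ring
          _ ≤ _ := by gcongr; linarith
      · refine (hb₃ _ _ h).trans ?_
        calc _ ≤ C₃ * R * (2 * D) := by gcongr; linarith
          _ = (2 * C₃) * R * D := by ring
          _ ≤ _ := by gcongr; linarith
      · refine ((hdec γ' hγ).diff z hz z' hz').trans ?_
        gcongr
        exact rpow_le_rpow_of_le_one hd0 (by linarith) (by positivity) (by linarith)
    have e (z : Phase) : w 1 z.2.2 z.2.2 * bracket z.2.2 ^ j / bracket z.2.2 ^ order γ * G γ' z
        = w 1 z.2.2 z.2.2 * (bracket z.2.2 ^ ((j : ℝ) - order γ - ℓ)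
          * weighted ℓ (G γ') z) := by
      rw [weighted, ← pow_div_pow_mul_rpow_eq]
      ring
    rw [e z, e z']
    refine key.trans ?_
    calc _ = 3 * ((C₁ + 2 * C₂) * (1 + 2 * C₃ + C₄)) * M * R * D := by ring
      _ ≤ _ := by gcongr
  | add _ _ h1 h2 =>
    obtain ⟨C, hC, h1⟩ := h1
    obtain ⟨C', hC', h2⟩ := h2
    refine ⟨C + C', by positivity, fun Ω G M hM hG hdec z hz z' hz' hd => ?_⟩
    obtain ⟨B, hB, h1⟩ := h1 Ω G M hM hG hdec z hz z' hz' hd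
    obtain ⟨B', hB', h2⟩ := h2 Ω G M hM hG hdec z hz z' hz' hd
    refine ⟨fun δ => B δ + B' δ, by simpa using hB.add hB', fun δ hδ => ?_⟩
    rw [add_sub_add_comm]
    refine (abs_add_le _ _).trans ((add_le_add (h1 δ hδ) (h2 δ hδ)).trans (le_of_eq ?_))
    ring

/-! ### Interchanging partial derivatives -/

/-- If `∂_v f`, `∂_w f` and `∂_w ∂_v f` exist near `z` and the latter is continuous at `z`,
then `∂_v ∂_w f` exists at `z` and has the same value. -/
theorem HasLineDerivAt.interchange {E : Type*} [NormedAddCommGroup E] [NormedSpace ℝ E]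
    {f fv fw fvw : E → ℝ} {z v w : E}
    (hv : ∀ᶠ y in 𝓝 z, HasLineDerivAt ℝ f (fv y) y v)
    (hw : ∀ᶠ y in 𝓝 z, HasLineDerivAt ℝ f (fw y) y w)
    (hvw : ∀ᶠ y in 𝓝 z, HasLineDerivAt ℝ fv (fvw y) y w) (hc : ContinuousAt fvw z) :
    HasLineDerivAt ℝ fw (fvw z) z v := by
  have e0 : Tendsto (fun x : ℝ × ℝ => z + x.1 • v + x.2 • w) (𝓝 0) (𝓝 z) := by
    have : Continuous fun x : ℝ × ℝ => z + x.1 • v + x.2 • w := by fun_prop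
    simpa using this.tendsto 0
  unfold HasLineDerivAt
  rw [hasDerivAt_iff_isLittleO, Asymptotics.isLittleO_iff]
  intro c hc0
  have h1 := e0.eventually (hv.and (hw.and (hvw.and (hc.eventually (Metric.ball_mem_nhds _ hc0)))))
  obtain ⟨r, hr, hball⟩ := Metric.eventually_nhds_iff.1 h1
  have hgood {s h : ℝ} (hs : |s| < r) (hh : |h| < r) := hball (y := (s, h)) (by
    simpa [Prod.dist_eq, Real.dist_eq] using ⟨hs, hh⟩)
  simp only at hgood
  -- The mean value inequality along w compares increments of `fv` with h times the mixed
  -- derivative. A second application along v then estimates the second difference of f; dividing by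
  -- h and letting h → 0 turns it into an increment of `fw`.
  have hfd (s h : ℝ) (hs : |s| < r) (hh : |h| < r) :
      |fv (z + s • v + h • w) - fv (z + s • v) - h * fvw z| ≤ c * |h| := by
    have hlt {x : ℝ} (hx : x ∈ Set.uIcc 0 h) : |x| < r := by
      have := Set.abs_sub_left_of_mem_uIcc hx
      simp only [sub_zero] at this
      linarith
    have h := (convex_uIcc (0 : ℝ) h).norm_image_sub_le_of_norm_hasDerivWithin_le (𝕜 := ℝ)
      (f := fun x : ℝ => fv (z + s • v + x • w) - x * fvw z)
      (f' := fun x : ℝ => fvw (z + s • v + x • w) - 1 * fvw z) (C := c)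
      (fun x hx => ((hasDerivAt_of_hasLineDerivAt (hgood hs (hlt hx)).2.2.1).sub
        ((hasDerivAt_id x).mul_const _)).hasDerivWithinAt)
      (fun x hx => by
        have := (hgood hs (hlt hx)).2.2.2
        rw [dist_eq_norm] at this
        simpa using this.le) Set.left_mem_uIcc Set.right_mem_uIcc
    simp only [zero_smul, add_zero, zero_mul, sub_zero, Real.norm_eq_abs] at h
    convert h using 2
    ring
  have hdd (s h : ℝ) (hs : |s| < r) (hh : |h| < r) :
      |(f (z + s • v + h • w) - f (z + s • v)) - (f (z + h • w) - f z) - s * (h * fvw z)|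
        ≤ c * |h| * |s| := by
    have hlt {x : ℝ} (hx : x ∈ Set.uIcc 0 s) : |x| < r := by
      have := Set.abs_sub_left_of_mem_uIcc hx
      simp only [sub_zero] at this
      linarith
    have hr0 : |(0 : ℝ)| < r := by simpa using hr
    have h1 := (convex_uIcc (0 : ℝ) s).norm_image_sub_le_of_norm_hasDerivWithin_le (𝕜 := ℝ)
      (f := fun x : ℝ => f (z + h • w + x • v) - f (z + x • v) - x * (h * fvw z))
      (f' := fun x : ℝ => fv (z + h • w + x • v) - fv (z + x • v) - 1 * (h * fvw z))
      (C := c * |h|)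
      (fun x hx => by
        have e1 := (hgood (hlt hx) hh).1
        have e2 := (hgood (hlt hx) hr0).1
        rw [add_right_comm] at e1
        rw [zero_smul, add_zero] at e2
        exact (((hasDerivAt_of_hasLineDerivAt e1).sub (hasDerivAt_of_hasLineDerivAt e2)).sub
          ((hasDerivAt_id x).mul_const _)).hasDerivWithinAt)
      (fun x hx => by
        have := hfd x h (hlt hx) hh
        rw [add_right_comm] at this
        simpa using this) Set.left_mem_uIcc Set.right_mem_uIcc
    simp only [zero_smul, add_zero, zero_mul, sub_zero, Real.norm_eq_abs] at h1
    convert h1 using 2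
    rw [add_right_comm]
    ring
  refine Metric.eventually_nhds_iff.2 ⟨r, hr, fun s hs => ?_⟩
  have hs' : |s| < r := by simpa [Real.dist_eq] using hs
  have hr0 : |(0 : ℝ)| < r := by simpa using hr
  have t1 := (hgood hs' hr0).2.1
  have t2 := (hgood hr0 hr0).2.1
  simp only [zero_smul, add_zero] at t1 t2
  have l1 := t1.tendsto_slope_zero
  have l2 := t2.tendsto_slope_zero
  have l3 := ((l1.sub l2).sub_const (s * fvw z)).abs
  simp only [zero_smul, add_zero, sub_zero, Real.norm_eq_abs]
  rw [smul_eq_mul]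
  refine le_of_tendsto l3 ?_
  have hev : ∀ᶠ h : ℝ in 𝓝[≠] 0, |h| < r := by
    have : ∀ᶠ h : ℝ in 𝓝 0, |h| < r := by
      filter_upwards [Metric.ball_mem_nhds (0 : ℝ) hr] with h hh
      simpa using hh
    exact this.filter_mono nhdsWithin_le_nhds
  filter_upwards [hev, self_mem_nhdsWithin] with h hh hne
  have hh0 : 0 < |h| := abs_pos.2 hne
  have h3 := hdd s h hs' hh
  have e : h⁻¹ • (f (z + s • v + h • w) - f (z + s • v)) - h⁻¹ • (f (z + h • w) - f z)
      - s * fvw z = h⁻¹ * ((f (z + s • v + h • w) - f (z + s • v)) - (f (z + h • w) - f z)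
        - s * (h * fvw z)) := by
    have : h ≠ 0 := hne
    rw [smul_eq_mul, smul_eq_mul]
    field_simp
  rw [e, abs_mul, abs_inv, inv_mul_le_iff₀ hh0]
  linarith

/-! ### Mixed derivatives, indexed uniformly -/

/-- The coordinate directions, in the order in which `mixed` composes them. -/
noncomputable def dir : Fin 7 → Phase := ![dirT, dirX 0, dirX 1, dirX 2, dirP 0, dirP 1, dirP 2]

/-- `mixed`, with the three multi-indices merged into one. -/
noncomputable def mix (κ : Fin 7 → ℕ) (u : Phase → ℝ) : Phase → ℝ :=
  (pd (dir 0))^[κ 0] ((pd (dir 1))^[κ 1] ((pd (dir 2))^[κ 2] ((pd (dir 3))^[κ 3]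
    ((pd (dir 4))^[κ 4] ((pd (dir 5))^[κ 5] ((pd (dir 6))^[κ 6] u))))))

/-- The multi-index in all variables built from those in `t`, `x` and `p`. -/
def idx (m : ℕ) (γx γp : Fin 3 → ℕ) : Fin 7 → ℕ :=
  ![m, γx 0, γx 1, γx 2, γp 0, γp 1, γp 2]

theorem mix_idx (m : ℕ) (γx γp : Fin 3 → ℕ) (u : Phase → ℝ) :
    mix (idx m γx γp) u = mixed m γx γp u := rfl

theorem mix_zero (u : Phase → ℝ) : mix 0 u = u := rfl

/-- Directions of smaller index are applied later, so the new derivative is outermost only when none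
of them occurs. -/
theorem mix_add_single {κ : Fin 7 → ℕ} {i : Fin 7} (h : ∀ j < i, κ j = 0) (u : Phase → ℝ) :
    mix (κ + Pi.single i 1) u = pd (dir i) (mix κ u) := by
  fin_cases i <;> simp only [mix, Pi.add_apply, Pi.single_apply] <;>
    simp [h 0, h 1, h 2, h 3, h 4, h 5, Function.iterate_succ_apply', Function.iterate_succ_apply']

theorem exists_first_index {κ : Fin 7 → ℕ} (h : κ ≠ 0) :
    ∃ (i : Fin 7) (κ' : Fin 7 → ℕ), κ = κ' + Pi.single i 1 ∧ ∀ j < i, κ j = 0 := by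
  obtain ⟨i₀, hi₀⟩ := Function.ne_iff.1 h
  have hex : ∃ i, κ i ≠ 0 := ⟨i₀, hi₀⟩
  have hS : (Finset.univ.filter fun i => κ i ≠ 0).Nonempty := ⟨i₀, by simpa using hi₀⟩
  set i := (Finset.univ.filter fun i => κ i ≠ 0).min' hS with hi
  have h1 : κ i ≠ 0 := by simpa using Finset.min'_mem _ hS
  refine ⟨i, κ - Pi.single i 1, ?_, fun j hj => ?_⟩
  · funext j
    simp only [Pi.add_apply, Pi.sub_apply, Pi.single_apply]
    split_ifs with hji
    · subst hji
      omega
    · simp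
  · by_contra h2
    exact absurd (Finset.min'_le _ j (by simpa using h2)) (not_le.2 hj)

/-- `HasMixedDerivs`, with the multi-indices merged into one. -/
def HasMix (U : Set Phase) (β : Fin 7 → ℕ) (u : Phase → ℝ) : Prop :=
  ∀ κ ≤ β, ContinuousOn (mix κ u) U ∧
    ∀ i, κ i < β i → ∀ z ∈ U, LineDifferentiableAt ℝ (mix κ u) z (dir i)

theorem sum_add_single (κ : Fin 7 → ℕ) (i : Fin 7) :
    ∑ j, (κ + Pi.single i 1 : Fin 7 → ℕ) j = ∑ j, κ j + 1 := by
  simp [Finset.sum_add_distrib]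

theorem lt_of_add_single_le {κ β : Fin 7 → ℕ} {i : Fin 7} (h : κ + Pi.single i 1 ≤ β) :
    κ i < β i := by
  have := h i
  simpa [Nat.succ_le_iff] using this

/-- All partial derivatives may be taken in any order. -/
theorem HasMix.hasLineDerivAt {U : Set Phase} (hU : IsOpen U) {β : Fin 7 → ℕ} {u : Phase → ℝ}
    (h : HasMix U β u) {κ : Fin 7 → ℕ} {i : Fin 7} (hκ : κ + Pi.single i 1 ≤ β) {z : Phase}
    (hz : z ∈ U) : HasLineDerivAt ℝ (mix κ u) (mix (κ + Pi.single i 1) u z) z (dir i) := by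
  obtain ⟨n, hn⟩ : ∃ n, ∑ j, κ j = n := ⟨_, rfl⟩
  induction n generalizing κ i z with
  | zero =>
    have h0 : κ = 0 := by
      funext j
      exact (Finset.sum_eq_zero_iff.1 hn) j (Finset.mem_univ j)
    rw [mix_add_single fun j _ => by simp [h0]]
    exact ((h κ (le_self_add.trans hκ)).2 i (lt_of_add_single_le hκ) z hz).hasLineDerivAt
  | succ n ih =>
    have hdirect (hi : ∀ j < i, κ j = 0) :
        HasLineDerivAt ℝ (mix κ u) (mix (κ + Pi.single i 1) u z) z (dir i) := by
      rw [mix_add_single hi]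
      exact ((h κ (le_self_add.trans hκ)).2 i (lt_of_add_single_le hκ) z hz).hasLineDerivAt
    have hne : κ ≠ 0 := by
      rintro rfl
      simp at hn
    -- The outermost derivative is ∂_j. If i ≤ j, then ∂_i goes outside it directly; otherwise ∂_i
    -- and ∂_j are interchanged, with both derivatives of `mix κ' u` supplied by the induction
    -- hypothesis.
    obtain ⟨j, κ', rfl, hj⟩ := exists_first_index hne
    rcases le_or_gt i j with hij | hij
    · exact hdirect fun k hk => hj k (hk.trans_le hij)
    rw [sum_add_single] at hn
    have hn' : ∑ j, κ' j = n := by omega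
    have hcomm : κ' + Pi.single j 1 + Pi.single i 1 = κ' + Pi.single i 1 + Pi.single j 1 :=
      add_right_comm _ _ _
    have hle1 : κ' + Pi.single j 1 ≤ β := le_self_add.trans hκ
    rw [hcomm] at hκ
    have hle2 : κ' + Pi.single i 1 ≤ β := le_self_add.trans hκ
    have hz' := hU.mem_nhds hz
    rw [hcomm]
    refine HasLineDerivAt.interchange (f := mix κ' u) (fv := mix (κ' + Pi.single i 1) u)
      (fvw := mix (κ' + Pi.single i 1 + Pi.single j 1) u) (w := dir j) ?_ ?_ ?_
      ((h _ hκ).1.continuousAt hz')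
    · filter_upwards [hz'] with y hy
      exact ih hle2 hy hn'
    · filter_upwards [hz'] with y hy
      exact ih hle1 hy hn'
    · filter_upwards [hz'] with y hy
      rw [mix_add_single (κ := κ' + Pi.single i 1)]
      · exact ((h _ hle2).2 j (lt_of_add_single_le hκ) y hy).hasLineDerivAt
      · intro k hk
        have := hj k hk
        simp only [Pi.add_apply, Nat.add_eq_zero_iff] at this ⊢
        refine ⟨this.1, ?_⟩
        simp [(hk.trans hij).ne]

/-! ### Splitting multi-indices into base and momentum parts. -/

/-- The momentum part of a multi-index. -/
def momentumPart (κ : Fin 7 → ℕ) : Fin 3 → ℕ := ![κ 4, κ 5, κ 6]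

/-- Replacement of the momentum part of a multi-index. -/
def withMomentum (κ : Fin 7 → ℕ) (γ : Fin 3 → ℕ) : Fin 7 → ℕ :=
  ![κ 0, κ 1, κ 2, κ 3, γ 0, γ 1, γ 2]

theorem withMomentum_le {κ β : Fin 7 → ℕ} (h : κ ≤ β) {γ : Fin 3 → ℕ} (hγ : γ ≤ momentumPart β) :
    withMomentum κ γ ≤ β := by
  intro i
  have := h i
  have h0 := hγ 0
  have h1 := hγ 1
  have h2 := hγ 2
  fin_cases i <;> simp_all [withMomentum, momentumPart]

theorem momentumPart_le {κ β : Fin 7 → ℕ} (h : κ ≤ β) : momentumPart κ ≤ momentumPart β := by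
  intro i
  fin_cases i
  exacts [h 4, h 5, h 6]

/-- The dichotomy behind all later inductions: t and x derivatives pass through an operator onto the
density, momentum derivatives change the operator. -/
theorem base_or_momentum (i : Fin 7) :
    ((dir i).2.2 = 0 ∧ (∀ κ, momentumPart (κ + Pi.single i 1) = momentumPart κ) ∧
      ∀ κ γ, withMomentum (κ + Pi.single i 1) γ = withMomentum κ γ + Pi.single i 1) ∨
    ∃ j : Fin 3, 4 ≤ i ∧ dir i = dirP j ∧
      (∀ κ, momentumPart (κ + Pi.single i 1) = momentumPart κ + Pi.single j 1) ∧
      (∀ κ γ, withMomentum (κ + Pi.single i 1) γ = withMomentum κ γ) ∧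
      ∀ κ γ, withMomentum κ (γ + Pi.single j 1) = withMomentum κ γ + Pi.single i 1 := by
  have hb (i : Fin 7) (hi : i < 4) (h : (dir i).2.2 = 0) : (dir i).2.2 = 0 ∧
      (∀ κ, momentumPart (κ + Pi.single i 1) = momentumPart κ) ∧
      ∀ κ γ, withMomentum (κ + Pi.single i 1) γ = withMomentum κ γ + Pi.single i 1 := by
    refine ⟨h, fun κ => ?_, fun κ γ => ?_⟩
    · funext k
      fin_cases i <;> fin_cases k <;> simp_all [momentumPart]
    · funext k
      fin_cases i <;> fin_cases k <;> simp_all [withMomentum]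
  have hp (j : Fin 3) (h : dir (Fin.natAdd 4 j) = dirP j) :
      4 ≤ Fin.natAdd 4 j ∧ dir (Fin.natAdd 4 j) = dirP j ∧
      (∀ κ, momentumPart (κ + Pi.single (Fin.natAdd 4 j) 1) = momentumPart κ + Pi.single j 1) ∧
      (∀ κ γ, withMomentum (κ + Pi.single (Fin.natAdd 4 j) 1) γ = withMomentum κ γ) ∧
      ∀ κ γ, withMomentum κ (γ + Pi.single j 1)
        = withMomentum κ γ + Pi.single (Fin.natAdd 4 j) 1 := by
    refine ⟨Fin.le_iff_val_le_val.2 (Nat.le_add_right 4 j), h, fun κ => ?_, fun κ γ => ?_,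
      fun κ γ => ?_⟩
    · funext k
      fin_cases j <;> fin_cases k <;> simp [momentumPart]
    · funext k
      fin_cases j <;> fin_cases k <;> simp [withMomentum]
    · funext k
      fin_cases j <;> fin_cases k <;> simp [withMomentum]
  fin_cases i
  · exact Or.inl (hb 0 (by decide) rfl)
  · exact Or.inl (hb 1 (by decide) rfl)
  · exact Or.inl (hb 2 (by decide) rfl)
  · exact Or.inl (hb 3 (by decide) rfl)
  · exact Or.inr ⟨0, hp 0 rfl⟩
  · exact Or.inr ⟨1, hp 1 rfl⟩
  · exact Or.inr ⟨2, hp 2 rfl⟩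

theorem HasMixedDerivs.hasMix {U : Set Phase} {m : ℕ} {βx βp : Fin 3 → ℕ} {u : Phase → ℝ}
    (h : HasMixedDerivs U m βx βp u) : HasMix U (idx m βx βp) u := by
  intro κ hκ
  have hx : (![κ 1, κ 2, κ 3] : Fin 3 → ℕ) ≤ βx := by
    intro i
    fin_cases i
    exacts [hκ 1, hκ 2, hκ 3]
  have hp : momentumPart κ ≤ βp := by
    intro i
    fin_cases i
    exacts [hκ 4, hκ 5, hκ 6]
  obtain ⟨h1, h2, h3, h4⟩ := h (κ 0) (hκ 0) _ hx _ hp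
  refine ⟨h1, fun i hi => ?_⟩
  fin_cases i
  exacts [h2 hi, h3 0 hi, h3 1 hi, h3 2 hi, h4 0 hi, h4 1 hi, h4 2 hi]

theorem idx_le {m m' : ℕ} {γx γp βx βp : Fin 3 → ℕ} (hm : m' ≤ m) (hx : γx ≤ βx) (hp : γp ≤ βp) :
    idx m' γx γp ≤ idx m βx βp := by
  intro i
  fin_cases i
  exacts [hm, hx 0, hx 1, hx 2, hp 0, hp 1, hp 2]

theorem HasMix.hasMixedDerivs {U : Set Phase} {m : ℕ} {βx βp : Fin 3 → ℕ} {u : Phase → ℝ}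
    (h : HasMix U (idx m βx βp) u) : HasMixedDerivs U m βx βp u := by
  intro m' hm γx hx γp hp
  obtain ⟨h1, h2⟩ := h (idx m' γx γp) (idx_le hm hx hp)
  refine ⟨h1, h2 0, fun i => ?_, fun i => ?_⟩
  · fin_cases i
    exacts [h2 1, h2 2, h2 3]
  · fin_cases i
    exacts [h2 4, h2 5, h2 6]

/-! ### Derivatives of coefficients given by operators -/

/-- The coefficient `F` is given by the operator `A` of order zero, for every `δ`. -/
structure IsCoeff (F : (Phase → ℝ) → Phase → ℝ)
    (A : ℝ → ((Fin 3 → ℕ) → Phase → ℝ) → Phase → ℝ) : Prop where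
  op : Op 0 A
  eq : ∀ (Ω : Set (ℝ × R3)) (G : (Fin 3 → ℕ) → Phase → ℝ) (δ : ℝ), IsOpen Ω → 0 < δ →
    Reg Ω 0 G → ∀ z ∈ dom Ω δ, F (G 0) z = A δ G z

theorem exists_mem_dom {Ω : Set (ℝ × R3)} {z : Phase} (hz : z ∈ cyl Ω) :
    ∃ δ, 0 < δ ∧ z ∈ dom Ω δ := by
  have hb := bracket_pos z.2.2
  refine ⟨1 / (32 * bracket z.2.2 ^ 2), by positivity, hz, ?_⟩
  field_simp
  norm_num

/-- The assumptions on `g`: all derivatives up to order `β` are continuous, and those without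
momentum derivatives are locally dominated. -/
structure Admissible (Ω : Set (ℝ × R3)) (β : Fin 7 → ℕ) (g : Phase → ℝ) : Prop where
  hasMix : HasMix (cyl Ω) β g
  dominated : ∀ κ ≤ β, ∀ y ∈ Ω, ∃ w : R3 → ℝ, Integrable w ∧
    ∀ᶠ y' in 𝓝 y, ∀ q : R3, |mix (withMomentum κ 0) g (y'.1, y'.2, q)| ≤ w q

theorem Admissible.reg {Ω : Set (ℝ × R3)} {β : Fin 7 → ℕ} {g : Phase → ℝ}
    (h : Admissible Ω β g) {κ : Fin 7 → ℕ} (hκ : κ ≤ β) :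
    Reg Ω (momentumPart κ) fun γ => mix (withMomentum κ γ) g where
  cont _ hγ := (h.hasMix _ (withMomentum_le hκ (hγ.trans (momentumPart_le hκ)))).1
  dominated := h.dominated κ hκ

/-- Differentiation in `t` and `x` commutes with the operators. -/
theorem Op.hasLineDerivAt_mix {γ : Fin 3 → ℕ}
    {A : ℝ → ((Fin 3 → ℕ) → Phase → ℝ) → Phase → ℝ} (hA : Op γ A) {κ : Fin 7 → ℕ}
    (hγ : momentumPart κ = γ) {i : Fin 7} (h1 : (dir i).2.2 = 0)
    (h2 : ∀ κ, momentumPart (κ + Pi.single i 1) = momentumPart κ)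
    (h3 : ∀ κ γ, withMomentum (κ + Pi.single i 1) γ = withMomentum κ γ + Pi.single i 1)
    {Ω : Set (ℝ × R3)} {β : Fin 7 → ℕ} {g : Phase → ℝ} {δ : ℝ} (hΩ : IsOpen Ω) (hδ : 0 < δ)
    (hg : Admissible Ω β g) (hκ : κ + Pi.single i 1 ≤ β) {z : Phase} (hz : z ∈ dom Ω δ) :
    HasLineDerivAt ℝ (A δ fun γ => mix (withMomentum κ γ) g)
      (A δ (fun γ => mix (withMomentum (κ + Pi.single i 1) γ) g) z) z (dir i) := by
  subst hγ
  have hr := hg.reg hκ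
  rw [h2] at hr
  refine hA.hasLineDerivAt_base hΩ (hg.reg (le_self_add.trans hκ)) hr h1
    (fun _ hγ y hy => ?_) hδ hz
  rw [h3]
  refine hg.hasMix.hasLineDerivAt (isOpen_cyl hΩ) ?_ hy
  rw [← h3]
  exact withMomentum_le hκ (hγ.trans (momentumPart_le (le_self_add.trans hκ)))

/-- The action of an operator on derivatives of `g` can be differentiated in every direction. -/
theorem Op.exists_step {κ : Fin 7 → ℕ} {A : ℝ → ((Fin 3 → ℕ) → Phase → ℝ) → Phase → ℝ}
    (hA : Op (momentumPart κ) A) (i : Fin 7) :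
    ∃ A', Op (momentumPart (κ + Pi.single i 1)) A' ∧
      ∀ (Ω : Set (ℝ × R3)) (β : Fin 7 → ℕ) (g : Phase → ℝ) (δ : ℝ), IsOpen Ω → 0 < δ →
        Admissible Ω β g → κ + Pi.single i 1 ≤ β → ∀ z ∈ dom Ω δ,
        HasLineDerivAt ℝ (A δ fun γ => mix (withMomentum κ γ) g)
          (A' δ (fun γ => mix (withMomentum (κ + Pi.single i 1) γ) g) z) z (dir i) := by
  rcases base_or_momentum i with ⟨h1, h2, h3⟩ | ⟨j, -, h1, h2, h3, h4⟩
  · exact ⟨A, by rwa [h2], fun Ω β g δ hΩ hδ hg hκ z hz =>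
      hA.hasLineDerivAt_mix rfl h1 h2 h3 hΩ hδ hg hκ hz⟩
  · obtain ⟨A', hA', h⟩ := hA.exists_deriv j
    refine ⟨A', by rwa [h2], fun Ω β g δ hΩ hδ hg hκ z hz => ?_⟩
    have hr := hg.reg hκ
    simp only [h2, h3] at hr ⊢
    rw [h1]
    refine h Ω _ δ hΩ hδ hr (fun _ hγ y hy => ?_) z hz
    rw [h4, ← h1]
    refine hg.hasMix.hasLineDerivAt (isOpen_cyl hΩ) ?_ hy
    rw [← h4]
    refine withMomentum_le (le_self_add.trans hκ) ?_
    have := momentumPart_le hκ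
    rw [h2] at this
    exact (add_le_add_left hγ _).trans this

/-- Induction on the number of derivatives, the outermost being peeled off. The representation holds
on the open set `dom`, so it may be differentiated there. -/
theorem IsCoeff.exists_op {F : (Phase → ℝ) → Phase → ℝ}
    {A₀ : ℝ → ((Fin 3 → ℕ) → Phase → ℝ) → Phase → ℝ} (hF : IsCoeff F A₀) (κ : Fin 7 → ℕ) :
    ∃ A, Op (momentumPart κ) A ∧ ∀ (Ω : Set (ℝ × R3)) (β : Fin 7 → ℕ) (g : Phase → ℝ) (δ : ℝ),
      IsOpen Ω → 0 < δ → Admissible Ω β g → κ ≤ β → ∀ z ∈ dom Ω δ,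
        mix κ (F g) z = A δ (fun γ => mix (withMomentum κ γ) g) z := by
  obtain ⟨n, hn⟩ : ∃ n, ∑ j, κ j = n := ⟨_, rfl⟩
  have hmz : momentumPart 0 = 0 := by
    funext k
    fin_cases k <;> rfl
  have hwz : withMomentum 0 0 = 0 := by
    funext k
    fin_cases k <;> rfl
  induction n generalizing κ with
  | zero =>
    have h0 : κ = 0 := by
      funext j
      exact (Finset.sum_eq_zero_iff.1 hn) j (Finset.mem_univ j)
    subst h0
    refine ⟨A₀, by rw [hmz]; exact hF.op, fun Ω β g δ hΩ hδ hg hκ z hz => ?_⟩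
    have hr := hg.reg hκ
    rw [hmz] at hr
    have h := hF.eq Ω _ δ hΩ hδ hr z hz
    rw [hwz, mix_zero] at h
    rw [mix_zero, h]
  | succ n ih =>
    have hne : κ ≠ 0 := by
      rintro rfl
      simp at hn
    obtain ⟨i, κ', rfl, hi⟩ := exists_first_index hne
    rw [sum_add_single] at hn
    obtain ⟨A, hA, h⟩ := ih κ' (by omega)
    obtain ⟨A', hA', h'⟩ := hA.exists_step i
    refine ⟨A', hA', fun Ω β g δ hΩ hδ hg hκ z hz => ?_⟩
    rw [mix_add_single fun j hj => by simpa using (Nat.add_eq_zero_iff.1 (hi j hj)).1, pd]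
    refine HasLineDerivAt.lineDeriv ((h' Ω β g δ hΩ hδ hg hκ z hz).congr_of_eventuallyEq ?_)
    filter_upwards [(isOpen_dom hΩ δ).mem_nhds hz] with y hy
    exact h Ω β g δ hΩ hδ hg (le_self_add.trans hκ) y hy

/-- The operator giving a derivative of a coefficient can be chosen to depend only on the momentum
part of the multi-index. -/
theorem IsCoeff.exists_op_of_momentumPart {F : (Phase → ℝ) → Phase → ℝ}
    {A₀ : ℝ → ((Fin 3 → ℕ) → Phase → ℝ) → Phase → ℝ} (hF : IsCoeff F A₀) (γ : Fin 3 → ℕ) :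
    ∃ A, Op γ A ∧ ∀ (Ω : Set (ℝ × R3)) (κ β : Fin 7 → ℕ) (g : Phase → ℝ) (δ : ℝ),
      momentumPart κ = γ → IsOpen Ω → 0 < δ → Admissible Ω β g → κ ≤ β → ∀ z ∈ dom Ω δ,
        mix κ (F g) z = A δ (fun γ => mix (withMomentum κ γ) g) z := by
  have hm : momentumPart (withMomentum 0 γ) = γ := by
    funext k
    fin_cases k <;> rfl
  -- The operator is fixed by the pure momentum derivative. As t and x derivatives are applied
  -- afterwards and leave it unchanged, the later constants are independent of m and β_x.
  obtain ⟨A, hA, h⟩ := hF.exists_op (withMomentum 0 γ)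
  rw [hm] at hA
  refine ⟨A, hA, fun Ω κ β g δ hκγ hΩ hδ hg hκ => ?_⟩
  obtain ⟨n, hn⟩ : ∃ n, ∑ j, κ j = n := ⟨_, rfl⟩
  induction n generalizing κ with
  | zero =>
    have h0 : κ = withMomentum 0 γ := by
      have h1 : κ = 0 := by
        funext j
        exact (Finset.sum_eq_zero_iff.1 hn) j (Finset.mem_univ j)
      rw [← hκγ, h1]
      funext k
      fin_cases k <;> rfl
    rw [h0] at hκ ⊢
    exact h Ω β g δ hΩ hδ hg hκ
  | succ n ih =>
    have hne : κ ≠ 0 := by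
      rintro rfl
      simp at hn
    obtain ⟨i, κ', rfl, hi⟩ := exists_first_index hne
    rw [sum_add_single] at hn
    rcases base_or_momentum i with ⟨h1, h2, h3⟩ | ⟨j, h4, -⟩
    · intro z hz
      rw [h2] at hκγ
      rw [mix_add_single fun j hj => by simpa using (Nat.add_eq_zero_iff.1 (hi j hj)).1, pd]
      refine HasLineDerivAt.lineDeriv ((hA.hasLineDerivAt_mix hκγ h1 h2 h3 hΩ hδ hg hκ
        hz).congr_of_eventuallyEq ?_)
      filter_upwards [(isOpen_dom hΩ δ).mem_nhds hz] with y hy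
      exact ih κ' hκγ (le_self_add.trans hκ) (by omega) y hy
    -- If the outermost derivative is in a momentum direction, no t or x derivative occurs at all.
    · set κ := κ' + Pi.single i 1
      have h0 : κ = withMomentum 0 γ := by
        have hlt (k : Fin 7) (hk : k < 4) := hi k (hk.trans_le h4)
        rw [← hκγ]
        funext k
        fin_cases k
        exacts [hlt 0 (by decide), hlt 1 (by decide), hlt 2 (by decide), hlt 3 (by decide),
          rfl, rfl, rfl]
      rw [h0] at hκ ⊢
      exact h Ω β g δ hΩ hδ hg hκ

/-- Existence and continuity are local, so δ may depend on the point; no decay of g in momentum is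
involved beyond domination. -/
theorem IsCoeff.hasMix {F : (Phase → ℝ) → Phase → ℝ}
    {A₀ : ℝ → ((Fin 3 → ℕ) → Phase → ℝ) → Phase → ℝ} (hF : IsCoeff F A₀) {Ω : Set (ℝ × R3)}
    (hΩ : IsOpen Ω) {β : Fin 7 → ℕ} {g : Phase → ℝ} (hg : Admissible Ω β g) :
    HasMix (cyl Ω) β (F g) := by
  intro κ hκ
  obtain ⟨A, hA, h⟩ := hF.exists_op κ
  refine ⟨fun z hz => ?_, fun i hi z hz => ?_⟩
  · obtain ⟨δ, hδ, hzδ⟩ := exists_mem_dom hz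
    have hU := (isOpen_dom hΩ δ).mem_nhds hzδ
    have h1 := (hA.continuousOn hΩ (hg.reg hκ) hδ).continuousAt hU
    refine (h1.congr ?_).continuousWithinAt
    filter_upwards [hU] with y hy
    exact (h Ω β g δ hΩ hδ hg hκ y hy).symm
  · obtain ⟨δ, hδ, hzδ⟩ := exists_mem_dom hz
    have hU := (isOpen_dom hΩ δ).mem_nhds hzδ
    obtain ⟨A', hA', h'⟩ := hA.exists_step i
    have hκi : κ + Pi.single i 1 ≤ β := by
      intro j
      rcases eq_or_ne j i with rfl | hj
      · simpa [Nat.succ_le_iff] using hi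
      · simpa [hj] using hκ j
    refine ((h' Ω β g δ hΩ hδ hg hκi z hzδ).congr_of_eventuallyEq ?_).lineDifferentiableAt
    filter_upwards [hU] with y hy
    exact h Ω β g δ hΩ hδ hg hκ y hy

/-! ### The coefficients as operators -/

theorem order_zero : order 0 = 0 := by simp [order]

/-- The kernel is written in two ways, as h times a bounded symbol and as a far symbol, and then
split by the cut-off and its complement. Identities are required off the diagonal only, which is a
null set. -/
theorem isCoeff_integral {K : R3 → R3 → ℝ} {w : ℝ → R3 → R3 → ℝ} (hw : Sym w) {f : R3 → R3 → ℝ}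
    (hf : FarSym f) (hK : ∀ p q, p ≠ q → K p q = hker 0 p q * w 0 p q)
    (hfw : ∀ p q, p ≠ q → f p q = hker 0 p q * w 0 p q) :
    IsCoeff (fun g z => ∫ q, K z.2.2 q * g (z.1, z.2.1, q))
      (fun δ G z => (∫ q, kern cutoff w 0 (order 0) δ 0 z.2.2 q * G 0 (z.1, z.2.1, q))
        + ∫ q, farKern f δ z.2.2 q * G 0 (z.1, z.2.1, q)) where
  op := (Op.near isCut_cutoff hw le_rfl (Nat.zero_le _)).add (Op.far hf)
  eq Ω G δ hΩ hδ hG z hz := by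
    have hu := hG.continuous_zero (t := z.1) (x := z.2.1) hz.1
    rw [← integral_add ((singKernel_kern isCut_cutoff hw 0 _ hδ).integrable le_rfl _ hu)
      (hf.integrable hG hδ hz)]
    refine integral_congr_ae ?_
    filter_upwards [ae_ne z.2.2] with q hq
    rw [hK _ _ hq, kern, farKern, hfw _ _ hq, order_zero]
    ring

theorem IsCoeff.add {F F' : (Phase → ℝ) → Phase → ℝ}
    {A A' : ℝ → ((Fin 3 → ℕ) → Phase → ℝ) → Phase → ℝ} (hF : IsCoeff F A) (hF' : IsCoeff F' A') :
    IsCoeff (fun g z => F g z + F' g z) (fun δ G z => A δ G z + A' δ G z) where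
  op := hF.op.add hF'.op
  eq Ω G δ hΩ hδ hG z hz := by
    rw [hF.eq Ω G δ hΩ hδ hG z hz, hF'.eq Ω G δ hΩ hδ hG z hz]

theorem isCoeff_kappa : IsCoeff (fun g z => kappa z.2.2 * g z)
    (fun _ G z => (2 : ℝ) ^ (7 / 2 : ℝ) * Real.pi * 2 * (1 / bracket z.2.2) * bracket z.2.2 ^ 0
      / bracket z.2.2 ^ order 0 * G 0 z) where
  op := Op.loc (w := fun _ p _ => (2 : ℝ) ^ (7 / 2 : ℝ) * Real.pi * 2 * (1 / bracket p))
    ((Sym.const _).mul .pinv) le_rfl (Nat.zero_le _)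
  eq Ω G δ hΩ hδ hG z hz := by
    rw [kappa_eq, order_zero]
    simp

theorem Lam_eq {p q : R3} (h : p ≠ q) :
    Lam p q = hker 0 p q / (bracket p * bracket q * (gam p q - 1)) := by
  have hγ := one_lt_gam h
  have h1 : 0 < gam p q - 1 := sub_pos.2 hγ
  have h2 : 0 < gam p q + 1 := by linarith
  have e : tau p q * (tau p q - 2) = (√(gam p q - 1) * √(gam p q + 1)) ^ 2 := by
    rw [mul_pow, Real.sq_sqrt h1.le, Real.sq_sqrt h2.le, tau_eq_gam]
    ring
  have hs := Real.sqrt_pos.2 h1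
  have hr := Real.sqrt_pos.2 h2
  have e2 : ((√(gam p q - 1) * √(gam p q + 1)) ^ 2) ^ (-(3 / 2) : ℝ)
      = ((√(gam p q - 1) * √(gam p q + 1)) ^ 3)⁻¹ := by
    rw [← Real.rpow_natCast, ← Real.rpow_mul (by positivity), ← Real.rpow_natCast,
      ← Real.rpow_neg (by positivity)]
    norm_num
  have hp := bracket_pos p
  have hq := bracket_pos q
  have e3 : bracket p * bracket q * (gam p q - 1)
      = bracket p * bracket q * √(gam p q - 1) ^ 2 := by rw [Real.sq_sqrt h1.le]
  rw [Lam, e, e2, e3, hker, tau_eq_gam, add_zero, add_sub_cancel_right]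
  field_simp

/-- With τ(τ-2) = γ² - 1, the left side is γ(γ²-1)^{-1/2}, and 1 + 1/γ supplies the ratio between
this and h(γ). -/
theorem cKernel_eq {p q : R3} (h : p ≠ q) :
    (tau p q - 1) / √(tau p q * (tau p q - 2)) = hker 0 p q * (1 + 1 / gam p q) := by
  have hγ := one_lt_gam h
  have h0 := gam_pos p q
  have h1 : 0 < gam p q - 1 := sub_pos.2 hγ
  have h2 : 0 < gam p q + 1 := by linarith
  have hs := Real.sqrt_pos.2 h1
  have hr := Real.sqrt_pos.2 h2
  have e : √(tau p q * (tau p q - 2)) = √(gam p q - 1) * √(gam p q + 1) := by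
    rw [← Real.sqrt_mul h1.le, tau_eq_gam]
    ring_nf
  rw [e, hker, tau_eq_gam, add_zero, add_sub_cancel_right]
  have e3 : 1 + 1 / gam p q = √(gam p q + 1) ^ 2 / gam p q := by
    rw [Real.sq_sqrt h2.le]
    field_simp
  rw [e3]
  field_simp

/-- By `Lam_eq` the factor Λ is h divided by ⟨p⟩⟨q⟩(γ-1). The matrix S vanishes to second order on
the diagonal and absorbs this: its first and last terms contain γ - 1, and the middle one becomes a
product of two normalised differences. -/
theorem exists_isCoeff_aCoeff (i j : Fin 3) : ∃ A, IsCoeff (aCoeff i j) A := by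
  set c : ℝ := if i = j then 1 else 0 with hc
  refine ⟨_, isCoeff_integral (K := Phi i j)
    (w := fun ε p q => c * (gam p q / (bracket p * bracket q) + 1 / bracket p * (1 / bracket q))
      - (p i - q i) / den ε p q * ((p j - q j) / den ε p q)
      + (p i / bracket p * (q j / bracket q) + p j / bracket p * (q i / bracket q)))
    (f := fun p q => hker 0 p q *
      (c * (1 / bracket p * (gam p q / bracket q) + 1 / bracket p * (1 / bracket q))
      - 1 / bracket p * ((p i * (1 / bracket q) - q i / bracket q)
        * ((p j * (1 / bracket q) - q j / bracket q) * (bracket q / (gam p q - 1))))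
      + (p i * (1 / bracket p) * (q j / bracket q) + p j * (1 / bracket p) * (q i / bracket q))))
    ?_ ?_ (fun p q h => ?_) (fun p q h => ?_)⟩
  · exact ((((Sym.const c).mul (Sym.gamma.add (Sym.pinv.mul .qinv))).sub
      ((Sym.dspace i).mul (.dspace j))).add
      (((Sym.pdir i).mul (.qdir j)).add ((Sym.pdir j).mul (.qdir i))))
  · exact FarSym.hker.mul ((((FarSym.const c).mul ((FarSym.pinv.mul .gamma).add
      (FarSym.pinv.mul .qinv))).sub (FarSym.pinv.mul ((((FarSym.pcoord i).mul .qinv).sub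
      (.qdir i)).mul ((((FarSym.pcoord j).mul .qinv).sub (.qdir j)).mul .gammaSubInv)))).add
      ((((FarSym.pcoord i).mul .pinv).mul (.qdir j)).add
        (((FarSym.pcoord j).mul .pinv).mul (.qdir i))))
  all_goals
    have hγ := one_lt_gam h
    have h1 : gam p q - 1 ≠ 0 := (sub_pos.2 hγ).ne'
    have hp := bracket_ne_zero p
    have hq := bracket_ne_zero q
    have hd := den_sq (ε := 0) (p := p) (q := q) (by linarith)
    have e : (p i - q i) / den 0 p q * ((p j - q j) / den 0 p q)
        = (p i - q i) * (p j - q j) / ((gam p q - 1) * (bracket p * bracket q)) := by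
      rw [div_mul_div_comm, ← sq, hd, add_zero]
    rw [e]
  · rw [Phi, Lam_eq h, Smat, tau_eq_gam, ← hc]
    field_simp
    ring
  · field_simp

/-- The factor τ - 2 = γ - 1 cancels the extra singularity of Λ, and (p_j+q_j)/(⟨p⟩⟨q⟩) is a bounded
symbol; b therefore obeys the same bounds as a. -/
theorem exists_isCoeff_bCoeff (j : Fin 3) : ∃ A, IsCoeff (bCoeff j) A := by
  have hF : bCoeff j = fun g z => ∫ q : R3,
      2 * (Lam z.2.2 q * (tau z.2.2 q - 2) * (z.2.2 j + q j)) * g (z.1, z.2.1, q) := by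
    funext g z
    rw [bCoeff, ← integral_const_mul]
    simp only [mul_assoc]
  rw [hF]
  refine ⟨_, isCoeff_integral (K := fun p q => 2 * (Lam p q * (tau p q - 2) * (p j + q j)))
    (w := fun _ p q => 2 * (p j / bracket p * (1 / bracket q) + 1 / bracket p * (q j / bracket q)))
    (f := fun p q => hker 0 p q * (2 * (p j * (1 / bracket p) * (1 / bracket q)
      + 1 / bracket p * (q j / bracket q)))) ?_ ?_ (fun p q h => ?_) (fun p q h => ?_)⟩
  · exact (Sym.const 2).mul (((Sym.pdir j).mul .qinv).add (Sym.pinv.mul (.qdir j)))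
  · exact FarSym.hker.mul ((FarSym.const 2).mul ((((FarSym.pcoord j).mul .pinv).mul .qinv).add
      (FarSym.pinv.mul (.qdir j))))
  all_goals
    have h1 : gam p q - 1 ≠ 0 := (sub_pos.2 (one_lt_gam h)).ne'
    have hp := bracket_ne_zero p
    have hq := bracket_ne_zero q
  · rw [Lam_eq h, tau_eq_gam]
    field_simp
    ring
  · field_simp

theorem exists_isCoeff_cCoeff : ∃ A, IsCoeff cCoeff A := by
  have hF : cCoeff = fun g z => (∫ q : R3,
      4 * (1 / (bracket z.2.2 * bracket q)
        * ((tau z.2.2 q - 1) / √(tau z.2.2 q * (tau z.2.2 q - 2)))) * g (z.1, z.2.1, q))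
      + kappa z.2.2 * g z := by
    funext g z
    rw [cCoeff, ← integral_const_mul]
    simp only [mul_assoc]
  rw [hF]
  refine ⟨_, (isCoeff_integral (K := fun p q => 4 * (1 / (bracket p * bracket q)
        * ((tau p q - 1) / √(tau p q * (tau p q - 2)))))
    (w := fun _ p q => 4 * (1 / bracket p * (1 / bracket q) * (1 + 1 / gam p q)))
    (f := fun p q => hker 0 p q * (4 * (1 / bracket p * (1 / bracket q)
      * (1 + bracket q / gam p q * (1 / bracket q)))))
    ?_ ?_ (fun p q h => ?_) (fun p q h => ?_)).add isCoeff_kappa⟩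
  · exact (Sym.const 4).mul ((Sym.pinv.mul .qinv).mul ((Sym.const 1).add .gammaInv))
  · exact FarSym.hker.mul ((FarSym.const 4).mul ((FarSym.pinv.mul .qinv).mul
      ((FarSym.const 1).add (FarSym.gammaInv.mul .qinv))))
  all_goals
    have h0 := (gam_pos p q).ne'
    have hp := bracket_ne_zero p
    have hq := bracket_ne_zero q
  · rw [cKernel_eq h]
    field_simp
  · field_simp

/-! ### Bounds for derivatives of the coefficients -/

theorem HasMixedDerivs.admissible {Ω : Set (ℝ × R3)} {m : ℕ} {βx βp : Fin 3 → ℕ} {g : Phase → ℝ}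
    (h : HasMixedDerivs (cyl Ω) m βx βp g) (h' : LocallyDominated Ω m βx g) :
    Admissible Ω (idx m βx βp) g where
  hasMix := h.hasMix
  dominated κ hκ := by
    refine h' (κ 0) (hκ 0) ![κ 1, κ 2, κ 3] fun i => ?_
    fin_cases i
    exacts [hκ 1, hκ 2, hκ 3]

theorem momentumPart_idx (m : ℕ) (γx γp : Fin 3 → ℕ) : momentumPart (idx m γx γp) = γp := by
  funext k
  fin_cases k <;> rfl

theorem IsCoeff.hasMixedDerivs {F : (Phase → ℝ) → Phase → ℝ}
    {A₀ : ℝ → ((Fin 3 → ℕ) → Phase → ℝ) → Phase → ℝ} (hF : IsCoeff F A₀) {Ω : Set (ℝ × R3)}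
    (hΩ : IsOpen Ω) {m : ℕ} {βx βp : Fin 3 → ℕ} {g : Phase → ℝ}
    (hg : HasMixedDerivs (cyl Ω) m βx βp g) (hg' : LocallyDominated Ω m βx g) :
    HasMixedDerivs (cyl Ω) m βx βp (F g) :=
  (hF.hasMix hΩ (hg.admissible hg')).hasMixedDerivs

theorem le_of_order_eq {γ : Fin 3 → ℕ} {n : ℕ} (h : order γ = n) : γ ≤ fun _ => n := by
  intro i
  rw [← h]
  exact Finset.single_le_sum (f := γ) (fun _ _ => Nat.zero_le _) (Finset.mem_univ i)

/-- A constant valid for all multi-indices of a given order. -/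
theorem exists_forall_order_eq {P : (Fin 3 → ℕ) → ℝ → Prop} (n : ℕ)
    (hP : ∀ γ C C', C ≤ C' → P γ C → P γ C') (h : ∀ γ, order γ = n → ∃ C, 0 ≤ C ∧ P γ C) :
    ∃ C, 0 ≤ C ∧ ∀ γ, order γ = n → P γ C := by
  have h' (γ : Fin 3 → ℕ) : ∃ C, 0 ≤ C ∧ (order γ = n → P γ C) := by
    by_cases hγ : order γ = n
    · obtain ⟨C, hC, hb⟩ := h γ hγ
      exact ⟨C, hC, fun _ => hb⟩
    · exact ⟨0, le_rfl, fun h => absurd h hγ⟩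
  choose C hC hb using h'
  refine ⟨∑ γ ∈ Finset.Iic fun _ => n, C γ, Finset.sum_nonneg fun γ _ => hC γ, fun γ hγ => ?_⟩
  exact hP _ _ _ (Finset.single_le_sum (f := C) (fun γ _ => hC γ)
    (Finset.mem_Iic.2 (le_of_order_eq hγ))) (hb γ hγ)

theorem mem_dom_of_le {Ω : Set (ℝ × R3)} {δ δ₀ : ℝ} {z : Phase} (hz : z ∈ dom Ω δ₀)
    (h : δ ≤ δ₀) : z ∈ dom Ω δ := by
  refine ⟨hz.1, lt_of_le_of_lt ?_ hz.2⟩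
  gcongr

/-- Pointwise bounds for a coefficient, with explicit dependence on the constant in the decay. -/
theorem IsCoeff.exists_pointwise {F : (Phase → ℝ) → Phase → ℝ}
    {A₀ : ℝ → ((Fin 3 → ℕ) → Phase → ℝ) → Phase → ℝ} (hF : IsCoeff F A₀) (n : ℕ) {k : ℝ}
    (hk : 9 + (n : ℝ) < k) : ∃ C, 0 ≤ C ∧ ∀ βp, order βp = n →
      ∀ (Ω : Set (ℝ × R3)) (m : ℕ) (βx : Fin 3 → ℕ) (g : Phase → ℝ) (Ck : ℝ), 0 ≤ Ck →
        IsOpen Ω → HasMixedDerivs (cyl Ω) m βx βp g → LocallyDominated Ω m βx g →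
        (∀ γ ≤ βp, ∀ z ∈ cyl Ω, |mixed m βx γ g z| ≤ Ck * bracket z.2.2 ^ (-k)) →
        ∀ z ∈ cyl Ω, |mixed m βx βp (F g) z| ≤ C * Ck * bracket z.2.2 ^ (-(n : ℝ)) := by
  refine exists_forall_order_eq n (fun γ C C' hCC h Ω m βx g Ck hCk hΩ hg hg' hd z hz =>
    (h Ω m βx g Ck hCk hΩ hg hg' hd z hz).trans ?_) fun γ hγ => ?_
  · have := Real.rpow_pos_of_pos (bracket_pos z.2.2) (-(n : ℝ))
    gcongr
  obtain ⟨A, hA, h⟩ := hF.exists_op_of_momentumPart γ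
  obtain ⟨C, hC, hb⟩ := hA.exists_pointwise (k := k) (by rwa [hγ])
  refine ⟨C, hC, fun Ω m βx g Ck hCk hΩ hg hg' hd z hz => ?_⟩
  have hadm := hg.admissible hg'
  have hreg := hadm.reg le_rfl
  rw [momentumPart_idx] at hreg
  obtain ⟨B, hB, hb⟩ := hb Ω _ Ck hCk hreg (fun γ' hγ' => hd γ' hγ') z hz
  obtain ⟨δ₀, hδ₀, hzδ⟩ := exists_mem_dom hz
  have hlim : Tendsto (fun δ => C * Ck / bracket z.2.2 ^ order γ + B δ) (𝓝[>] 0)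
      (𝓝 (C * Ck / bracket z.2.2 ^ order γ)) := by
    simpa using hB.const_add (C * Ck / bracket z.2.2 ^ order γ)
  rw [Real.rpow_neg (bracket_pos _).le, Real.rpow_natCast, ← div_eq_mul_inv, ← hγ]
  -- The derivative does not depend on δ, while the error tends to 0 with δ.
  refine ge_of_tendsto hlim ?_
  filter_upwards [Ioo_mem_nhdsGT hδ₀] with δ hδ
  have e := h Ω _ _ g δ (momentumPart_idx m βx γ) hΩ hδ.1 hadm le_rfl z
    (mem_dom_of_le hzδ hδ.2.le)
  rw [mix_idx] at e
  rw [e]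
  exact hb δ hδ.1

/-- Local Hölder bounds for a coefficient. -/
theorem IsCoeff.exists_holder {F : (Phase → ℝ) → Phase → ℝ}
    {A₀ : ℝ → ((Fin 3 → ℕ) → Phase → ℝ) → Phase → ℝ} (hF : IsCoeff F A₀) (n : ℕ) {α ℓ : ℝ}
    (hα : 0 < α) (hα1 : α < 1) (hℓ : 9 + (n : ℝ) < ℓ) : ∃ C, 0 ≤ C ∧ ∀ βp, order βp = n →
      ∀ (Ω : Set (ℝ × R3)) (m : ℕ) (βx : Fin 3 → ℕ) (g : Phase → ℝ) (M : ℝ), 0 ≤ M →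
        IsOpen Ω → HasMixedDerivs (cyl Ω) m βx βp g → LocallyDominated Ω m βx g →
        (∀ γ ≤ βp, HolderBound Ω α ℓ M (mixed m βx γ g)) →
        ∀ z ∈ cyl Ω, ∀ z' ∈ cyl Ω, distL z z' ≤ 1 / 4 →
          |mixed m βx βp (F g) z - mixed m βx βp (F g) z'|
            ≤ C * M * bracket z'.2.2 ^ (α / 2 - n) * distL z z' ^ (2 * α / 3) := by
  refine exists_forall_order_eq n (fun γ C C' hCC h Ω m βx g M hM hΩ hg hg' hd z hz z' hz' hzz =>
    (h Ω m βx g M hM hΩ hg hg' hd z hz z' hz' hzz).trans ?_) fun γ hγ => ?_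
  · have := Real.rpow_pos_of_pos (bracket_pos z'.2.2) (α / 2 - n)
    have := Real.rpow_nonneg (distL_nonneg z z') (2 * α / 3)
    gcongr
  obtain ⟨A, hA, h⟩ := hF.exists_op_of_momentumPart γ
  obtain ⟨C, hC, hb⟩ := hA.exists_holder hα hα1 (by rwa [hγ])
  refine ⟨C, hC, fun Ω m βx g M hM hΩ hg hg' hd z hz z' hz' hzz => ?_⟩
  have hadm := hg.admissible hg'
  have hreg := hadm.reg le_rfl
  rw [momentumPart_idx] at hreg
  obtain ⟨B, hB, hb⟩ := hb Ω _ M hM hreg (fun γ' hγ' => hd γ' hγ') z hz z' hz' hzz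
  obtain ⟨δ₀, hδ₀, hzδ⟩ := exists_mem_dom hz
  obtain ⟨δ₁, hδ₁, hzδ'⟩ := exists_mem_dom hz'
  rw [Real.rpow_sub (bracket_pos _), Real.rpow_natCast, ← hγ]
  set K := C * M * (bracket z'.2.2 ^ (α / 2) / bracket z'.2.2 ^ order γ)
    * distL z z' ^ (2 * α / 3)
  have hlim : Tendsto (fun δ => K + B δ) (𝓝[>] 0) (𝓝 K) := by simpa using hB.const_add K
  refine ge_of_tendsto hlim ?_
  filter_upwards [Ioo_mem_nhdsGT hδ₀, Ioo_mem_nhdsGT hδ₁] with δ hδ hδ'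
  have e (z : Phase) (hz : z ∈ dom Ω δ) :=
    h Ω _ _ g δ (momentumPart_idx m βx γ) hΩ hδ.1 hadm le_rfl z hz
  simp only [mix_idx] at e
  rw [e z (mem_dom_of_le hzδ hδ.2.le), e z' (mem_dom_of_le hzδ' hδ'.2.le)]
  exact hb δ hδ.1

/-! ### Hölder norms -/

theorem holderBound_of_holderNorm_le {Ω : Set (ℝ × R3)} {α ℓ M : ℝ} {u : Phase → ℝ}
    (hM : 0 ≤ M) (h : holderNorm α (cyl Ω) (weighted ℓ u) ≤ ENNReal.ofReal M) :
    HolderBound Ω α ℓ M u where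
  sup z hz := by
    refine (ENNReal.ofReal_le_ofReal_iff hM).1 (le_trans ?_ (le_add_self.trans h))
    exact le_iSup₂ (f := fun z (_ : z ∈ cyl Ω) => ENNReal.ofReal |weighted ℓ u z|) z hz
  diff z hz z' hz' := by
    rcases (distL_nonneg z z').eq_or_lt with hd | hd
    · rw [eq_of_distL_eq_zero hd.symm, sub_self, abs_zero]
      exact mul_nonneg hM (Real.rpow_nonneg (distL_nonneg _ _) _)
    · rw [← div_le_iff₀ (Real.rpow_pos_of_pos hd α)]
      refine (ENNReal.ofReal_le_ofReal_iff hM).1 (le_trans ?_ (le_self_add.trans h))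
      refine le_trans ?_ (le_iSup₂ (f := fun z (_ : z ∈ cyl Ω) => ⨆ z₀ ∈ cyl Ω,
        ENNReal.ofReal (|weighted ℓ u z - weighted ℓ u z₀| / distL z z₀ ^ α)) z hz)
      exact le_iSup₂ (f := fun z₀ (_ : z₀ ∈ cyl Ω) =>
        ENNReal.ofReal (|weighted ℓ u z - weighted ℓ u z₀| / distL z z₀ ^ α)) z' hz'

theorem HolderBound.holderNorm_le {Ω : Set (ℝ × R3)} {α s M : ℝ} {u : Phase → ℝ}
    (h : HolderBound Ω α s M u) (hM : 0 ≤ M) :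
    holderNorm α (cyl Ω) (weighted s u) ≤ ENNReal.ofReal (2 * M) := by
  rw [two_mul, ENNReal.ofReal_add hM hM]
  refine add_le_add (iSup₂_le fun z hz => iSup₂_le fun z' hz' => ENNReal.ofReal_le_ofReal ?_)
    (iSup₂_le fun z hz => ENNReal.ofReal_le_ofReal (h.sup z hz))
  exact div_le_of_le_mul₀ (Real.rpow_nonneg (distL_nonneg _ _) _) hM (h.diff z hz z' hz')

/-- A weighted Hölder bound from a sup bound and a bound for differences at small distance. -/
theorem exists_holderBound (n : ℕ) {α s : ℝ} (hα : 0 < α) (hα1 : α < 1) (hs : s ≤ -(α / 2)) :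
    ∃ K, 0 ≤ K ∧ ∀ (Ω : Set (ℝ × R3)) (u : Phase → ℝ) (M : ℝ), 0 ≤ M →
      (∀ z ∈ cyl Ω, |u z| ≤ M * bracket z.2.2 ^ (-(n : ℝ))) →
      (∀ z ∈ cyl Ω, ∀ z' ∈ cyl Ω, distL z z' ≤ 1 / 4 → |u z - u z'|
        ≤ M * bracket z'.2.2 ^ (α / 2 - n) * distL z z' ^ (2 * α / 3)) →
      HolderBound Ω (2 * α / 3) s (K * M) u := by
  obtain ⟨C₁, hC₁, hb₁⟩ := exists_bracket_rpow_le s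
  obtain ⟨C₂, hC₂, hb₂⟩ := exists_bracket_rpow_sub_le s
  refine ⟨C₁ + 2 * C₂ + 8, by positivity, fun Ω u M hM hsup hdiff => ?_⟩
  have hn : (0 : ℝ) ≤ n := Nat.cast_nonneg n
  have hle1 (p : R3) {x : ℝ} (hx : x ≤ 0) : bracket p ^ x ≤ 1 :=
    Real.rpow_le_one_of_one_le_of_nonpos (one_le_bracket p) hx
  have hsup' : ∀ z ∈ cyl Ω, |weighted s u z| ≤ M := by
    intro z hz
    have hp := Real.rpow_pos_of_pos (bracket_pos z.2.2) s
    rw [weighted, abs_mul, abs_of_pos hp]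
    calc _ ≤ bracket z.2.2 ^ s * (M * bracket z.2.2 ^ (-(n : ℝ))) := by
          have := hsup z hz
          gcongr
      _ = M * bracket z.2.2 ^ (s + -(n : ℝ)) := by
          rw [Real.rpow_add (bracket_pos _)]
          ring
      _ ≤ M * 1 := by
          gcongr
          exact hle1 _ (by linarith)
      _ = M := mul_one M
  refine ⟨fun z hz => (hsup' z hz).trans (le_mul_of_one_le_left hM (by linarith)),
    fun z hz z' hz' => ?_⟩
  have hd0 := distL_nonneg z z'
  set d := distL z z'
  set D := d ^ (2 * α / 3) with hD
  have hD0 : 0 ≤ D := Real.rpow_nonneg hd0 _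
  rcases le_or_gt d (1 / 4) with hd | hd
  · have hb := bracket_pos z'.2.2
    have hdD : d ≤ D := by
      nth_rw 1 [← Real.rpow_one d]
      exact rpow_le_rpow_of_le_one hd0 (by linarith) (by positivity) (by linarith)
    have hm := norm_momentum_sub_le_distL z z'
    have hpp : ‖z.2.2 - z'.2.2‖ ≤ bracket z'.2.2 / 2 := by
      have h2 := mul_le_mul_of_nonneg_left hd hb.le
      linarith
    have hpp' : ‖z.2.2 - z'.2.2‖ / bracket z'.2.2 ≤ 2 * D := by
      rw [div_le_iff₀ hb]
      have h2 := mul_le_mul_of_nonneg_left hdD hb.le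
      linarith
    have e : weighted s u z - weighted s u z' = bracket z.2.2 ^ s * (u z - u z')
        + (bracket z.2.2 ^ s - bracket z'.2.2 ^ s) * u z' := by
      unfold weighted
      ring
    -- Here s ≤ -α/2 absorbs the growth ⟨p'⟩^{α/2} left by the change of frame.
    have e1 : |bracket z.2.2 ^ s * (u z - u z')| ≤ C₁ * M * D := by
      rw [abs_mul, abs_of_pos (Real.rpow_pos_of_pos (bracket_pos _) _)]
      calc _ ≤ (C₁ * bracket z'.2.2 ^ s) * (M * bracket z'.2.2 ^ (α / 2 - n) * D) :=
            mul_le_mul (hb₁ _ _ hpp) (hdiff z hz z' hz' hd) (abs_nonneg _) (by positivity)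
        _ = C₁ * M * D * bracket z'.2.2 ^ (s + (α / 2 - n)) := by
            rw [Real.rpow_add hb]
            ring
        _ ≤ C₁ * M * D * 1 := by
            gcongr
            exact hle1 _ (by linarith)
        _ = _ := mul_one _
    have e2 : |(bracket z.2.2 ^ s - bracket z'.2.2 ^ s) * u z'| ≤ 2 * C₂ * M * D := by
      rw [abs_mul]
      calc _ ≤ (C₂ * bracket z'.2.2 ^ s * (2 * D)) * |u z'| := by
            gcongr
            exact (hb₂ _ _ hpp).trans (by gcongr)
        _ = 2 * C₂ * D * |weighted s u z'| := by
            rw [weighted, abs_mul, abs_of_pos (Real.rpow_pos_of_pos hb s)]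
            ring
        _ ≤ 2 * C₂ * D * M := by
            have := hsup' z' hz'
            gcongr
        _ = _ := by ring
    rw [e]
    refine (abs_add_le _ _).trans ((add_le_add e1 e2).trans ?_)
    have : 0 ≤ M * D := by positivity
    linarith
  -- At distance above 1/4 the sup bound suffices: 2M = 8M·(1/4) ≤ 8MD, which explains the 8 in the
  -- constant.
  · have hD4 : 1 / 4 ≤ D := by
      calc (1 / 4 : ℝ) = (1 / 4) ^ (1 : ℝ) := (Real.rpow_one _).symm
        _ ≤ (1 / 4) ^ (2 * α / 3) :=
            Real.rpow_le_rpow_of_exponent_ge (by norm_num) (by norm_num) (by linarith)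
        _ ≤ D := Real.rpow_le_rpow (by norm_num) hd.le (by positivity)
    have h1 := hsup' z hz
    have h2 := hsup' z' hz'
    have h3 := abs_sub (weighted s u z) (weighted s u z')
    calc _ ≤ 8 * M * (1 / 4) := by linarith
      _ ≤ 8 * M * D := by gcongr
      _ ≤ _ := by gcongr; linarith

/-- The sup part of the hypothesis is a decay of order ℓ and feeds the pointwise bound with k = ℓ;
the seminorm feeds the bound for differences at small distance. -/
theorem IsCoeff.exists_holderNorm_le {F : (Phase → ℝ) → Phase → ℝ}
    {A₀ : ℝ → ((Fin 3 → ℕ) → Phase → ℝ) → Phase → ℝ} (hF : IsCoeff F A₀) (n : ℕ) {α ℓ s Cl : ℝ}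
    (hα : 0 < α) (hα1 : α < 1) (hℓ : 9 + (n : ℝ) < ℓ) (hs : s ≤ -(α / 2)) (hCl : 0 ≤ Cl) :
    ∃ C, 0 ≤ C ∧ ∀ (Ω : Set (ℝ × R3)) (m : ℕ) (βx βp : Fin 3 → ℕ) (g : Phase → ℝ),
        IsOpen Ω → order βp = n → HasMixedDerivs (cyl Ω) m βx βp g → LocallyDominated Ω m βx g →
        (∀ γ ≤ βp, holderNorm α (cyl Ω) (weighted ℓ (mixed m βx γ g)) ≤ ENNReal.ofReal Cl) →
        holderNorm (2 * α / 3) (cyl Ω) (weighted s (mixed m βx βp (F g))) ≤ ENNReal.ofReal C := by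
  obtain ⟨C₁, hC₁, hb₁⟩ := hF.exists_pointwise n hℓ
  obtain ⟨C₂, hC₂, hb₂⟩ := hF.exists_holder n hα hα1 hℓ
  obtain ⟨K, hK, hb⟩ := exists_holderBound n hα hα1 hs
  refine ⟨2 * (K * ((C₁ + C₂) * Cl)), by positivity, fun Ω m βx βp g hΩ hβ hg hg' hd => ?_⟩
  have hd' : ∀ γ ≤ βp, HolderBound Ω α ℓ Cl (mixed m βx γ g) :=
    fun γ hγ => holderBound_of_holderNorm_le hCl (hd γ hγ)
  refine HolderBound.holderNorm_le (hb Ω _ _ (by positivity) (fun z hz => ?_)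
    fun z hz z' hz' hzz => ?_) (by positivity)
  · refine (hb₁ βp hβ Ω m βx g Cl hCl hΩ hg hg' (fun γ hγ z hz => (hd' γ hγ).abs_le hz) z
      hz).trans ?_
    have := Real.rpow_pos_of_pos (bracket_pos z.2.2) (-(n : ℝ))
    gcongr
    linarith
  · refine (hb₂ βp hβ Ω m βx g Cl hCl hΩ hg hg' hd' z hz z' hz' hzz).trans ?_
    have := Real.rpow_pos_of_pos (bracket_pos z'.2.2) (α / 2 - n)
    have := Real.rpow_nonneg (distL_nonneg z z') (2 * α / 3)
    gcongr
    linarith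

end RelLandau

open RelLandau in
theorem proposition7p8 :
    -- pointwise bounds; `C` depends only on `n = |βp|`, `k` and `Ck`
    (∀ (n : ℕ) (k Ck : ℝ), 9 + (n : ℝ) < k → 0 < Ck →
      ∃ C : ℝ, 0 < C ∧
        ∀ (Ω : Set (ℝ × R3)) (m : ℕ) (βx βp : Fin 3 → ℕ) (g : Phase → ℝ),
          IsOpen Ω → order βp = n →
          HasMixedDerivs (cyl Ω) m βx βp g →
          LocallyDominated Ω m βx g →
          (∀ γ ≤ βp, ∀ z ∈ cyl Ω, |mixed m βx γ g z| ≤ Ck * bracket z.2.2 ^ (-k)) →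
            (∀ i j, HasMixedDerivs (cyl Ω) m βx βp (aCoeff i j g) ∧
              ∀ z ∈ cyl Ω,
                |mixed m βx βp (aCoeff i j g) z| ≤ C * bracket z.2.2 ^ (-(n : ℝ))) ∧
            (∀ j, HasMixedDerivs (cyl Ω) m βx βp (bCoeff j g) ∧
              ∀ z ∈ cyl Ω,
                |mixed m βx βp (bCoeff j g) z| ≤ C * bracket z.2.2 ^ (1 - (n : ℝ))) ∧
            (HasMixedDerivs (cyl Ω) m βx βp (cCoeff g) ∧
              ∀ z ∈ cyl Ω,
                |mixed m βx βp (cCoeff g) z| ≤ C * bracket z.2.2 ^ (-(n : ℝ)))) ∧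
    -- Hölder bounds; `C` depends only on `n = |βp|`, `α`, `ℓ` and `Cl`
    (∀ (n : ℕ) (α ℓ Cl : ℝ), 0 < α → α < 1 → 10 + max (n : ℝ) (α / 2) < ℓ → 0 < Cl →
      ∃ C : ℝ, 0 < C ∧
        ∀ (Ω : Set (ℝ × R3)) (m : ℕ) (βx βp : Fin 3 → ℕ) (g : Phase → ℝ),
          IsOpen Ω → order βp = n →
          HasMixedDerivs (cyl Ω) m βx βp g →
          LocallyDominated Ω m βx g →
          (∀ γ ≤ βp,
            holderNorm α (cyl Ω) (weighted ℓ (mixed m βx γ g)) ≤ ENNReal.ofReal Cl) →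
            (∀ i j, holderNorm (2 * α / 3) (cyl Ω)
              (weighted (min (-α) ((n : ℝ) - 1)) (mixed m βx βp (aCoeff i j g)))
                ≤ ENNReal.ofReal C) ∧
            (∀ j, holderNorm (2 * α / 3) (cyl Ω)
              (weighted (-1 + min (-α) ((n : ℝ) - 1)) (mixed m βx βp (bCoeff j g)))
                ≤ ENNReal.ofReal C) ∧
            holderNorm (2 * α / 3) (cyl Ω)
              (weighted (min (-α) ((n : ℝ) - 1)) (mixed m βx βp (cCoeff g)))
                ≤ ENNReal.ofReal C) := by
  choose Aa ha using exists_isCoeff_aCoeff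
  choose Ab hb using exists_isCoeff_bCoeff
  obtain ⟨Ac, hc⟩ := exists_isCoeff_cCoeff
  refine ⟨fun n k Ck hk hCk => ?_, fun n α ℓ Cl hα hα1 hℓ hCl => ?_⟩
  · choose Ka hKa hba using fun i j => (ha i j).exists_pointwise n hk
    choose Kb hKb hbb using fun j => (hb j).exists_pointwise n hk
    obtain ⟨Kc, hKc, hbc⟩ := hc.exists_pointwise n hk
    have hSa : 0 ≤ ∑ i, ∑ j, Ka i j :=
      Finset.sum_nonneg fun i _ => Finset.sum_nonneg fun j _ => hKa i j
    have hSb : 0 ≤ ∑ j, Kb j := Finset.sum_nonneg fun j _ => hKb j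
    have hla (i j : Fin 3) : Ka i j ≤ ∑ i, ∑ j, Ka i j :=
      (Finset.single_le_sum (f := Ka i) (fun j _ => hKa i j) (Finset.mem_univ j)).trans
        (Finset.single_le_sum (f := fun i => ∑ j, Ka i j)
          (fun i _ => Finset.sum_nonneg fun j _ => hKa i j) (Finset.mem_univ i))
    have hlb (j : Fin 3) : Kb j ≤ ∑ j, Kb j :=
      Finset.single_le_sum (f := Kb) (fun j _ => hKb j) (Finset.mem_univ j)
    refine ⟨((∑ i, ∑ j, Ka i j) + (∑ j, Kb j) + Kc + 1) * Ck, by positivity,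
      fun Ω m βx βp g hΩ hβ hg hg' hd => ⟨fun i j => ⟨(ha i j).hasMixedDerivs hΩ hg hg',
        fun z hz => ?_⟩, fun j => ⟨(hb j).hasMixedDerivs hΩ hg hg', fun z hz => ?_⟩,
        hc.hasMixedDerivs hΩ hg hg', fun z hz => ?_⟩⟩
    · refine (hba i j βp hβ Ω m βx g Ck hCk.le hΩ hg hg' hd z hz).trans ?_
      have := Real.rpow_pos_of_pos (bracket_pos z.2.2) (-(n : ℝ))
      gcongr
      linarith [hla i j]
    · refine (hbb j βp hβ Ω m βx g Ck hCk.le hΩ hg hg' hd z hz).trans ?_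
      have h1 := Real.rpow_pos_of_pos (bracket_pos z.2.2) (-(n : ℝ))
      -- The estimate obtained for b has the exponent -n and is weakened to 1 - n.
      have h2 : bracket z.2.2 ^ (-(n : ℝ)) ≤ bracket z.2.2 ^ (1 - (n : ℝ)) :=
        Real.rpow_le_rpow_of_exponent_le (one_le_bracket _) (by linarith)
      gcongr
      linarith [hlb j]
    · refine (hbc βp hβ Ω m βx g Ck hCk.le hΩ hg hg' hd z hz).trans ?_
      have := Real.rpow_pos_of_pos (bracket_pos z.2.2) (-(n : ℝ))
      gcongr
      linarith
  · have hℓ' : 9 + (n : ℝ) < ℓ := by linarith [le_max_left (n : ℝ) (α / 2)]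
    -- The exponents of the weights enter only through the bound s ≤ -α/2.
    have hs : min (-α) ((n : ℝ) - 1) ≤ -(α / 2) := (min_le_left _ _).trans (by linarith)
    have hs' : -1 + min (-α) ((n : ℝ) - 1) ≤ -(α / 2) := by linarith
    choose Ka hKa hba using fun i j => (ha i j).exists_holderNorm_le n hα hα1 hℓ' hs hCl.le
    choose Kb hKb hbb using fun j => (hb j).exists_holderNorm_le n hα hα1 hℓ' hs' hCl.le
    obtain ⟨Kc, hKc, hbc⟩ := hc.exists_holderNorm_le n hα hα1 hℓ' hs hCl.le
    have hSa : 0 ≤ ∑ i, ∑ j, Ka i j :=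
      Finset.sum_nonneg fun i _ => Finset.sum_nonneg fun j _ => hKa i j
    have hSb : 0 ≤ ∑ j, Kb j := Finset.sum_nonneg fun j _ => hKb j
    have hla (i j : Fin 3) : Ka i j ≤ ∑ i, ∑ j, Ka i j :=
      (Finset.single_le_sum (f := Ka i) (fun j _ => hKa i j) (Finset.mem_univ j)).trans
        (Finset.single_le_sum (f := fun i => ∑ j, Ka i j)
          (fun i _ => Finset.sum_nonneg fun j _ => hKa i j) (Finset.mem_univ i))
    have hlb (j : Fin 3) : Kb j ≤ ∑ j, Kb j :=
      Finset.single_le_sum (f := Kb) (fun j _ => hKb j) (Finset.mem_univ j)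
    refine ⟨(∑ i, ∑ j, Ka i j) + (∑ j, Kb j) + Kc + 1, by positivity,
      fun Ω m βx βp g hΩ hβ hg hg' hd => ⟨fun i j => ?_, fun j => ?_, ?_⟩⟩
    · exact (hba i j Ω m βx βp g hΩ hβ hg hg' hd).trans
        (ENNReal.ofReal_le_ofReal (by linarith [hla i j]))
    · exact (hbb j Ω m βx βp g hΩ hβ hg hg' hd).trans
        (ENNReal.ofReal_le_ofReal (by linarith [hlb j]))
    · exact (hbc Ω m βx βp g hΩ hβ hg hg' hd).trans (ENNReal.ofReal_le_ofReal (by linarith))
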